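/- Setting. Let $X$ be a smooth oriented manifold (Hausdorff, $\sigma$-compact, e.g. compact, without boundary) of dimension $n\ge 1$, let $W\to X$ be a smooth real vector bundle of finite rank (in the application, $W=\kappa^*V\mathcal Y$ is the bundle of generalized velocities at a smooth configuration $\kappa$ of a fiber bundle $\mathcal Y\to X$), and let $k\ge 1$. A subbody is a compact $n$-dimensional submanifold $R\subset X$ with boundary, possibly with corners. A variational hyper-stress is a smooth section $S$ of $L(J^kW,\bigwedge^nT^*X)$; a non-holonomic stress is a smooth section $P$ of $L(J^1(J^{k-1}W),\bigwedge^nT^*X)$. Let $\iota^k_{1,k-1}:J^kW\to J^1(J^{k-1}W)$, $j^kw(x)\mapsto j^1(j^{k-1}w)(x)$, be the natural inclusion; $S$ is consistent with $P$ if $S=\iota^{k*}_{1,k-1}(P)=P\circ\iota^k_{1,k-1}$. A smooth system of hyper-forces $(\mathbf b,\{\mathbf t_R\})$ consists of a smooth section $\mathbf b$ of $L(J^{k-1}W,\bigwedge^nT^*X)$ (the body hyper-force) and, for each subbody $R$, a section $\mathbf t_R$ of $L(J^{k-1}W|_{\partial R},\bigwedge^{n-1}T^*\partial R)$ that is smooth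 on each face of $\partial R$ (the hyper-traction). Its force functionals are $F_R(w)=\int_R\mathbf b\cdot j^{k-1}w+\int_{\partial R}\mathbf t_R\cdot j^{k-1}w$ for $C^k$ sections $w$ of $W$. The system is consistent if (i) there is a smooth section $\xi$ of $L(J^1(J^{k-1}W),\bigwedge^nT^*X)$ with $\bigl|\int_{\partial R}\mathbf t_R\cdot u\bigr|\le\int_R|\xi\cdot j^1u|$ for all subbodies $R$ and all smooth sections $u$ of $J^{k-1}W$, and (ii) there is a smooth field $\Sigma$ of alternating $(n-1)$-linear maps $(T_xX)^{n-1}\to(J^{k-1}W)_x^*$ such that $\mathbf t_R(a)(v_1,\dots,v_{n-1})=\Sigma_x(v_1,\dots,v_{n-1})(a)$ for all $R$, $x\in\partial R$, $a\in(J^{k-1}W)_x$ and $v_1,\dots,v_{n-1}\in T_x\partial R$. The stress $P$ represents the force functionals of the system if $F_R(w)=\int_RP\cdot j^1(j^{k-1}w)$ for all subbodies $R$ and all $C^k$ sections $w$ of $W$; it represents the system in the extended sense if $\int_R\mathbf b\cdot A+\int_{\partial R}\mathbf t_R\cdot A=\int_RP\cdot j^1A$ for all $R$ and all $C^1$ sections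 $A$ of $J^{k-1}W$ (not only for $A=j^{k-1}w$). Proposition. Suppose that $S$ is consistent with $P$. (1) If $P$ represents the force functionals of a smooth system of hyper-forces $(\mathbf b,\{\mathbf t_R\})$, then $S$ determines them: $$F_R(w)=\int_RS\cdot j^kw$$ for every subbody $R$ and every $C^k$ section $w$ of $W$. (2) For $k\ge 2$, $S$ determines neither the body hyper-force nor the hyper-tractions: if $X$ is non-empty, $W$ has positive rank, and $P$ represents, in the extended sense, a consistent system $(\mathbf b,\{\mathbf t_R\})$, then there are a non-holonomic stress $P'$ with $\iota^{k*}_{1,k-1}(P')=S$ and a consistent system $(\mathbf b',\{\mathbf t'_R\})$, represented by $P'$ in the extended sense, such that $\mathbf b'\neq\mathbf b$ and $\mathbf t'_R\neq\mathbf t_R$ for some subbody $R$. -/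

import Mathlib

open Set Filter Topology MeasureTheory
open scoped Manifold ContDiff

noncomputable section

namespace HyperStress

/-- The model space `ℝⁿ` of the base manifold, with `n = d + 1 ≥ 1`. -/
abbrev Model (d : ℕ) : Type := EuclideanSpace ℝ (Fin (d + 1))

theorem fderiv_iteratedFDeriv_eq_zero {E M : Type*} [NormedAddCommGroup E] [NormedSpace ℝ E]
    [NormedAddCommGroup M] [NormedSpace ℝ M] {f : E → M} {a : E} {j : ℕ}
    (h : iteratedFDeriv ℝ (j + 1) f a = 0) : fderiv ℝ (iteratedFDeriv ℝ j f) a = 0 := by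
  ext v u
  have h2 := iteratedFDeriv_succ_apply_left (𝕜 := ℝ) (f := f) (x := a) (n := j)
    (Fin.cons v u : Fin (j + 1) → E)
  rw [h] at h2
  simpa using h2.symm

theorem iteratedFDeriv_one_eq_zero {E M : Type*} [NormedAddCommGroup E] [NormedSpace ℝ E]
    [NormedAddCommGroup M] [NormedSpace ℝ M] {f : E → M} {a : E}
    (h : fderiv ℝ f a = 0) : iteratedFDeriv ℝ 1 f a = 0 := by
  rw [← norm_eq_zero, norm_iteratedFDeriv_one, h, norm_zero]

section Jets

variable {d : ℕ} {X : Type*} [TopologicalSpace X] [ChartedSpace (Model d) X]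

/-- Coordinates for a family `J` of vector spaces over the manifold `X`: for every `x₀`, an open
set `dom x₀` around `x₀`, inside the domain of the chart at `x₀`, and linear fibre coordinates
`coord x₀ y` on `J y`, with values in the fixed space `M`, that are meaningful for `y ∈ dom x₀`.
Only two families of such coordinates are used below: those of a smooth vector bundle
(`bundleCoords`) and those that they induce on jets (`jetCoords`). -/
structure LocalCoords (d : ℕ) {X : Type*} [TopologicalSpace X] [ChartedSpace (Model d) X]
    (J : X → Type*) [∀ x, AddCommGroup (J x)] [∀ x, Module ℝ (J x)]
    (M : Type*) [NormedAddCommGroup M] [NormedSpace ℝ M] where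
  dom : X → Set X
  isOpen_dom : ∀ x₀ : X, IsOpen (dom x₀)
  mem_dom : ∀ x₀ : X, x₀ ∈ dom x₀
  dom_subset : ∀ x₀ : X, dom x₀ ⊆ (chartAt (Model d) x₀).source
  coord : ∀ x₀ y : X, J y →ₗ[ℝ] M

namespace LocalCoords

variable {J : X → Type*} [∀ x, AddCommGroup (J x)] [∀ x, Module ℝ (J x)]
  {M : Type*} [NormedAddCommGroup M] [NormedSpace ℝ M] (C : LocalCoords d J M)

/-- The part of `ℝⁿ` that corresponds to `dom x₀` in the chart at `x₀`. -/
def coordDom (x₀ : X) : Set (Model d) :=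
  (chartAt (Model d) x₀).target ∩ (chartAt (Model d) x₀).symm ⁻¹' C.dom x₀

theorem isOpen_coordDom (x₀ : X) : IsOpen (C.coordDom x₀) :=
  (chartAt (Model d) x₀).isOpen_inter_preimage_symm (C.isOpen_dom x₀)

theorem chart_mem_coordDom {x₀ y : X} (hy : y ∈ C.dom x₀) :
    chartAt (Model d) x₀ y ∈ C.coordDom x₀ := by
  refine ⟨(chartAt (Model d) x₀).map_source (C.dom_subset x₀ hy), ?_⟩
  simpa [(chartAt (Model d) x₀).left_inv (C.dom_subset x₀ hy)] using hy

/-- The local representative of a section in the coordinates at `x₀`. -/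
def rep (A : ∀ y, J y) (x₀ : X) (z : Model d) : M :=
  C.coord x₀ ((chartAt (Model d) x₀).symm z) (A ((chartAt (Model d) x₀).symm z))

/-- The space of sections of class `C^r`. -/
def CkSection (r : WithTop ℕ∞) : Submodule ℝ (∀ y, J y) where
  carrier := {A | ∀ x₀, ContDiffOn ℝ r (C.rep A x₀) (C.coordDom x₀)}
  zero_mem' x₀ := by
    refine contDiffOn_const (c := (0 : M)) |>.congr fun z _ => ?_
    simp [rep]
  add_mem' {A B} hA hB x₀ := by
    refine ((hA x₀).add (hB x₀)).congr fun z _ => ?_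
    simp [rep]
  smul_mem' c A hA x₀ := by
    refine ((hA x₀).const_smul c).congr fun z _ => ?_
    simp [rep]

theorem CkSection_mono {r s : WithTop ℕ∞} (h : r ≤ s) : C.CkSection s ≤ C.CkSection r :=
  fun _ hA x₀ => (hA x₀).of_le h

theorem contDiffAt_rep {r : WithTop ℕ∞} (A : C.CkSection r) {x₀ : X} {z : Model d}
    (hz : z ∈ C.coordDom x₀) : ContDiffAt ℝ r (C.rep A.1 x₀) z :=
  (A.2 x₀).contDiffAt ((C.isOpen_coordDom x₀).mem_nhds hz)

/-- The partial derivatives of order `j ≤ k`, in the coordinates at `x₀`, of a section of class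
`C^k` at the point `y ∈ dom x₀`. -/
def derivs (k : ℕ) {x₀ y : X} (hy : y ∈ C.dom x₀) :
    C.CkSection k →ₗ[ℝ] (∀ j : Fin (k + 1), (Model d) [×(j : ℕ)]→L[ℝ] M) where
  toFun A j := iteratedFDeriv ℝ j (C.rep A.1 x₀) (chartAt (Model d) x₀ y)
  map_add' A B := by
    funext j
    have hj : ((j : ℕ) : WithTop ℕ∞) ≤ (k : WithTop ℕ∞) := by
      exact_mod_cast Nat.lt_succ_iff.mp j.2
    have hz := C.chart_mem_coordDom hy
    have hAB : C.rep (A + B).1 x₀ = C.rep A.1 x₀ + C.rep B.1 x₀ := by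
      funext z; simp [rep]
    rw [hAB]
    exact iteratedFDeriv_add_apply ((C.contDiffAt_rep A hz).of_le hj)
      ((C.contDiffAt_rep B hz).of_le hj)
  map_smul' c A := by
    funext j
    have hj : ((j : ℕ) : WithTop ℕ∞) ≤ (k : WithTop ℕ∞) := by
      exact_mod_cast Nat.lt_succ_iff.mp j.2
    have hz := C.chart_mem_coordDom hy
    have hA : C.rep (c • A).1 x₀ = c • C.rep A.1 x₀ := by
      funext z; simp [rep]
    rw [hA]
    exact iteratedFDeriv_const_smul_apply ((C.contDiffAt_rep A hz).of_le hj)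

/-- The sections of class `C^k` whose `k`-jet at `y` is zero: all their partial derivatives of
order at most `k` vanish at `y`. -/
def vanish (k : ℕ) (y : X) : Submodule ℝ (C.CkSection k) :=
  ⨅ (x₀ : X) (hy : y ∈ C.dom x₀), LinearMap.ker (C.derivs k hy)

theorem mem_vanish {k : ℕ} {y : X} {A : C.CkSection k} :
    A ∈ C.vanish k y ↔ ∀ x₀, ∀ hy : y ∈ C.dom x₀, C.derivs k hy A = 0 := by
  simp [vanish, Submodule.mem_iInf]

/-- The fibre at `y` of the bundle of `k`-jets. -/
def Jet (k : ℕ) (y : X) : Type _ := C.CkSection k ⧸ C.vanish k y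

instance (k : ℕ) (y : X) : AddCommGroup (C.Jet k y) :=
  inferInstanceAs (AddCommGroup (C.CkSection k ⧸ C.vanish k y))

instance (k : ℕ) (y : X) : Module ℝ (C.Jet k y) :=
  inferInstanceAs (Module ℝ (C.CkSection k ⧸ C.vanish k y))

/-- The `k`-jet at `y` of a section of class `C^k`. -/
def jetAt (k : ℕ) (y : X) : C.CkSection k →ₗ[ℝ] C.Jet k y := (C.vanish k y).mkQ

open Classical in
/-- The coordinates of jets: the partial derivatives of order at most `k`. -/
def jetCoords (k : ℕ) :
    LocalCoords d (C.Jet k) (∀ j : Fin (k + 1), (Model d) [×(j : ℕ)]→L[ℝ] M) where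
  dom := C.dom
  isOpen_dom := C.isOpen_dom
  mem_dom := C.mem_dom
  dom_subset := C.dom_subset
  coord x₀ y :=
    if hy : y ∈ C.dom x₀ then
      (C.vanish k y).liftQ (C.derivs k hy) (fun _ hA => C.mem_vanish.mp hA x₀ hy)
    else 0

theorem jetCoords_coord_jetAt (k : ℕ) {x₀ y : X} (hy : y ∈ C.dom x₀) (A : C.CkSection k) :
    (C.jetCoords k).coord x₀ y (C.jetAt k y A) = C.derivs k hy A := by
  have h : (C.jetCoords k).coord x₀ y =
      (C.vanish k y).liftQ (C.derivs k hy) (fun _ hA => C.mem_vanish.mp hA x₀ hy) :=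
    dif_pos hy
  rw [h]
  exact Submodule.liftQ_apply _ _ _

/-- The local representative of `y ↦ j^k w (y)` consists of the partial derivatives of `w`. -/
theorem rep_jetAt (k : ℕ) (A : C.CkSection k) {x₀ : X} {z : Model d} (hz : z ∈ C.coordDom x₀) :
    (C.jetCoords k).rep (fun y => C.jetAt k y A) x₀ z =
      fun j : Fin (k + 1) => iteratedFDeriv ℝ j (C.rep A.1 x₀) z := by
  unfold rep
  rw [C.jetCoords_coord_jetAt k hz.2]
  funext j
  change iteratedFDeriv ℝ j (C.rep A.1 x₀)
    (chartAt (Model d) x₀ ((chartAt (Model d) x₀).symm z)) = _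
  rw [(chartAt (Model d) x₀).right_inv hz.1]
  rfl

/-- A section of class `C^(k+1)`, regarded as a section of class `C^k`. -/
def lower (k : ℕ) : C.CkSection (k + 1 : ℕ) →ₗ[ℝ] C.CkSection k :=
  Submodule.inclusion (C.CkSection_mono (by exact_mod_cast Nat.le_succ k))

/-- The jet extension `w ↦ j^k w` of sections of class `C^(k+1)`; its values are sections of class
`C^1` of the bundle of `k`-jets. -/
def prolong (k : ℕ) : C.CkSection (k + 1 : ℕ) →ₗ[ℝ] (C.jetCoords k).CkSection (1 : ℕ) where
  toFun w := ⟨fun y => C.jetAt k y (C.lower k w), by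
    intro x₀
    change ContDiffOn ℝ _ _ (C.coordDom x₀)
    refine ContDiffOn.congr (f := fun z => fun j : Fin (k + 1) =>
      iteratedFDeriv ℝ j (C.rep w.1 x₀) z) ?_ fun z hz => C.rep_jetAt k (C.lower k w) hz
    refine contDiffOn_pi.mpr fun j => ?_
    intro z hz
    refine ((C.contDiffAt_rep w hz).iteratedFDeriv_right ?_).contDiffWithinAt
    have := j.2
    exact_mod_cast (by omega : 1 + (j : ℕ) ≤ k + 1)⟩
  map_add' w w' := by
    apply Subtype.ext
    funext y
    simp
  map_smul' c w := by
    apply Subtype.ext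
    funext y
    simp

theorem prolong_mem_vanish (k : ℕ) {y : X} {w : C.CkSection (k + 1 : ℕ)}
    (hw : w ∈ C.vanish (k + 1) y) : C.prolong k w ∈ (C.jetCoords k).vanish 1 y := by
  rw [mem_vanish]
  intro x₀ hy
  have hy' : y ∈ C.dom x₀ := hy
  have h := C.mem_vanish.mp hw x₀ hy'
  set a := chartAt (Model d) x₀ y with ha
  have haD : a ∈ C.coordDom x₀ := C.chart_mem_coordDom hy'
  have hd : ∀ j : ℕ, j ≤ k + 1 → iteratedFDeriv ℝ j (C.rep w.1 x₀) a = 0 := fun j hj =>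
    congrFun h ⟨j, Nat.lt_succ_of_le hj⟩
  have hrep : (C.jetCoords k).rep (C.prolong k w).1 x₀ =ᶠ[𝓝 a]
      fun z => fun j : Fin (k + 1) => iteratedFDeriv ℝ j (C.rep w.1 x₀) z :=
    Filter.eventuallyEq_of_mem ((C.isOpen_coordDom x₀).mem_nhds haD)
      fun z hz => C.rep_jetAt k (C.lower k w) hz
  have hfd : fderiv ℝ (fun z => fun j : Fin (k + 1) =>
      iteratedFDeriv ℝ j (C.rep w.1 x₀) z) a = 0 := by
    have hj0 : ∀ j : Fin (k + 1),
        HasFDerivAt (fun z => iteratedFDeriv ℝ (j : ℕ) (C.rep w.1 x₀) z)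
          (0 : Model d →L[ℝ] ((Model d) [×(j : ℕ)]→L[ℝ] M)) a := by
      intro j
      have hdiff : DifferentiableAt ℝ (iteratedFDeriv ℝ j (C.rep w.1 x₀)) a := by
        refine ((C.contDiffAt_rep w haD).iteratedFDeriv_right (m := 1) ?_).differentiableAt
          one_ne_zero
        have := j.2
        exact_mod_cast (by omega : 1 + (j : ℕ) ≤ k + 1)
      have h0 : fderiv ℝ (iteratedFDeriv ℝ j (C.rep w.1 x₀)) a = 0 := by
        exact fderiv_iteratedFDeriv_eq_zero (hd (j + 1) (by have := j.2; omega))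
      simpa [h0] using hdiff.hasFDerivAt
    have hpi : HasFDerivAt (fun z => fun j : Fin (k + 1) => iteratedFDeriv ℝ j (C.rep w.1 x₀) z)
        (0 : Model d →L[ℝ] (∀ j : Fin (k + 1), (Model d) [×(j : ℕ)]→L[ℝ] M)) a :=
      hasFDerivAt_pi'.mpr fun j => by simpa using hj0 j
    exact hpi.fderiv
  funext j
  change iteratedFDeriv ℝ j ((C.jetCoords k).rep (C.prolong k w).1 x₀) a = 0
  rw [(hrep.iteratedFDeriv ℝ j).eq_of_nhds]
  obtain ⟨j, hj⟩ := j
  interval_cases j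
  · ext v
    simp only [iteratedFDeriv_zero_apply]
    rw [hd _ (by omega)]
    rfl
  · exact iteratedFDeriv_one_eq_zero hfd

/-- The natural inclusion `J^(k+1) W → J^1 (J^k W)`, `j^(k+1) w (y) ↦ j^1 (j^k w) (y)`, of the
holonomic elements. -/
def holonomic (k : ℕ) (y : X) : C.Jet (k + 1) y →ₗ[ℝ] (C.jetCoords k).Jet 1 y :=
  (C.vanish (k + 1) y).mapQ ((C.jetCoords k).vanish 1 y) (C.prolong k)
    fun _ hw => C.prolong_mem_vanish k hw

theorem holonomic_jetAt (k : ℕ) (y : X) (w : C.CkSection (k + 1 : ℕ)) :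
    C.holonomic k y (C.jetAt (k + 1) y w) = (C.jetCoords k).jetAt 1 y (C.prolong k w) := rfl

end LocalCoords

/-- The coordinates of a smooth vector bundle: the chart and the trivialization at `x₀`. -/
def bundleCoords (d : ℕ) {X : Type*} [TopologicalSpace X] [ChartedSpace (Model d) X]
    (F : Type*) [NormedAddCommGroup F] [NormedSpace ℝ F]
    (V : X → Type*) [∀ x, AddCommGroup (V x)] [∀ x, Module ℝ (V x)]
    [∀ x, TopologicalSpace (V x)] [TopologicalSpace (Bundle.TotalSpace F V)]
    [FiberBundle F V] [VectorBundle ℝ F V] : LocalCoords d V F where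
  dom x₀ := (chartAt (Model d) x₀).source ∩ (trivializationAt F V x₀).baseSet
  isOpen_dom x₀ := (chartAt (Model d) x₀).open_source.inter (trivializationAt F V x₀).open_baseSet
  mem_dom x₀ := ⟨mem_chart_source _ x₀, FiberBundle.mem_baseSet_trivializationAt' x₀⟩
  dom_subset _ := inter_subset_left
  coord x₀ y := (trivializationAt F V x₀).linearMapAt ℝ y

/-- The sections of class `C^r` of a smooth vector bundle in the sense above are those of
Mathlib. -/
theorem mem_CkSection_bundleCoords_iff {d : ℕ} {X : Type*} [TopologicalSpace X]
    [ChartedSpace (Model d) X] [IsManifold 𝓘(ℝ, Model d) ∞ X]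
    {F : Type*} [NormedAddCommGroup F] [NormedSpace ℝ F]
    {V : X → Type*} [∀ x, AddCommGroup (V x)] [∀ x, Module ℝ (V x)]
    [∀ x, TopologicalSpace (V x)] [TopologicalSpace (Bundle.TotalSpace F V)]
    [FiberBundle F V] [VectorBundle ℝ F V] [ContMDiffVectorBundle ∞ F V 𝓘(ℝ, Model d)]
    {r : WithTop ℕ∞} (hr : r ≤ ∞) (w : ∀ x, V x) :
    w ∈ (bundleCoords d F V).CkSection r ↔
      ContMDiff 𝓘(ℝ, Model d) (𝓘(ℝ, Model d).prod 𝓘(ℝ, F)) r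
        (fun x => Bundle.TotalSpace.mk' F x (w x)) := by
  have : IsManifold 𝓘(ℝ, Model d) r X := .of_le hr
  have : ContMDiffVectorBundle r F V 𝓘(ℝ, Model d) := .of_le hr
  have hcoord : ∀ x₀ y, y ∈ (bundleCoords d F V).dom x₀ →
      (bundleCoords d F V).coord x₀ y (w y) = (trivializationAt F V x₀ ⟨y, w y⟩).2 := by
    intro x₀ y hy
    exact congrFun (Bundle.Trivialization.coe_linearMapAt_of_mem (R := ℝ) _ hy.2) _
  constructor
  · intro hw x₀
    rw [Bundle.contMDiffAt_section]
    have hm := (bundleCoords d F V).mem_dom x₀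
    have h1 : ContDiffAt ℝ r ((bundleCoords d F V).rep w x₀) (chartAt (Model d) x₀ x₀) :=
      (hw x₀).contDiffAt (((bundleCoords d F V).isOpen_coordDom x₀).mem_nhds
        ((bundleCoords d F V).chart_mem_coordDom hm))
    have h2 : ContMDiffAt 𝓘(ℝ, Model d) 𝓘(ℝ, Model d) r (chartAt (Model d) x₀) x₀ :=
      contMDiffAt_of_mem_maximalAtlas (IsManifold.chart_mem_maximalAtlas x₀)
        (mem_chart_source _ x₀)
    refine (h1.contMDiffAt.comp x₀ h2).congr_of_eventuallyEq ?_
    filter_upwards [((bundleCoords d F V).isOpen_dom x₀).mem_nhds hm] with y hy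
    rw [← hcoord x₀ y hy]
    change _ = (bundleCoords d F V).coord x₀
      ((chartAt (Model d) x₀).symm (chartAt (Model d) x₀ y)) (w _)
    rw [(chartAt (Model d) x₀).left_inv ((bundleCoords d F V).dom_subset x₀ hy)]
  · intro hw x₀ z hz
    refine ContDiffAt.contDiffWithinAt ?_
    have hy : (chartAt (Model d) x₀).symm z ∈ (bundleCoords d F V).dom x₀ := hz.2
    have h1 := ((trivializationAt F V x₀).contMDiffAt_section_iff hy.2).mp
      (hw ((chartAt (Model d) x₀).symm z))
    have h2 : ContMDiffAt 𝓘(ℝ, Model d) 𝓘(ℝ, Model d) r (chartAt (Model d) x₀).symm z :=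
      contMDiffAt_symm_of_mem_maximalAtlas (IsManifold.chart_mem_maximalAtlas x₀) hz.1
    refine ((h1.comp z h2).congr_of_eventuallyEq ?_).contDiffAt
    filter_upwards [((bundleCoords d F V).isOpen_coordDom x₀).mem_nhds hz] with z' hz'
    exact hcoord x₀ _ hz'.2

end Jets

section Forms

variable {d : ℕ} {X : Type*} [TopologicalSpace X] [ChartedSpace (Model d) X]

/-- Alternating `p`-forms on the tangent space at `x`. -/
abbrev FormAt (d : ℕ) {X : Type*} [TopologicalSpace X] [ChartedSpace (Model d) X]
    (p : ℕ) (x : X) : Type :=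
  (TangentSpace 𝓘(ℝ, Model d) x) [⋀^Fin p]→ₗ[ℝ] ℝ

/-- The coordinate vector fields of the chart `e`, at the point with coordinates `z`. -/
def frame (e : OpenPartialHomeomorph X (Model d)) (z : Model d) (j : Fin (d + 1)) :
    TangentSpace 𝓘(ℝ, Model d) (e.symm z) :=
  mfderiv 𝓘(ℝ, Model d) 𝓘(ℝ, Model d) e.symm z
    (EuclideanSpace.single j (1 : ℝ) : Model d)

/-- The differential of the chart `e` at `x`, as a map to `ℝⁿ`. -/
def chartDeriv (e : OpenPartialHomeomorph X (Model d)) (x : X) :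
    TangentSpace 𝓘(ℝ, Model d) x →L[ℝ] Model d :=
  mfderiv 𝓘(ℝ, Model d) 𝓘(ℝ, Model d) e x

variable (d X) in
/-- An orientation of `X`, given by a nowhere vanishing smooth form of top degree. Only its sign
on frames is used. -/
structure OrientationForm where
  toFun : ∀ x : X, FormAt d (d + 1) x
  smooth : ∀ x₀ : X, ContDiffOn ℝ ∞
    (fun z => toFun ((chartAt (Model d) x₀).symm z) (frame (chartAt (Model d) x₀) z))
    (chartAt (Model d) x₀).target
  ne_zero : ∀ x, toFun x ≠ 0

/-- A smooth field of linear maps `J_x → ⋀^p T_x^*X`, i.e. a smooth section of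
`L(J, ⋀^p T^*X)`: near every point, in the coordinates at any `x₀`, it is given by coefficients
that depend smoothly on the base point. -/
structure FormValued {J : X → Type*} [∀ x, AddCommGroup (J x)] [∀ x, Module ℝ (J x)]
    {M : Type*} [NormedAddCommGroup M] [NormedSpace ℝ M] (C : LocalCoords d J M) (p : ℕ) where
  toFun : ∀ x, J x →ₗ[ℝ] FormAt d p x
  smooth : ∀ x₀ : X, ∀ x ∈ C.dom x₀,
    ∃ (U : Set X) (β : Model d → M →L[ℝ] (Model d) [⋀^Fin p]→L[ℝ] ℝ),
    IsOpen U ∧ x ∈ U ∧ U ⊆ C.dom x₀ ∧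
    ContDiffOn ℝ ∞ β ((chartAt (Model d) x₀).target ∩ (chartAt (Model d) x₀).symm ⁻¹' U) ∧
    ∀ y ∈ U, ∀ (a : J y) (v : Fin p → TangentSpace 𝓘(ℝ, Model d) y),
      toFun y a v = β (chartAt (Model d) x₀ y) (C.coord x₀ y a)
        (fun i => chartDeriv (chartAt (Model d) x₀) y (v i))

end Forms

section Subbodies

variable {d : ℕ} {X : Type*} [TopologicalSpace X] [ChartedSpace (Model d) X]

/-- A chart at `x` adapted to the region `R`: in it, `R` is the corner
`{z | z i ≤ 0 for all i ∈ s}`, and `x` lies on all of the faces `{z i = 0}`, `i ∈ s`. Thus `x` is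
an interior point of `R` if `s` is empty, and a point at which the boundary of `R` is a smooth
hypersurface if `s` has one element. -/
structure CornerChart (R : Set X) (x : X) where
  e : OpenPartialHomeomorph X (Model d)
  mem_maximalAtlas : e ∈ IsManifold.maximalAtlas 𝓘(ℝ, Model d) ∞ X
  mem_source : x ∈ e.source
  s : Finset (Fin (d + 1))
  eq_zero : ∀ i ∈ s, e x i = 0
  mem_iff : ∀ y ∈ e.source, y ∈ R ↔ ∀ i ∈ s, e y i ≤ 0

variable (d X) in
/-- A subbody: a compact `n`-dimensional submanifold of `X` with boundary and, possibly,
corners. -/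
structure Subbody where
  carrier : Set X
  isCompact : IsCompact carrier
  exists_chart : ∀ x ∈ carrier, Nonempty (CornerChart (d := d) carrier x)

namespace Subbody

variable (R : Subbody d X)

/-- The chosen adapted chart at a point of the subbody. -/
def chart (x : R.carrier) : CornerChart (d := d) R.carrier (x : X) :=
  (R.exists_chart x x.2).some

/-- The tangent space at `x` of the boundary `∂R` (at a corner: of the stratum of the boundary
that contains `x`, so that every `(n-1)`-form on it vanishes). -/
def bdryTangent (x : X) : Submodule ℝ (TangentSpace 𝓘(ℝ, Model d) x) where
  carrier := {v | ∀ c : CornerChart (d := d) R.carrier x, ∀ i ∈ c.s, chartDeriv c.e x v i = 0}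
  zero_mem' c i _ := by simp
  add_mem' {v v'} hv hv' c i hi := by simp [hv c i hi, hv' c i hi]
  smul_mem' r v hv c i hi := by simp [hv c i hi]

/-- Alternating `(n-1)`-forms on the tangent space of the boundary. -/
abbrev BdryFormAt (x : X) : Type := (R.bdryTangent x) [⋀^Fin d]→ₗ[ℝ] ℝ

section Integration

variable [T2Space X] [SigmaCompactSpace X] [IsManifold 𝓘(ℝ, Model d) ∞ X]

theorem exists_partition :
    ∃ ρ : SmoothPartitionOfUnity R.carrier 𝓘(ℝ, Model d) X R.carrier,
      ρ.IsSubordinate fun x => (R.chart x).e.source :=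
  SmoothPartitionOfUnity.exists_isSubordinate 𝓘(ℝ, Model d) R.isCompact.isClosed _
    (fun x => (R.chart x).e.open_source)
    (fun x hx => mem_iUnion_of_mem ⟨x, hx⟩ (R.chart ⟨x, hx⟩).mem_source)

/-- The chosen partition of unity on `R`, subordinate to the adapted charts. -/
def partition : SmoothPartitionOfUnity R.carrier 𝓘(ℝ, Model d) X R.carrier :=
  R.exists_partition.choose

variable (o : OrientationForm d X)

/-- The integral over `R` of a density, given by its (nonnegatively homogeneous) values on
coordinate frames. -/
def integralAux (g : ∀ x : X, (Fin (d + 1) → TangentSpace 𝓘(ℝ, Model d) x) → ℝ) : ℝ :=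
  ∑ᶠ x : R.carrier, ∫ z in (R.chart x).e.target ∩ (R.chart x).e.symm ⁻¹' R.carrier,
    R.partition x ((R.chart x).e.symm z) * g ((R.chart x).e.symm z) (frame (R.chart x).e z)

/-- `∫_R η`, for an `n`-form `η`, with respect to the orientation `o`. -/
def integral (η : ∀ x : X, FormAt d (d + 1) x) : ℝ :=
  R.integralAux fun x v => Real.sign (o.toFun x v) * η x v

/-- `∫_R |η|`, for an `n`-form `η`. -/
def integralAbs (η : ∀ x : X, FormAt d (d + 1) x) : ℝ :=
  R.integralAux fun x v => |η x v|

/-- The point of the hyperplane `{z i = 0}` of `ℝⁿ` with the remaining coordinates `y`. -/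
def facePoint (i : Fin (d + 1)) (y : EuclideanSpace ℝ (Fin d)) : Model d :=
  WithLp.toLp 2 (i.insertNth (α := fun _ => ℝ) 0 y.ofLp)

open Classical in
/-- The value of a form on the boundary on `n - 1` vectors at `p`; zero unless `p` is a boundary
point and the vectors are tangent to the boundary. -/
def evalBdry (τ : ∀ x : frontier R.carrier, R.BdryFormAt (x : X)) (p : X)
    (v : Fin d → TangentSpace 𝓘(ℝ, Model d) p) : ℝ :=
  if h : p ∈ frontier R.carrier ∧ ∀ l, v l ∈ R.bdryTangent p then
    τ ⟨p, h.1⟩ (fun l => ⟨v l, h.2 l⟩)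
  else 0

/-- `∫_{∂R} τ`, for an `(n-1)`-form `τ` on the boundary, where the boundary carries the
orientation induced by `o`: a frame of the boundary is positive if, preceded by an outward pointing
vector, it is a positive frame of `X`. In an adapted chart the boundary of `R` consists of the
faces `{z i = 0}`, on which the `i`-th coordinate vector points outward. -/
def bdryIntegral (τ : ∀ x : frontier R.carrier, R.BdryFormAt (x : X)) : ℝ :=
  ∑ᶠ x : R.carrier, ∑ i ∈ (R.chart x).s,
    ∫ y in {y : EuclideanSpace ℝ (Fin d) | facePoint i y ∈ (R.chart x).e.target ∧
        (R.chart x).e.symm (facePoint i y) ∈ R.carrier},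
      R.partition x ((R.chart x).e.symm (facePoint i y)) *
        Real.sign (o.toFun _ (Fin.cons (frame (R.chart x).e (facePoint i y) i)
          (fun l => frame (R.chart x).e (facePoint i y) (i.succAbove l)))) *
        R.evalBdry τ ((R.chart x).e.symm (facePoint i y))
          (fun l => frame (R.chart x).e (facePoint i y) (i.succAbove l))

end Integration

end Subbody

end Subbodies

section Mechanics

variable {d : ℕ} {X : Type*} [TopologicalSpace X] [ChartedSpace (Model d) X]
  {V : X → Type*} [∀ x, AddCommGroup (V x)] [∀ x, Module ℝ (V x)]
  {F : Type*} [NormedAddCommGroup F] [NormedSpace ℝ F]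

/-- Variational hyper-stress fields of order `k`: smooth sections of `L(J^k W, ⋀^n T^*X)`. -/
abbrev VariationalHyperStress (W : LocalCoords d V F) (k : ℕ) :=
  FormValued (W.jetCoords k) (d + 1)

/-- Body hyper-force fields acting on `k`-jets: smooth sections of `L(J^k W, ⋀^n T^*X)`. -/
abbrev BodyHyperForce (W : LocalCoords d V F) (k : ℕ) :=
  FormValued (W.jetCoords k) (d + 1)

/-- Traction hyper-stress fields acting on `k`-jets: smooth sections of
`L(J^k W, ⋀^(n-1) T^*X)`. -/
abbrev TractionHyperStress (W : LocalCoords d V F) (k : ℕ) :=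
  FormValued (W.jetCoords k) d

/-- Non-holonomic stress fields: smooth sections of `L(J^1 (J^k W), ⋀^n T^*X)`. -/
abbrev NonHolonomicStress (W : LocalCoords d V F) (k : ℕ) :=
  FormValued ((W.jetCoords k).jetCoords 1) (d + 1)

/-- A smooth system of hyper-forces acting on `k`-jets: a body hyper-force field and, for every
subbody `R`, a hyper-traction field on `∂R`, i.e. a section of `L(J^k W, ⋀^(n-1) T^*∂R)` that is
smooth on every face of the boundary (up to the edges): locally it is the restriction to the face
of a smooth field on `X`. -/
structure HyperForceSystem (W : LocalCoords d V F) (k : ℕ) where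
  body : BodyHyperForce W k
  traction : ∀ (R : Subbody d X) (x : frontier R.carrier), W.Jet k (x : X) →ₗ[ℝ] R.BdryFormAt x
  traction_smooth : ∀ (R : Subbody d X) (x : frontier R.carrier)
    (c : CornerChart (d := d) R.carrier (x : X)), ∀ i ∈ c.s, ∃ σ : TractionHyperStress W k,
    ∀ᶠ y in 𝓝 (x : X), ∀ hy : y ∈ frontier R.carrier,
      c.e y i = 0 → (∀ j ∈ c.s, j ≠ i → c.e y j < 0) →
      ∀ (a : W.Jet k y) (v : Fin d → R.bdryTangent y),
        traction R ⟨y, hy⟩ a v = σ.toFun y a (fun l => (v l : TangentSpace 𝓘(ℝ, Model d) y))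

section

variable [T2Space X] [SigmaCompactSpace X] [IsManifold 𝓘(ℝ, Model d) ∞ X]
  (o : OrientationForm d X) {W : LocalCoords d V F} {k : ℕ}

namespace HyperForceSystem

variable (f : HyperForceSystem W k)

/-- The power `∫_R b ⋅ A + ∫_{∂R} t_R ⋅ A` of the system on a section `A` of the jet bundle. -/
def power (R : Subbody d X) (A : ∀ x, W.Jet k x) : ℝ :=
  R.integral o (fun x => f.body.toFun x (A x)) +
    R.bdryIntegral o (fun x => f.traction R x (A x))

/-- The force functional `F_R(w) = ∫_R b ⋅ j^k w + ∫_{∂R} t_R ⋅ j^k w` on a generalized velocity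
`w` of class `C^(k+1)`. -/
def force (R : Subbody d X) (w : W.CkSection (k + 1 : ℕ)) : ℝ :=
  f.power o R (W.prolong k w).1

/-- Consistency of the system of hyper-tractions, as in the generalized Cauchy theorem: boundedness,
Cauchy's postulate of locality, and regularity. -/
structure IsConsistent : Prop where
  bounded : ∃ ξ : NonHolonomicStress W k, ∀ (R : Subbody d X) (u : (W.jetCoords k).CkSection ∞),
    |R.bdryIntegral o (fun x => f.traction R x (u.1 x))| ≤
      R.integralAbs (fun x => ξ.toFun x ((W.jetCoords k).jetAt 1 x
        (Submodule.inclusion ((W.jetCoords k).CkSection_mono (by exact_mod_cast le_top)) u)))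
  local_regular : ∃ σ : TractionHyperStress W k, ∀ (R : Subbody d X) (x : frontier R.carrier)
    (a : W.Jet k (x : X)) (v : Fin d → R.bdryTangent (x : X)),
    f.traction R x a v = σ.toFun x a (fun l => (v l : TangentSpace 𝓘(ℝ, Model d) (x : X)))

end HyperForceSystem

namespace FormValued

/-- The non-holonomic stress `P` represents the force functionals of the system:
`F_R(w) = ∫_R P ⋅ j^1 (j^k w)` for every subbody `R` and every generalized velocity `w`. -/
def RepresentsForces (P : NonHolonomicStress W k) (f : HyperForceSystem W k) : Prop :=
  ∀ (R : Subbody d X) (w : W.CkSection (k + 1 : ℕ)),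
    f.force o R w =
      R.integral o fun x => P.toFun x ((W.jetCoords k).jetAt 1 x (W.prolong k w))

/-- The non-holonomic stress `P` represents the system of hyper-forces as a functional of arbitrary
sections of the jet bundle: `∫_R b ⋅ A + ∫_{∂R} t_R ⋅ A = ∫_R P ⋅ j^1 A` for every subbody `R` and
every `C^1` section `A` of `J^k W`, holonomic or not. -/
def Represents (P : NonHolonomicStress W k) (f : HyperForceSystem W k) : Prop :=
  ∀ (R : Subbody d X) (A : (W.jetCoords k).CkSection (1 : ℕ)),
    f.power o R A.1 = R.integral o fun x => P.toFun x ((W.jetCoords k).jetAt 1 x A)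

/-- The variational hyper-stress `S` is consistent with the non-holonomic stress `P`: it is the
composition of `P` with the inclusion `J^(k+1) W → J^1 (J^k W)`. -/
def ConsistentWith (S : VariationalHyperStress W (k + 1)) (P : NonHolonomicStress W k) : Prop :=
  ∀ x, S.toFun x = P.toFun x ∘ₗ W.holonomic k x

end FormValued

end

end Mechanics

end HyperStress

end

/-! Part (1) is pointwise: on holonomic jets `P` takes the values of `S`, so the two integrands
coincide.

Part (2) uses that a section `A` of a jet bundle of order at least one has a value component `A₀`
and an independent derivative component `A₁`. The equation `∂₁A₀ = A₁(e₁)` holds when `A` is the jet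
extension of a section of `W`, but not in general. Hence the stress `Q = φ λ(∂₁A₀ - A₁(e₁)) dz₁ ∧ ⋯
∧ dzₙ`, with a bump function `φ` in one chart and a functional `λ` on the fibre, annihilates
holonomic jets (`bumpStress_holonomic`), and `P + Q` is consistent with the same `S`.

The stress `Q` nevertheless carries forces. Put `τ(A) = φ λ(A₀) dz₂ ∧ ⋯ ∧ dzₙ` and `β(A) = -(∂₁φ
λ(A₀) + φ λ(A₁(e₁))) dz₁ ∧ ⋯ ∧ dzₙ`. The product rule gives `d(τ(A)) + β(A) = Q(j¹A)`
(`bump_identity`), so by Stokes' theorem `Q` represents the system with body hyper-force `β` and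
tractions restricted from `τ`. Adding it to the given system changes both parts: `β` is tested on a
section that vanishes to first order, `τ` on a face of a small coordinate cube. The new system is
consistent because it is represented: `∫_{∂R} t ⋅ u` equals `∫_R (P' ⋅ j¹u - b' ⋅ u)`, which is the
required bound (`isConsistent_ofTractionStress`).

The main labour is Stokes' theorem on subbodies with corners, needed only for forms `h dz₂ ∧ ⋯ ∧
dzₙ` supported in one chart (`Subbody.bdryIntegral_tailField`). In an adapted chart it is the
divergence theorem on a box, applied to a pull-back; the charts are glued by a partition of unity
whose differentials sum to zero on `R`. The other ingredient is that `Q`, `β` and `τ`, written in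
one chart, are smooth in all coordinates, because the components `A₀` and `A₁` transform smoothly
(`SmoothTransition.jetProj₀`, `SmoothTransition.jetProj₁`). -/

noncomputable section

namespace HyperStress

/-! ### Multilinear algebra and the divergence theorem on corners of `ℝⁿ` -/

section Euclidean

variable {d : ℕ}

/-- The coordinate vectors of `ℝⁿ`. -/
abbrev stdVec (i : Fin (d + 1)) : Model d := EuclideanSpace.single i (1 : ℝ)

/-- A form is determined by its values on tuples of basis vectors. Evaluation on these tuples is an
injective linear map into a finite product, and its linear left inverse is continuous, so smoothness
passes back from the values to the form. -/
theorem contDiffOn_alternating_of_basis {E : Type*} [NormedAddCommGroup E] [NormedSpace ℝ E]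
    {p : ℕ} {r : WithTop ℕ∞} {s : Set E} {f : E → (Model d) [⋀^Fin p]→L[ℝ] ℝ}
    (h : ∀ l : Fin p → Fin (d + 1), ContDiffOn ℝ r (fun z => f z (fun i => stdVec (l i))) s) :
    ContDiffOn ℝ r f s := by
  let ev : ((Model d) [⋀^Fin p]→L[ℝ] ℝ) →ₗ[ℝ] ((Fin p → Fin (d + 1)) → ℝ) :=
    { toFun := fun g l => g (fun i => stdVec (l i))
      map_add' := fun _ _ => rfl
      map_smul' := fun _ _ => rfl }
  have hinj : LinearMap.ker ev = ⊥ := by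
    rw [LinearMap.ker_eq_bot']
    intro g hg
    have : g.toAlternatingMap = 0 := by
      refine Module.Basis.ext_alternating (EuclideanSpace.basisFun (Fin (d + 1)) ℝ).toBasis ?_
      intro l _
      simpa using! (congrFun hg l : g (fun i => stdVec (l i)) = 0)
    ext v
    exact congrArg (fun g' : (Model d) [⋀^Fin p]→ₗ[ℝ] ℝ => g' v) this
  obtain ⟨L, hL⟩ := LinearMap.exists_leftInverse_of_injective ev hinj
  have hf : f = fun z => LinearMap.toContinuousLinearMap L (ev (f z)) := by
    funext z
    exact (LinearMap.congr_fun hL (f z)).symm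
  rw [hf]
  exact (LinearMap.toContinuousLinearMap L).contDiff.comp_contDiffOn (contDiffOn_pi.mpr h)

/-- The determinant form pulled back along a linear map to `ℝᵖ`. -/
def detForm {p : ℕ} (π : Model d →L[ℝ] (Fin p → ℝ)) : (Model d) [⋀^Fin p]→L[ℝ] ℝ :=
  { (Matrix.detRowAlternating (R := ℝ) (n := Fin p)).compLinearMap (π : Model d →ₗ[ℝ] _) with
    cont := by
      change Continuous fun v : Fin p → Model d => Matrix.det (Matrix.of fun i => π (v i))
      refine Continuous.matrix_det ?_
      refine continuous_pi fun i => ?_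
      exact π.continuous.comp (continuous_apply i) }

theorem detForm_apply {p : ℕ} (π : Model d →L[ℝ] (Fin p → ℝ)) (v : Fin p → Model d) :
    detForm π v = Matrix.det (Matrix.of fun i => π (v i)) := rfl

variable (d) in
/-- The volume form of `ℝⁿ`. -/
def volForm : (Model d) [⋀^Fin (d + 1)]→L[ℝ] ℝ :=
  detForm (ContinuousLinearMap.pi fun i => EuclideanSpace.proj i)

variable (d) in
/-- The product of all coordinate covectors but the first. -/
def tailForm : (Model d) [⋀^Fin d]→L[ℝ] ℝ :=
  detForm (ContinuousLinearMap.pi fun i => EuclideanSpace.proj i.succ)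

theorem volForm_stdVec : volForm d stdVec = 1 := by
  have : (Matrix.of fun i => (ContinuousLinearMap.pi fun i =>
      (EuclideanSpace.proj i : Model d →L[ℝ] ℝ)) (stdVec i)) = (1 : Matrix (Fin (d+1))
          (Fin (d+1)) ℝ) := by
    ext i j
    simp [Matrix.one_apply, eq_comm]
  rw [volForm, detForm_apply, this, Matrix.det_one]

theorem tailForm_stdVec_succ : tailForm d (fun l => stdVec l.succ) = 1 := by
  have : (Matrix.of fun i => (ContinuousLinearMap.pi fun i : Fin d =>
      (EuclideanSpace.proj i.succ : Model d →L[ℝ] ℝ)) (stdVec i.succ)) =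
      (1 : Matrix (Fin d) (Fin d) ℝ) := by
    ext i j
    simp [Matrix.one_apply, eq_comm]
  rw [tailForm, detForm_apply, this, Matrix.det_one]

theorem tailForm_eq_zero {v : Fin d → Model d} {l : Fin d} (h : v l = stdVec 0) :
    tailForm d v = 0 := by
  rw [tailForm, detForm_apply]
  refine Matrix.det_eq_zero_of_row_eq_zero l fun j => ?_
  simp [h]

/-- Forms of top degree make up a line. It suffices to compare on injective tuples of basis vectors;
these are permutations of the frame, and both sides acquire the same sign. -/
theorem topForm_eq_volForm {n : ℕ} (g : (Model n) [⋀^Fin (n + 1)]→ₗ[ℝ] ℝ) (v : Fin (n + 1) →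
    Model n) :
    g v = g stdVec * volForm n v := by
  have : g = g stdVec • (volForm n).toAlternatingMap := by
    refine Module.Basis.ext_alternating (EuclideanSpace.basisFun (Fin (n + 1)) ℝ).toBasis ?_
    intro l hl
    obtain ⟨σ, rfl⟩ : ∃ σ : Equiv.Perm (Fin (n + 1)), ⇑σ = l :=
      ⟨Equiv.ofBijective l (Finite.injective_iff_bijective.mp hl), rfl⟩
    have e1 : (fun i => (EuclideanSpace.basisFun (Fin (n + 1)) ℝ).toBasis (σ i)) =
        (stdVec ∘ σ : Fin (n + 1) → Model n) := by
      funext i; simp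
    rw [e1, AlternatingMap.map_perm, AlternatingMap.map_perm]
    have := volForm_stdVec (d := n)
    simp only [AlternatingMap.smul_apply, ContinuousAlternatingMap.coe_toAlternatingMap, this]
    simp
  calc g v = (g stdVec • (volForm n).toAlternatingMap) v := by rw [← this]
    _ = _ := rfl

theorem volForm_clm (T : Model d →L[ℝ] Model d) : volForm d (fun i => T (stdVec i)) = T.det := by
  have h : volForm d (fun i => T (stdVec i)) =
      Matrix.det (LinearMap.toMatrix (EuclideanSpace.basisFun (Fin (d + 1)) ℝ).toBasis
        (EuclideanSpace.basisFun (Fin (d + 1)) ℝ).toBasis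
            (T : Model d →ₗ[ℝ] Model d)).transpose := by
    rw [volForm, detForm_apply]
    congr 1
  rw [h, Matrix.det_transpose, LinearMap.det_toMatrix]

/-- In the alternating sum for the exterior derivative only the index `0` survives: omitting any
other index leaves the first coordinate vector among the arguments, and `tailForm` annihilates it.
-/
theorem extDeriv_smul_tailForm {h : Model d → ℝ} {z : Model d} (hh : DifferentiableAt ℝ h z)
    (v : Fin (d + 1) → Model d) :
    extDeriv (fun z => h z • tailForm d) z v = fderiv ℝ h z (stdVec 0) * volForm d v := by
  have hd : DifferentiableAt ℝ (fun z => h z • tailForm d) z := hh.smul_const _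
  have key := topForm_eq_volForm (extDeriv (fun z => h z • tailForm d) z).toAlternatingMap v
  have h1 : extDeriv (fun z => h z • tailForm d) z stdVec = fderiv ℝ h z (stdVec 0) := by
    rw [extDeriv_apply hd, Finset.sum_eq_single 0]
    · have : (fun x => (h x • tailForm d) ((0 : Fin (d + 1)).removeNth stdVec)) = h := by
        funext x
        have := tailForm_stdVec_succ (d := d)
        simp only [ContinuousAlternatingMap.smul_apply]
        have e : ((0 : Fin (d + 1)).removeNth stdVec : Fin d → Model d) =
            fun l => stdVec l.succ := by
          funext l; simp [Fin.removeNth]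
        rw [e, this]; simp
      rw [this]; simp
    · intro i _ hi
      have : (fun x => (h x • tailForm d) (i.removeNth stdVec)) = fun _ => 0 := by
        funext x
        obtain ⟨l, hl⟩ := Fin.exists_succAbove_eq (Ne.symm hi)
        have e : tailForm d (i.removeNth stdVec) = 0 :=
          tailForm_eq_zero (l := l) (by simp [Fin.removeNth, hl])
        simp [e]
      rw [this]; simp
    · simp
  calc _ = extDeriv (fun z => h z • tailForm d) z stdVec * volForm d v := key
    _ = _ := by rw [h1]

theorem facePoint_apply (i j : Fin (d + 1)) (y : EuclideanSpace ℝ (Fin d)) :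
    Subbody.facePoint i y j = i.insertNth (α := fun _ => ℝ) 0 y.ofLp j := rfl

theorem facePoint_apply_same (i : Fin (d + 1)) (y : EuclideanSpace ℝ (Fin d)) :
    Subbody.facePoint i y i = 0 := by simp [facePoint_apply]

theorem facePoint_apply_succAbove (i : Fin (d + 1)) (l : Fin d) (y : EuclideanSpace ℝ (Fin d)) :
    Subbody.facePoint i y (i.succAbove l) = y l := by simp [facePoint_apply]

theorem continuous_facePoint (i : Fin (d + 1)) :
    Continuous (Subbody.facePoint i : EuclideanSpace ℝ (Fin d) → Model d) := by
  refine (PiLp.continuous_toLp 2 _).comp ?_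
  refine continuous_pi fun j => ?_
  refine Fin.succAboveCases i ?_ (fun l => ?_) j
  · simpa using continuous_const
  · simpa using (EuclideanSpace.proj l : EuclideanSpace ℝ (Fin d) →L[ℝ] ℝ).continuous

/-- By compactness of the supports the corner may be replaced by a large box, on which the
divergence theorem applies. Only the faces at height `0` meet the supports. -/
theorem integral_corner_divergence (s : Finset (Fin (d + 1))) {G : Fin (d + 1) → Model d → ℝ}
    (hG : ∀ i, ContDiff ℝ 1 (G i)) (hc : ∀ i, HasCompactSupport (G i)) :
    ∫ z in {z : Model d | ∀ i ∈ s, z i ≤ 0}, ∑ i, fderiv ℝ (G i) z (stdVec i) =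
      ∑ i ∈ s, ∫ y in {y : EuclideanSpace ℝ (Fin d) | ∀ j ∈ s, Subbody.facePoint i y j ≤ 0},
        G i (Subbody.facePoint i y) := by
  classical
  obtain ⟨L, hL0, hL⟩ : ∃ L : ℝ, 0 < L ∧ ∀ i, ∀ z : Model d, (∃ j, L ≤ |z j|) → z ∉ tsupport
      (G i) := by
    have hK : IsCompact (⋃ i, tsupport (G i)) := isCompact_iUnion fun i => hc i
    obtain ⟨L, hL⟩ := hK.isBounded.exists_norm_le
    -- The summand `1` puts a point with some coordinate of size at least the new bound strictly
    -- outside the ball that contains all supports.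
    refine ⟨|L| + 1, by positivity, fun i z ⟨j, hj⟩ hz => ?_⟩
    have h1 := hL z (mem_iUnion_of_mem i hz)
    have h2 := PiLp.norm_apply_le z j
    rw [Real.norm_eq_abs] at h2
    have := le_abs_self L
    linarith
  have hG0 : ∀ i z, (∃ j, L ≤ |z j|) → G i z = 0 := fun i z h => image_eq_zero_of_notMem_tsupport
      (hL i z h)
  have hD0 : ∀ i z, (∃ j, L ≤ |z j|) → fderiv ℝ (G i) z = 0 := fun i z h =>
    image_eq_zero_of_notMem_tsupport fun h' => hL i z h (tsupport_fderiv_subset ℝ h')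
  -- The box ends at `0` in the directions of `s`, where the corner has its faces, and beyond the
  -- supports in all other directions.
  let a : Fin (d + 1) → ℝ := fun _ => -L
  let b : Fin (d + 1) → ℝ := fun i => if i ∈ s then 0 else L
  have hab : a ≤ b := fun i => by
    simp only [a, b]; split_ifs <;> linarith
  have hlp : ContDiff ℝ 1 (fun x : Fin (d + 1) → ℝ => (WithLp.toLp 2 x : Model d)) :=
    (PiLp.contDiff_toLp)
  let T : (Fin (d + 1) → ℝ) →L[ℝ] Model d := (PiLp.continuousLinearEquiv 2 ℝ (fun _ : Fin
      (d + 1) => ℝ)).symm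
  have hT : ∀ x, T x = WithLp.toLp 2 x := fun _ => rfl
  have key := integral_divergence_of_hasFDerivAt_off_countable' a b hab
    (fun i x => G i (WithLp.toLp 2 x)) (fun i x => (fderiv ℝ (G i) (WithLp.toLp 2 x)).comp T) ∅
    countable_empty (fun i => ((hG i).continuous.comp (PiLp.continuous_toLp 2 _)).continuousOn)
    (fun x _ i => by
      have h1 : HasFDerivAt (G i) (fderiv ℝ (G i) (T x)) (T x) :=
        ((hG i).differentiable one_ne_zero _).hasFDerivAt
      exact h1.comp x T.hasFDerivAt)
    (by
      refine Continuous.integrableOn_Icc (continuous_finsetSum _ fun i _ => ?_)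
      have h1 : Continuous fun x => fderiv ℝ (G i) (T x) :=
        ((hG i).continuous_fderiv one_ne_zero).comp T.continuous
      exact h1.clm_apply continuous_const)
  have hTs : ∀ i, T (Pi.single i 1) = stdVec i := fun i => rfl
  have mp := (PiLp.volume_preserving_toLp (Fin (d + 1)))
  have me : MeasurableEmbedding (WithLp.toLp 2 : (Fin (d + 1) → ℝ) → Model d) :=
    (MeasurableEquiv.toLp 2 (Fin (d + 1) → ℝ)).measurableEmbedding
  have mp' := (PiLp.volume_preserving_toLp (Fin d))
  have me' : MeasurableEmbedding (WithLp.toLp 2 : (Fin d → ℝ) → EuclideanSpace ℝ (Fin d)) :=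
    (MeasurableEquiv.toLp 2 (Fin d → ℝ)).measurableEmbedding
  rw [← mp.setIntegral_preimage_emb me]
  have lhs : ∫ x in (WithLp.toLp 2 : (Fin (d + 1) → ℝ) → Model d) ⁻¹' {z : Model d |
      ∀ i ∈ s, z i ≤ 0},
      ∑ i, fderiv ℝ (G i) (WithLp.toLp 2 x) (stdVec i) =
      ∫ x in Icc a b, ∑ i, fderiv ℝ (G i) (WithLp.toLp 2 x) (stdVec i) := by
    refine setIntegral_eq_of_subset_of_forall_sdiff_eq_zero ?_ ?_ ?_
    · refine me.measurable (IsClosed.measurableSet ?_)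
      simp only [ofPred_forall]
      exact isClosed_iInter fun i => isClosed_iInter fun _ =>
        isClosed_le (EuclideanSpace.proj i : Model d →L[ℝ] ℝ).continuous continuous_const
    · intro x hx i hi
      have := hx.2 i
      simp only [b, if_pos hi] at this
      exact this
    · intro x ⟨hx, hx'⟩
      refine Finset.sum_eq_zero fun i _ => ?_
      rw [hD0 i]; · simp
      by_contra hcon
      push Not at hcon
      refine hx' ⟨fun j => ?_, fun j => ?_⟩
      · exact (abs_lt.mp (hcon j)).1.le
      · simp only [b]
        split_ifs with hj
        · exact hx j hj
        · exact (abs_lt.mp (hcon j)).2.le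
  rw [lhs]
  simp only [ContinuousLinearMap.comp_apply, hTs] at key
  -- Each index contributes a front face minus a back face. The back faces and the front faces with
  -- `i ∉ s` lie at distance `L`, where the fields vanish.
  rw [key, ← Finset.sum_subset (Finset.subset_univ s)]
  · refine Finset.sum_congr rfl fun i hi => ?_
    rw [setIntegral_eq_zero_of_forall_eq_zero (t := Icc (a ∘ i.succAbove) (b ∘ i.succAbove))
      (f := fun x => G i (WithLp.toLp 2 (i.insertNth (a i) x))), sub_zero,
      ← mp'.setIntegral_preimage_emb me']
    · have hbi : b i = 0 := if_pos hi
      rw [hbi]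
      symm
      refine setIntegral_eq_of_subset_of_forall_sdiff_eq_zero ?_ ?_ ?_
      · refine me'.measurable (IsClosed.measurableSet ?_)
        simp only [ofPred_forall]
        exact isClosed_iInter fun j => isClosed_iInter fun _ =>
          isClosed_le ((EuclideanSpace.proj j : Model d →L[ℝ] ℝ).continuous.comp
            (continuous_facePoint i)) continuous_const
      · intro x hx j hj
        refine Fin.succAboveCases i (fun h => ?_) (fun l h => ?_) j hj
        · rw [facePoint_apply_same]
        · rw [facePoint_apply_succAbove]
          have := hx.2 l
          simp only [b, Function.comp, if_pos h] at this
          exact this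
      · intro x ⟨hx, hx'⟩
        apply hG0
        by_contra hcon
        push Not at hcon
        refine hx' ⟨fun l => ?_, fun l => ?_⟩
        · have := hcon (i.succAbove l)
          rw [facePoint_apply_succAbove] at this
          exact (abs_lt.mp this).1.le
        · have := hcon (i.succAbove l)
          rw [facePoint_apply_succAbove] at this
          simp only [b, Function.comp]
          split_ifs with hj
          · have := hx _ hj
            rwa [facePoint_apply_succAbove] at this
          · exact (abs_lt.mp this).2.le
    · intro x _
      apply hG0
      exact ⟨i, by simp [a]; exact le_abs_self L⟩
  · intro i _ hi
    have hbi : b i = L := if_neg hi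
    rw [setIntegral_eq_zero_of_forall_eq_zero, setIntegral_eq_zero_of_forall_eq_zero, sub_zero]
    · intro x _
      apply hG0
      exact ⟨i, by simp [a]; exact le_abs_self L⟩
    · intro x _
      apply hG0
      exact ⟨i, by simp [hbi]; exact le_abs_self L⟩

end Euclidean

/-! ### Transition maps, frames and forms of top degree -/

section Charts

variable {d : ℕ} {X : Type*} [TopologicalSpace X]

/-- The domain of the transition map between two charts. -/
def transDom (e e' : OpenPartialHomeomorph X (Model d)) : Set (Model d) :=
  e.target ∩ e.symm ⁻¹' e'.source

theorem isOpen_transDom (e e' : OpenPartialHomeomorph X (Model d)) : IsOpen (transDom e e') :=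
  e.isOpen_inter_preimage_symm e'.open_source

theorem trans_mem_transDom {e e' : OpenPartialHomeomorph X (Model d)} {z : Model d}
    (hz : z ∈ transDom e e') : e' (e.symm z) ∈ transDom e' e := by
  refine ⟨e'.map_source hz.2, ?_⟩
  rw [mem_preimage, e'.left_inv hz.2]
  exact e.map_target hz.1

theorem mem_transDom {e e' : OpenPartialHomeomorph X (Model d)} {y : X}
    (h : y ∈ e.source) (h' : y ∈ e'.source) : e y ∈ transDom e e' :=
  ⟨e.map_source h, by rwa [mem_preimage, e.left_inv h]⟩

variable {e e' : OpenPartialHomeomorph X (Model d)}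

theorem trans_self_fderiv {z : Model d} (hz : z ∈ e.target) :
    fderiv ℝ (e ∘ e.symm) z = ContinuousLinearMap.id ℝ (Model d) := by
  have : e ∘ e.symm =ᶠ[𝓝 z] id := by
    filter_upwards [e.open_target.mem_nhds hz] with z' hz'
    exact e.right_inv hz'
  rw [this.fderiv_eq, fderiv_id]

variable [ChartedSpace (Model d) X]

section

variable (he : e ∈ IsManifold.maximalAtlas 𝓘(ℝ, Model d) ∞ X)
  (he' : e' ∈ IsManifold.maximalAtlas 𝓘(ℝ, Model d) ∞ X)
include he

theorem mdifferentiableAt_chart {y : X} (hy : y ∈ e.source) :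
    MDifferentiableAt 𝓘(ℝ, Model d) 𝓘(ℝ, Model d) e y :=
  (contMDiffAt_of_mem_maximalAtlas he hy).mdifferentiableAt (by simp)

theorem mdifferentiableAt_chart_symm {z : Model d} (hz : z ∈ e.target) :
    MDifferentiableAt 𝓘(ℝ, Model d) 𝓘(ℝ, Model d) e.symm z :=
  (contMDiffAt_symm_of_mem_maximalAtlas he hz).mdifferentiableAt (by simp)

include he'

theorem contDiffOn_trans : ContDiffOn ℝ ∞ (e' ∘ e.symm) (transDom e e') := by
  rw [← contMDiffOn_iff_contDiffOn]
  exact (contMDiffOn_of_mem_maximalAtlas he').comp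
    ((contMDiffOn_symm_of_mem_maximalAtlas he).mono inter_subset_left) fun z hz => hz.2

theorem contDiffAt_trans {z : Model d} (hz : z ∈ transDom e e') :
    ContDiffAt ℝ ∞ (e' ∘ e.symm) z :=
  (contDiffOn_trans he he').contDiffAt ((isOpen_transDom e e').mem_nhds hz)

theorem hasFDerivAt_trans {z : Model d} (hz : z ∈ transDom e e') :
    HasFDerivAt (e' ∘ e.symm) (fderiv ℝ (e' ∘ e.symm) z) z :=
  ((contDiffAt_trans he he' hz).differentiableAt (by simp)).hasFDerivAt

theorem contDiffOn_fderiv_trans :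
    ContDiffOn ℝ ∞ (fderiv ℝ (e' ∘ e.symm)) (transDom e e') :=
  (contDiffOn_trans he he').fderiv_of_isOpen (isOpen_transDom e e') (by simp)

theorem chartDeriv_comp_symm {z : Model d} (hz : z ∈ transDom e e') (v : Model d) :
    chartDeriv e' (e.symm z) (mfderiv 𝓘(ℝ, Model d) 𝓘(ℝ, Model d) e.symm z v) =
      fderiv ℝ (e' ∘ e.symm) z v := by
  rw [← mfderiv_eq_fderiv]
  exact (mfderiv_comp_apply z (mdifferentiableAt_chart he' hz.2)
    (mdifferentiableAt_chart_symm he hz.1) v).symm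

theorem chartDeriv_frame {z : Model d} (hz : z ∈ transDom e e') (j : Fin (d + 1)) :
    chartDeriv e' (e.symm z) (frame e z j) = fderiv ℝ (e' ∘ e.symm) z (stdVec j) :=
  chartDeriv_comp_symm he he' hz _

/-- This is the chain rule for `e.symm`, factored locally through the transition map. The two
vectors are attached to equal points given by different expressions, hence the comparison inside the
model space. -/
theorem mfderiv_symm_eq {z : Model d} (hz : z ∈ transDom e e') (v : Model d) :
    (mfderiv 𝓘(ℝ, Model d) 𝓘(ℝ, Model d) e.symm z v : Model d) =
      (mfderiv 𝓘(ℝ, Model d) 𝓘(ℝ, Model d) e'.symm ((e' ∘ e.symm) z)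
        (fderiv ℝ (e' ∘ e.symm) z v) : Model d) := by
  have hev : e.symm =ᶠ[𝓝 z] e'.symm ∘ (e' ∘ e.symm) := by
    filter_upwards [(isOpen_transDom e e').mem_nhds hz] with z' hz'
    exact (e'.left_inv hz'.2).symm
  have h1 : (mfderiv 𝓘(ℝ, Model d) 𝓘(ℝ, Model d) e.symm z : Model d →L[ℝ] Model d) =
      (mfderiv 𝓘(ℝ, Model d) 𝓘(ℝ, Model d) (e'.symm ∘ (e' ∘ e.symm)) z : Model d →L[ℝ] Model d) :=
    hev.mfderiv_eq
  have h2 : MDifferentiableAt 𝓘(ℝ, Model d) 𝓘(ℝ, Model d) (e' ∘ e.symm) z :=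
    (hasFDerivAt_trans he he' hz).differentiableAt.mdifferentiableAt
  have h3 := mfderiv_comp_apply z
    (mdifferentiableAt_chart_symm he' (trans_mem_transDom hz).1) h2 v
  rw [mfderiv_eq_fderiv] at h3
  exact (DFunLike.congr_fun h1 v).trans h3

theorem fderiv_trans_comp_chartDeriv {y : X} (hy : y ∈ e.source) (hy' : y ∈ e'.source)
    (v : TangentSpace 𝓘(ℝ, Model d) y) :
    chartDeriv e' y v = fderiv ℝ (e' ∘ e.symm) (e y) (chartDeriv e y v) := by
  have hev : e' =ᶠ[𝓝 y] (e' ∘ e.symm) ∘ e := by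
    filter_upwards [e.open_source.mem_nhds hy] with y' hy'
    exact (congrArg e' (e.left_inv hy')).symm
  have h1 : (mfderiv 𝓘(ℝ, Model d) 𝓘(ℝ, Model d) e' y : Model d →L[ℝ] Model d) =
      (mfderiv 𝓘(ℝ, Model d) 𝓘(ℝ, Model d) ((e' ∘ e.symm) ∘ e) y : Model d →L[ℝ] Model d) :=
    hev.mfderiv_eq
  have h2 : MDifferentiableAt 𝓘(ℝ, Model d) 𝓘(ℝ, Model d) (e' ∘ e.symm) (e y) :=
    (hasFDerivAt_trans he he' (mem_transDom hy hy')).differentiableAt.mdifferentiableAt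
  have h3 := mfderiv_comp_apply y h2 (mdifferentiableAt_chart he hy) v
  rw [mfderiv_eq_fderiv] at h3
  exact (DFunLike.congr_fun h1 v).trans h3

end

theorem chartDeriv_frame_self (he : e ∈ IsManifold.maximalAtlas 𝓘(ℝ, Model d) ∞ X)
    {z : Model d} (hz : z ∈ e.target) (j : Fin (d + 1)) :
    chartDeriv e (e.symm z) (frame e z j) = stdVec j := by
  rw [chartDeriv_frame he he ⟨hz, e.map_target hz⟩, trans_self_fderiv hz]; rfl

/-- The tangent vectors are determined by their coordinates. -/
theorem mfderiv_symm_chartDeriv (he : e ∈ IsManifold.maximalAtlas 𝓘(ℝ, Model d) ∞ X)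
    {y : X} (hy : y ∈ e.source) (v : TangentSpace 𝓘(ℝ, Model d) y) :
    (mfderiv 𝓘(ℝ, Model d) 𝓘(ℝ, Model d) e.symm (e y) (chartDeriv e y v) : Model d) = v := by
  have hev : e.symm ∘ e =ᶠ[𝓝 y] id := by
    filter_upwards [e.open_source.mem_nhds hy] with y' hy'
    exact e.left_inv hy'
  have h1 : (mfderiv 𝓘(ℝ, Model d) 𝓘(ℝ, Model d) (e.symm ∘ e) y : Model d →L[ℝ] Model d) =
      (mfderiv 𝓘(ℝ, Model d) 𝓘(ℝ, Model d) (id : X → X) y : Model d →L[ℝ] Model d) :=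
    hev.mfderiv_eq
  have h3 := mfderiv_comp_apply y (mdifferentiableAt_chart_symm he (e.map_source hy))
    (mdifferentiableAt_chart he hy) v
  rw [mfderiv_id] at h1
  exact h3.symm.trans (DFunLike.congr_fun h1 v)

/-- The coefficient of a form of top degree in a chart. -/
def topCoeff (η : ∀ x : X, FormAt d (d + 1) x) (e : OpenPartialHomeomorph X (Model d))
    (z : Model d) : ℝ := η (e.symm z) (frame e z)

/-- The frame of `e` is the image of the coordinate vectors under the derivative of the transition
map, followed by the differential of `e'.symm`; a top form on `ℝⁿ` scales by the determinant. -/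
theorem topCoeff_trans (he : e ∈ IsManifold.maximalAtlas 𝓘(ℝ, Model d) ∞ X)
    (he' : e' ∈ IsManifold.maximalAtlas 𝓘(ℝ, Model d) ∞ X) (η : ∀ x : X, FormAt d (d + 1) x)
    {z : Model d} (hz : z ∈ transDom e e') :
    topCoeff η e z = (fderiv ℝ (e' ∘ e.symm) z).det * topCoeff η e' (e' (e.symm z)) := by
  -- All tangent spaces are definitionally the model space. With this typing the base point of the
  -- form can be rewritten while its arguments stay fixed.
  let η' : X → (Model d) [⋀^Fin (d + 1)]→ₗ[ℝ] ℝ := η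
  let D : Model d →L[ℝ] Model d :=
    mfderiv 𝓘(ℝ, Model d) 𝓘(ℝ, Model d) e'.symm (e' (e.symm z))
  let g : (Model d) [⋀^Fin (d + 1)]→ₗ[ℝ] ℝ :=
    (η' (e.symm z)).compLinearMap (D : Model d →ₗ[ℝ] Model d)
  have h1 : topCoeff η e z = g (fun j => fderiv ℝ (e' ∘ e.symm) z (stdVec j)) := by
    change η' (e.symm z) (fun j => frame e z j) = η' (e.symm z) (fun j => _)
    congr 1
    funext j
    exact mfderiv_symm_eq he he' hz (stdVec j)
  have h2 : topCoeff η e' (e' (e.symm z)) = g stdVec := by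
    change η' (e'.symm (e' (e.symm z))) _ = η' (e.symm z) _
    rw [e'.left_inv hz.2]
    rfl
  rw [h1, h2, topForm_eq_volForm, volForm_clm, mul_comm]

/-- Every tangent vector is recovered from its coordinates in the chart, so a top form that vanishes
on the coordinate frame vanishes identically. -/
theorem topCoeff_ne_zero (he : e ∈ IsManifold.maximalAtlas 𝓘(ℝ, Model d) ∞ X)
    {η : ∀ x : X, FormAt d (d + 1) x} (hη : ∀ x, η x ≠ 0) {z : Model d} (hz : z ∈ e.target) :
    topCoeff η e z ≠ 0 := by
  intro h0
  let η' : X → (Model d) [⋀^Fin (d + 1)]→ₗ[ℝ] ℝ := η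
  let D : Model d →L[ℝ] Model d := mfderiv 𝓘(ℝ, Model d) 𝓘(ℝ, Model d) e.symm z
  let g : (Model d) [⋀^Fin (d + 1)]→ₗ[ℝ] ℝ :=
    (η' (e.symm z)).compLinearMap (D : Model d →ₗ[ℝ] Model d)
  have hg : g stdVec = 0 := h0
  refine hη (e.symm z) ?_
  refine AlternatingMap.ext fun v => ?_
  have h1 : η (e.symm z) v = g (fun j => chartDeriv e (e.symm z) (v j)) := by
    change η' (e.symm z) _ = η' (e.symm z) _
    congr 1
    funext j
    have := mfderiv_symm_chartDeriv he (e.map_target hz) (v j)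
    rw [e.right_inv hz] at this
    exact this.symm
  rw [h1, topForm_eq_volForm, hg, zero_mul]
  rfl

/-! ### Orientation signs and change of variables -/

section Orientation

variable (o : OrientationForm d X)

/-- The sign of a chart with respect to the orientation. -/
def orientSign (e : OpenPartialHomeomorph X (Model d)) (z : Model d) : ℝ :=
  Real.sign (topCoeff o.toFun e z)

theorem sign_mul_mul_self (a c : ℝ) (hc : c ≠ 0) : Real.sign (a * c) * a = |a| * Real.sign c := by
  rcases lt_trichotomy a 0 with ha | ha | ha <;> rcases lt_or_gt_of_ne hc with h | h
  · rw [Real.sign_of_pos (mul_pos_of_neg_of_neg ha h), Real.sign_of_neg h, abs_of_neg ha]; ring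
  · rw [Real.sign_of_neg (mul_neg_of_neg_of_pos ha h), Real.sign_of_pos h, abs_of_neg ha]; ring
  · simp [ha]
  · simp [ha]
  · rw [Real.sign_of_neg (mul_neg_of_pos_of_neg ha h), Real.sign_of_neg h, abs_of_pos ha]; ring
  · rw [Real.sign_of_pos (mul_pos ha h), Real.sign_of_pos h, abs_of_pos ha]; ring

/-- The orientation sign turns the determinant in the transformation law of forms into the absolute
determinant in the change of variables formula. -/
theorem orientSign_trans (he : e ∈ IsManifold.maximalAtlas 𝓘(ℝ, Model d) ∞ X)
    (he' : e' ∈ IsManifold.maximalAtlas 𝓘(ℝ, Model d) ∞ X) {z : Model d}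
    (hz : z ∈ transDom e e') :
    orientSign o e z * (fderiv ℝ (e' ∘ e.symm) z).det =
      |(fderiv ℝ (e' ∘ e.symm) z).det| * orientSign o e' (e' (e.symm z)) := by
  rw [orientSign, topCoeff_trans he he' _ hz,
    sign_mul_mul_self _ _ (topCoeff_ne_zero he' o.ne_zero (trans_mem_transDom hz).1)]
  rfl

theorem continuous_clm_det : Continuous fun T : Model d →L[ℝ] Model d => T.det := by
  have : (fun T : Model d →L[ℝ] Model d => T.det) =
      fun T => volForm d (fun i => T (stdVec i)) := by
    funext T; rw [volForm_clm]
  rw [this]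
  exact (volForm d).cont.comp (continuous_pi fun i => (ContinuousLinearMap.apply ℝ _ _).continuous)

variable [IsManifold 𝓘(ℝ, Model d) ∞ X]

/-- Smoothness of the orientation form is given only in the preferred charts; the transformation law
with its continuous determinant factor carries continuity to any chart of the maximal atlas. -/
theorem continuousOn_topCoeff_orientation (he : e ∈ IsManifold.maximalAtlas 𝓘(ℝ, Model d) ∞ X) :
    ContinuousOn (topCoeff o.toFun e) e.target := by
  intro z hz
  refine ContinuousAt.continuousWithinAt ?_
  set e' := chartAt (Model d) (e.symm z)
  have he' : e' ∈ IsManifold.maximalAtlas 𝓘(ℝ, Model d) ∞ X := IsManifold.chart_mem_maximalAtlas _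
  have hz' : z ∈ transDom e e' := ⟨hz, mem_chart_source _ _⟩
  have hev : topCoeff o.toFun e =ᶠ[𝓝 z] fun z =>
      (fderiv ℝ (e' ∘ e.symm) z).det * topCoeff o.toFun e' ((e' ∘ e.symm) z) := by
    filter_upwards [(isOpen_transDom e e').mem_nhds hz'] with w hw
    exact topCoeff_trans he he' _ hw
  refine ContinuousAt.congr ?_ hev.symm
  have h1 : ContinuousAt (fderiv ℝ (e' ∘ e.symm)) z :=
    (contDiffOn_fderiv_trans he he').continuousOn.continuousAt ((isOpen_transDom e e').mem_nhds hz')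
  have h2 : ContinuousAt (topCoeff o.toFun e') ((e' ∘ e.symm) z) :=
    (o.smooth (e.symm z)).continuousOn.continuousAt
      (e'.open_target.mem_nhds (trans_mem_transDom hz').1)
  exact (continuous_clm_det.continuousAt.comp h1).mul
    (ContinuousAt.comp h2 (contDiffAt_trans he he' hz').continuousAt)

/-- A continuous function without zeros has locally constant sign. This lets the sign pass through
derivatives in the local Stokes theorem. -/
theorem eventually_orientSign_eq (he : e ∈ IsManifold.maximalAtlas 𝓘(ℝ, Model d) ∞ X)
    {z : Model d} (hz : z ∈ e.target) : ∀ᶠ z' in 𝓝 z, orientSign o e z' = orientSign o e z := by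
  have hc := (continuousOn_topCoeff_orientation o he).continuousAt (e.open_target.mem_nhds hz)
  rcases lt_or_gt_of_ne (topCoeff_ne_zero he o.ne_zero hz) with h | h
  · filter_upwards [hc.eventually_lt_const h] with w hw
    rw [orientSign, orientSign, Real.sign_of_neg h, Real.sign_of_neg hw]
  · filter_upwards [hc.eventually_const_lt h] with w hw
    rw [orientSign, orientSign, Real.sign_of_pos h, Real.sign_of_pos hw]

theorem continuousOn_orientSign (he : e ∈ IsManifold.maximalAtlas 𝓘(ℝ, Model d) ∞ X) :
    ContinuousOn (orientSign o e) e.target := fun _ hz =>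
  (continuousAt_const.congr
    ((eventually_orientSign_eq o he hz).mono fun _ h => h.symm)).continuousWithinAt

-- Moving the `i`-th vector to the front is a cycle of sign `(-1)^i`. This matches the outward-first
-- boundary orientation with the signs of the exterior derivative.
omit [IsManifold 𝓘(ℝ, Model d) ∞ X] in
theorem sign_orientation_cons (e : OpenPartialHomeomorph X (Model d)) (z : Model d)
    (i : Fin (d + 1)) :
    Real.sign (o.toFun (e.symm z) (Fin.cons (frame e z i) (fun l => frame e z (i.succAbove l)))) =
      (-1) ^ (i : ℕ) * orientSign o e z := by
  have h : (Fin.cons (frame e z i) (fun l => frame e z (i.succAbove l)) :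
      Fin (d + 1) → TangentSpace 𝓘(ℝ, Model d) (e.symm z)) = frame e z ∘ i.cycleRange.symm := by
    funext j
    refine Fin.cases ?_ (fun l => ?_) j
    · simp
    · simp
  rw [h, AlternatingMap.map_perm, Equiv.Perm.sign_symm, Fin.sign_cycleRange]
  change Real.sign ((((-1 : ℤˣ) ^ (i : ℕ) : ℤˣ)) • topCoeff o.toFun e z) = _
  rcases Nat.even_or_odd (i : ℕ) with hi | hi
  · simp [hi.neg_one_pow, orientSign]
  · simp [hi.neg_one_pow, orientSign, Real.sign_neg]

omit [IsManifold 𝓘(ℝ, Model d) ∞ X] in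
/-- Change of variables for forms of top degree. -/
theorem integral_topCoeff_trans (he : e ∈ IsManifold.maximalAtlas 𝓘(ℝ, Model d) ∞ X)
    (he' : e' ∈ IsManifold.maximalAtlas 𝓘(ℝ, Model d) ∞ X) {R : Set X} (hR : IsClosed R)
    (η : ∀ x : X, FormAt d (d + 1) x) :
    ∫ z in transDom e e' ∩ e.symm ⁻¹' R, orientSign o e z * topCoeff η e z =
      ∫ z in transDom e' e ∩ e'.symm ⁻¹' R, orientSign o e' z * topCoeff η e' z := by
  have himg : (e' ∘ e.symm) '' (transDom e e' ∩ e.symm ⁻¹' R) =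
      transDom e' e ∩ e'.symm ⁻¹' R := by
    ext w
    constructor
    · rintro ⟨z, ⟨hz, hzR⟩, rfl⟩
      refine ⟨trans_mem_transDom hz, ?_⟩
      change e'.symm (e' (e.symm z)) ∈ R
      rw [e'.left_inv hz.2]
      exact hzR
    · rintro ⟨hw, hwR⟩
      refine ⟨e (e'.symm w), ⟨trans_mem_transDom hw, ?_⟩, ?_⟩
      · change e.symm (e (e'.symm w)) ∈ R
        rw [e.left_inv hw.2]
        exact hwR
      · change e' (e.symm (e (e'.symm w))) = w
        rw [e.left_inv hw.2, e'.right_inv hw.1]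
  have hinj : InjOn (e' ∘ e.symm) (transDom e e' ∩ e.symm ⁻¹' R) := by
    intro z hz w hw h
    exact e.symm.injOn hz.1.1 hw.1.1 (e'.injOn hz.1.2 hw.1.2 h)
  have hmeas : MeasurableSet (transDom e e' ∩ e.symm ⁻¹' R) := by
    have : transDom e e' ∩ e.symm ⁻¹' R = transDom e e' \ (e.target ∩ e.symm ⁻¹' Rᶜ) := by
      ext z
      simp only [transDom, mem_inter_iff, mem_preimage, Set.mem_sdiff, mem_compl_iff]
      tauto
    rw [this]
    exact (isOpen_transDom e e').measurableSet.diff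
      (e.isOpen_inter_preimage_symm hR.isOpen_compl).measurableSet
  rw [← himg, integral_image_eq_integral_abs_det_fderiv_smul volume hmeas
    (fun z hz => (hasFDerivAt_trans he he' hz.1).hasFDerivWithinAt) hinj]
  refine setIntegral_congr_fun hmeas fun z hz => ?_
  change _ = |(fderiv ℝ (e' ∘ e.symm) z).det| •
    (orientSign o e' (e' (e.symm z)) * topCoeff η e' (e' (e.symm z)))
  rw [topCoeff_trans he he' η hz.1, smul_eq_mul, ← mul_assoc, ← mul_assoc,
    orientSign_trans o he he' hz.1]

end Orientation

end Charts

/-! ### Stokes' theorem for pull-backs to a corner -/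

section LocalStokes

variable {d : ℕ}

theorem measurableSet_corner (s : Finset (Fin (d + 1))) :
    MeasurableSet {z : Model d | ∀ i ∈ s, z i ≤ 0} := by
  refine IsClosed.measurableSet ?_
  simp only [ofPred_forall]
  exact isClosed_iInter fun i => isClosed_iInter fun _ =>
    isClosed_le (EuclideanSpace.proj i : Model d →L[ℝ] ℝ).continuous continuous_const

theorem contDiffOn_compContinuousLinearMap {p : ℕ} (α : (Model d) [⋀^Fin p]→L[ℝ] ℝ)
    {O : Set (Model d)} {D : Model d → Model d →L[ℝ] Model d} (hD : ContDiffOn ℝ ∞ D O) :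
    ContDiffOn ℝ ∞ (fun z => α.compContinuousLinearMap (D z)) O := by
  refine contDiffOn_alternating_of_basis fun l => ?_
  have h2 : ContDiff ℝ ∞ fun v : Fin p → Model d => α v :=
    α.toContinuousMultilinearMap.contDiff
  exact h2.comp_contDiffOn (contDiffOn_pi.mpr fun i => hD.clm_apply contDiffOn_const)

/-- Stokes' theorem for the pull-back of `H dz₂ ∧ ⋯ ∧ dzₙ` to a corner. -/
theorem integral_corner_pullback {O : Set (Model d)} (hO : IsOpen O) {ψ : Model d → Model d}
    (hψ : ContDiffOn ℝ ∞ ψ O) {H : Model d → ℝ} (hH : ContDiff ℝ 1 H) {K : Set (Model d)}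
    (hK : IsCompact K) (hKO : K ⊆ O) (hH0 : ∀ z ∈ O, z ∉ K → H (ψ z) = 0) {ε : Model d → ℝ}
    (hε : ∀ z ∈ O, ∀ᶠ z' in 𝓝 z, ε z' = ε z) (s : Finset (Fin (d + 1))) :
    ∫ z in {z : Model d | ∀ i ∈ s, z i ≤ 0} ∩ O,
        ε z * (fderiv ℝ H (ψ z) (stdVec 0) * (fderiv ℝ ψ z).det) =
      ∑ i ∈ s, ∫ y in {y : EuclideanSpace ℝ (Fin d) |
          (∀ j ∈ s, Subbody.facePoint i y j ≤ 0) ∧ Subbody.facePoint i y ∈ O},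
        (-1) ^ (i : ℕ) * ε (Subbody.facePoint i y) * (H (ψ (Subbody.facePoint i y)) *
          tailForm d fun l => fderiv ℝ ψ (Subbody.facePoint i y) (stdVec (i.succAbove l))) := by
  classical
  let θ : Model d → (Model d) [⋀^Fin d]→L[ℝ] ℝ := fun z =>
    (H (ψ z) • tailForm d).compContinuousLinearMap (fderiv ℝ ψ z)
  have hHψ : ContDiffOn ℝ 1 (fun z => H (ψ z)) O := hH.comp_contDiffOn (hψ.of_le (by simp))
  have hθ : ContDiffOn ℝ 1 θ O := by
    have : θ = fun z => H (ψ z) • (tailForm d).compContinuousLinearMap (fderiv ℝ ψ z) := rfl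
    rw [this]
    exact hHψ.smul ((contDiffOn_compContinuousLinearMap (tailForm d)
      (hψ.fderiv_of_isOpen hO (by simp))).of_le (by simp))
  -- The components of the vector field dual to the pulled-back form, multiplied by the locally
  -- constant sign. They vanish outside the compact set `K ⊆ O`, so extension by zero keeps them of
  -- class `C¹`, and their divergence is `ε` times the exterior derivative.
  let G : Fin (d + 1) → Model d → ℝ := fun i z =>
    if z ∈ O then ε z * ((-1) ^ (i : ℕ) * θ z (i.removeNth stdVec)) else 0
  have hGK : ∀ i z, z ∉ K → G i z = 0 := by
    intro i z hz
    by_cases hzO : z ∈ O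
    · simp [G, θ, hH0 z hzO hz]
    · simp [G, hzO]
  have hGO : ∀ i, ∀ z ∈ O, G i =ᶠ[𝓝 z] fun z' => ε z * ((-1) ^ (i : ℕ) * θ z'
      (i.removeNth stdVec)) := by
    intro i z hz
    filter_upwards [hO.mem_nhds hz, hε z hz] with w hw hεw
    simp [G, hw, hεw]
  have hθi : ∀ i : Fin (d + 1), ∀ z ∈ O, ContDiffAt ℝ 1 (fun z' => θ z' (i.removeNth stdVec))
      z := by
    intro i z hz
    have h1 : ContDiffAt ℝ 1 θ z := hθ.contDiffAt (hO.mem_nhds hz)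
    exact (ContinuousAlternatingMap.apply ℝ (Model d) ℝ
        (i.removeNth stdVec)).contDiff.contDiffAt.comp
      z h1
  have hGc : ∀ i, ContDiff ℝ 1 (G i) := by
    intro i
    rw [contDiff_iff_contDiffAt]
    intro z
    by_cases hz : z ∈ O
    · refine ContDiffAt.congr_of_eventuallyEq ?_ (hGO i z hz)
      exact contDiffAt_const.mul (contDiffAt_const.mul (hθi i z hz))
    · have : G i =ᶠ[𝓝 z] fun _ => 0 := by
        filter_upwards [hK.isClosed.isOpen_compl.mem_nhds fun h => hz (hKO h)] with w hw
        exact hGK i w hw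
      exact contDiffAt_const.congr_of_eventuallyEq this
  have key := integral_corner_divergence s hGc
    (fun i => HasCompactSupport.intro hK fun z hz => hGK i z hz)
  have hlhs : ∫ z in {z : Model d | ∀ i ∈ s, z i ≤ 0} ∩ O,
        ε z * (fderiv ℝ H (ψ z) (stdVec 0) * (fderiv ℝ ψ z).det) =
      ∫ z in {z : Model d | ∀ i ∈ s, z i ≤ 0}, ∑ i, fderiv ℝ (G i) z (stdVec i) := by
    have h1 : ∫ z in {z : Model d | ∀ i ∈ s, z i ≤ 0}, ∑ i, fderiv ℝ (G i) z (stdVec i) =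
        ∫ z in {z : Model d | ∀ i ∈ s, z i ≤ 0} ∩ O, ∑ i, fderiv ℝ (G i) z (stdVec i) := by
      refine setIntegral_eq_of_subset_of_forall_sdiff_eq_zero (measurableSet_corner s)
        inter_subset_left ?_
      intro z hz
      have hzO : z ∉ O := fun h => hz.2 ⟨hz.1, h⟩
      refine Finset.sum_eq_zero fun i _ => ?_
      have : G i =ᶠ[𝓝 z] fun _ => 0 := by
        filter_upwards [hK.isClosed.isOpen_compl.mem_nhds fun h => hzO (hKO h)] with w hw
        exact hGK i w hw
      rw [this.fderiv_eq]; simp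
    rw [h1]
    refine setIntegral_congr_fun ((measurableSet_corner s).inter hO.measurableSet) ?_
    intro z ⟨_, hz⟩
    have hθd : DifferentiableAt ℝ θ z := (hθ.contDiffAt
        (hO.mem_nhds hz)).differentiableAt one_ne_zero
    have hψz : ContDiffAt ℝ ∞ ψ z := hψ.contDiffAt (hO.mem_nhds hz)
    have h2 : ∑ i, fderiv ℝ (G i) z (stdVec i) = ε z * extDeriv θ z stdVec := by
      rw [extDeriv_apply hθd, Finset.mul_sum]
      refine Finset.sum_congr rfl fun i _ => ?_
      rw [(hGO i z hz).fderiv_eq]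
      have hd := (hθi i z hz).differentiableAt one_ne_zero
      rw [fderiv_const_mul (hd.const_mul _), fderiv_const_mul hd]
      simp
    -- The exterior derivative commutes with pull-back, so it can be computed before pulling back,
    -- where it is a single partial derivative of `H`.
    have h3 : extDeriv θ z = (extDeriv (fun z => H z • tailForm d) (ψ z)).compContinuousLinearMap
        (fderiv ℝ ψ z) := by
      have hω : DifferentiableAt ℝ (fun z => H z • tailForm d) (ψ z) :=
        (hH.differentiable one_ne_zero _).smul_const _
      exact extDeriv_pullback hω hψz (by simpa using ENat.LEInfty.out)
    change _ = ∑ i, fderiv ℝ (G i) z (stdVec i)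
    rw [h2, h3, ContinuousAlternatingMap.compContinuousLinearMap_apply,
      extDeriv_smul_tailForm (hH.differentiable one_ne_zero _)]
    change _ = ε z * (_ * volForm d fun i => fderiv ℝ ψ z (stdVec i))
    rw [volForm_clm]
  rw [hlhs, key]
  refine Finset.sum_congr rfl fun i _ => ?_
  have hm : MeasurableSet {y : EuclideanSpace ℝ (Fin d) | ∀ j ∈ s, Subbody.facePoint i y j ≤ 0} :=
    (continuous_facePoint i).measurable (measurableSet_corner s)
  have h1 := setIntegral_eq_of_subset_of_forall_sdiff_eq_zero (μ := volume) (s :=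
      {y : EuclideanSpace ℝ (Fin d) |
          (∀ j ∈ s, Subbody.facePoint i y j ≤ 0) ∧ Subbody.facePoint i y ∈ O})
    (f := fun y => G i (Subbody.facePoint i y)) hm
    (fun y hy => hy.1) (fun y hy => by
      have : Subbody.facePoint i y ∉ O := fun h => hy.2 ⟨hy.1, h⟩
      simp [G, this])
  rw [h1]
  refine setIntegral_congr_fun (hm.inter ((continuous_facePoint i).measurable hO.measurableSet)) ?_
  intro y hy
  have hyO : Subbody.facePoint i y ∈ O := hy.2
  simp only [G, if_pos hyO]
  change _ * (_ * (H (ψ (Subbody.facePoint i y)) * tailForm d _)) = _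
  rw [← mul_assoc, mul_comm (ε _)]
  rfl

end LocalStokes

/-! ### Boundary points and boundary tangents of subbodies -/

section SubbodyGeometry

variable {d : ℕ} {X : Type*} [TopologicalSpace X] [ChartedSpace (Model d) X]

namespace CornerChart

variable {R : Set X} {x : X}

theorem symm_mem_iff (c : CornerChart (d := d) R x) {z : Model d} (hz : z ∈ c.e.target) :
    c.e.symm z ∈ R ↔ ∀ i ∈ c.s, z i ≤ 0 := by
  rw [c.mem_iff _ (c.e.map_target hz), c.e.right_inv hz]

/-- Moving from the point along the positive `i`-th coordinate direction leaves `R` at once, so the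
point is not interior. -/
theorem symm_mem_frontier (c : CornerChart (d := d) R x) {z : Model d} (hz : z ∈ c.e.target)
    (hR : c.e.symm z ∈ R)
    {i : Fin (d + 1)} (hi : i ∈ c.s) (h0 : z i = 0) : c.e.symm z ∈ frontier R := by
  refine ⟨subset_closure hR, fun hint => ?_⟩
  have h1 : ∀ᶠ w in 𝓝 z, c.e.symm w ∈ interior R :=
    (c.e.continuousAt_symm hz).eventually (isOpen_interior.mem_nhds hint)
  have h2 : Tendsto (fun t : ℝ => z + t • stdVec i) (𝓝[>] 0) (𝓝 z) := by
    have : Continuous fun t : ℝ => z + t • (stdVec i : Model d) := by fun_prop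
    have h := this.tendsto 0
    simp only [zero_smul, add_zero] at h
    exact h.mono_left nhdsWithin_le_nhds
  have h3 := h2.eventually (h1.and (c.e.open_target.mem_nhds hz))
  obtain ⟨t, ⟨ht1, ht2⟩, ht0⟩ := (h3.and self_mem_nhdsWithin).exists
  have := (c.symm_mem_iff ht2).mp (interior_subset ht1) i hi
  simp [h0] at this
  exact absurd ht0 (not_lt.mpr this)

/-- Moving along `-(1, …, 1)` makes all constrained coordinates strictly negative. The result lets
identities extend by continuity from the interior of a subbody to its boundary. -/
theorem mem_closure_interior (c : CornerChart (d := d) R x) (hx : x ∈ R) : x ∈ closure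
    (interior R) := by
  have hxt := c.e.map_source c.mem_source
  have hcs := (c.mem_iff x c.mem_source).mp hx
  have hev : ∀ᶠ t : ℝ in 𝓝[>] 0, c.e.symm (c.e x - t • ∑ j, (stdVec j : Model d)) ∈ interior R := by
    have h2 : Tendsto (fun t : ℝ => c.e x - t • ∑ j, (stdVec j : Model d)) (𝓝[>] 0)
        (𝓝 (c.e x)) := by
      have : Continuous fun t : ℝ => c.e x - t • ∑ j, (stdVec j : Model d) := by fun_prop
      have h := this.tendsto 0
      simp only [zero_smul, sub_zero] at h
      exact h.mono_left nhdsWithin_le_nhds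
    filter_upwards [h2.eventually (c.e.open_target.mem_nhds hxt), self_mem_nhdsWithin] with t ht ht0
    have hlt : ∀ i ∈ c.s, (c.e x - t • ∑ j, (stdVec j : Model d)) i < 0 := by
      intro i hi
      have := hcs i hi
      have ht0' : (0 : ℝ) < t := ht0
      simp [Finset.sum_apply, Pi.single_apply]
      linarith
    let U : Set (Model d) := ⋂ i ∈ c.s, {z | z i < 0}
    have hU : IsOpen U := c.s.finite_toSet.isOpen_biInter fun i _ =>
      isOpen_lt (EuclideanSpace.proj i : Model d →L[ℝ] ℝ).continuous continuous_const
    refine mem_interior.mpr ⟨c.e.source ∩ c.e ⁻¹' U, ?_, c.e.isOpen_inter_preimage hU,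
      c.e.map_target ht, ?_⟩
    · intro y hy
      rw [c.mem_iff y hy.1]
      intro i hi
      have hyU := hy.2
      simp only [U, mem_preimage, mem_iInter] at hyU
      exact le_of_lt (hyU i hi)
    · rw [mem_preimage, c.e.right_inv ht]
      simpa only [U, mem_iInter] using! hlt
  have h2 : Tendsto (fun t : ℝ => c.e.symm (c.e x - t • ∑ j, (stdVec j : Model d))) (𝓝[>] 0)
      (𝓝 x) := by
    have : Continuous fun t : ℝ => c.e x - t • ∑ j, (stdVec j : Model d) := by fun_prop
    have h := this.tendsto 0
    simp only [zero_smul, sub_zero] at h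
    have h' := (c.e.continuousAt_symm hxt).tendsto.comp
      (h.mono_left (nhdsWithin_le_nhds (s := Ioi (0 : ℝ))))
    rw [c.e.left_inv c.mem_source] at h'
    exact h'
  exact mem_closure_of_tendsto h2 hev

end CornerChart

namespace Subbody

variable (R : Subbody d X)

theorem subset_closure_interior : R.carrier ⊆ closure (interior R.carrier) := fun x hx =>
  (R.exists_chart x hx).some.mem_closure_interior hx

/-- Tangency is tested in every adapted chart `c'`. Along the line in direction `m ≠ i` the point
stays in `R` for small times of both signs: coordinate `i` remains `0` and the other constraints are
strict. Hence a constrained coordinate of `c'` is at most `0` along the line and equal to `0` at the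
start; at this local maximum its derivative vanishes. -/
theorem frame_mem_bdryTangent {x : X} (c : CornerChart (d := d) R.carrier x) {z : Model d}
    (hz : z ∈ c.e.target) {i : Fin (d + 1)} (h0 : z i = 0)
    (hneg : ∀ j ∈ c.s, j ≠ i → z j < 0) {m : Fin (d + 1)} (hm : m ≠ i) :
    frame c.e z m ∈ R.bdryTangent (c.e.symm z) := by
  intro c' j hj
  have hz' : z ∈ transDom c.e c'.e := ⟨hz, c'.mem_source⟩
  have h := chartDeriv_frame c.mem_maximalAtlas c'.mem_maximalAtlas hz' m
  refine (congrArg (fun v : Model d => v j) h).trans ?_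
  let γ : ℝ → Model d := fun t => z + t • stdVec m
  have hγ : HasDerivAt γ (stdVec m) 0 := by
    have : HasDerivAt (fun t : ℝ => t • (stdVec m : Model d)) ((1 : ℝ) • stdVec m) 0 :=
      (hasDerivAt_id (0 : ℝ)).smul_const (stdVec m : Model d)
    simpa [γ] using this
  have hγ0 : γ 0 = z := by simp [γ]
  have hψ := hasFDerivAt_trans c.mem_maximalAtlas c'.mem_maximalAtlas hz'
  have h1 : HasDerivAt ((c'.e ∘ c.e.symm) ∘ γ) (fderiv ℝ (c'.e ∘ c.e.symm) z (stdVec m)) 0 :=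
    hψ.comp_hasDerivAt_of_eq 0 hγ hγ0.symm
  have h2 : HasDerivAt (fun t => ((c'.e ∘ c.e.symm) (γ t)) j)
      ((fderiv ℝ (c'.e ∘ c.e.symm) z (stdVec m)) j) 0 :=
    (EuclideanSpace.proj j : Model d →L[ℝ] ℝ).hasFDerivAt.comp_hasDerivAt 0 h1
  have h3 : IsLocalMax (fun t => ((c'.e ∘ c.e.symm) (γ t)) j) 0 := by
    have hv0 : ((c'.e ∘ c.e.symm) (γ 0)) j = 0 :=
      (congrArg (fun w => (c'.e (c.e.symm w)) j) hγ0).trans (c'.eq_zero j hj)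
    have hγc : ContinuousAt γ 0 := hγ.continuousAt
    have hγt : Tendsto γ (𝓝 0) (𝓝 z) := by
      have := hγc.tendsto
      rwa [hγ0] at this
    have hT : ∀ᶠ t in 𝓝 (0 : ℝ), γ t ∈ transDom c.e c'.e :=
      hγt.eventually ((isOpen_transDom _ _).mem_nhds hz')
    have hN : ∀ᶠ t in 𝓝 (0 : ℝ), ∀ l ∈ c.s, γ t l ≤ 0 := by
      rw [Filter.eventually_all_finset]
      intro l hl
      by_cases hli : l = i
      · refine Eventually.of_forall fun t => ?_
        have : γ t l = 0 := by simp [γ, hli, h0, Ne.symm hm]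
        exact this.le
      · have : ContinuousAt (fun t => γ t l) 0 :=
          (EuclideanSpace.proj l : Model d →L[ℝ] ℝ).continuous.continuousAt.comp hγc
        filter_upwards [this.eventually_lt_const
            (by simp only [hγ0]; exact hneg l hl hli)] with t ht
        exact ht.le
    filter_upwards [hT, hN] with t ht htN
    simp only [hv0]
    exact (c'.mem_iff _ ht.2).mp ((c.symm_mem_iff ht.1).mpr htN) j hj
  exact h3.hasDerivAt_eq_zero h2

end Subbody

end SubbodyGeometry

theorem integrableOn_of_continuousOn_of_eq_zero {E : Type*} [TopologicalSpace E] [T2Space E]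
    [MeasurableSpace E] [BorelSpace E] {μ : Measure E} [IsFiniteMeasureOnCompacts μ] {f : E → ℝ}
    {S K : Set E} (hS : MeasurableSet S) (hK : IsCompact K) (hf : ContinuousOn f K)
    (h0 : ∀ z ∈ S, z ∉ K → f z = 0) : IntegrableOn f S μ :=
  (hf.integrableOn_compact' hK hK.measurableSet).of_forall_sdiff_eq_zero hS
      fun z hz => h0 z hz.1 hz.2

/-! ### Integrals over subbodies and their boundaries -/

section Integration

variable {d : ℕ} {X : Type*} [TopologicalSpace X] [ChartedSpace (Model d) X]

/-- Continuity of `e.symm` is available only on its target, so the set is written as a difference of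
two open sets. -/
theorem measurableSet_target_inter_preimage {Y : Type*} [TopologicalSpace Y]
    (e : OpenPartialHomeomorph Y (Model d)) {R : Set Y}
    (hR : IsClosed R) : MeasurableSet (e.target ∩ e.symm ⁻¹' R) := by
  have : e.target ∩ e.symm ⁻¹' R = e.target \ (e.target ∩ e.symm ⁻¹' Rᶜ) := by
    ext z
    simp only [mem_inter_iff, mem_preimage, Set.mem_sdiff, mem_compl_iff]
    tauto
  rw [this]
  exact e.open_target.measurableSet.diff
      (e.isOpen_inter_preimage_symm hR.isOpen_compl).measurableSet

theorem volume_coord_eq_zero (l : Fin d) :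
    volume {y : EuclideanSpace ℝ (Fin d) | y l = 0} = 0 := by
  have h := Measure.addHaar_submodule (volume : Measure (EuclideanSpace ℝ (Fin d)))
    (LinearMap.ker (EuclideanSpace.proj l : EuclideanSpace ℝ (Fin d) →L[ℝ] ℝ).toLinearMap) (by
      intro h
      have h1 : (EuclideanSpace.single l (1 : ℝ) : EuclideanSpace ℝ (Fin d)) ∈ LinearMap.ker
          (EuclideanSpace.proj l : EuclideanSpace ℝ (Fin d) →L[ℝ] ℝ).toLinearMap := by
        rw [h]; trivial
      simp at h1)
  exact h

/-- Continuity of a field of forms: its coefficients in all charts are continuous. -/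
def ContForm {p : ℕ} (η : ∀ x : X, FormAt d p x) : Prop :=
  ∀ e ∈ IsManifold.maximalAtlas 𝓘(ℝ, Model d) ∞ X, ∀ l : Fin p → Fin (d + 1),
    ContinuousOn (fun z => η (e.symm z) (fun i => frame e z (l i))) e.target

namespace Subbody

/-- The restriction of a field of forms to the boundary. -/
def restrictBdry (R : Subbody d X) (η : ∀ x : X, FormAt d d x) (x : frontier R.carrier) :
    R.BdryFormAt (x : X) := (η x).compLinearMap (R.bdryTangent (x : X)).subtype

theorem measurableSet_chart [T2Space X] (R : Subbody d X) (x : R.carrier) :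
    MeasurableSet ((R.chart x).e.target ∩ (R.chart x).e.symm ⁻¹' R.carrier) :=
  measurableSet_target_inter_preimage _ R.isCompact.isClosed

/-- The part of a face of an adapted chart that belongs to `R`. -/
def faceDom (R : Subbody d X) (x : R.carrier) (i : Fin (d + 1)) : Set (EuclideanSpace ℝ (Fin d)) :=
  {y | facePoint i y ∈ (R.chart x).e.target ∧ (R.chart x).e.symm (facePoint i y) ∈ R.carrier}

theorem measurableSet_faceDom [T2Space X] (R : Subbody d X) (x : R.carrier) (i : Fin (d + 1)) :
    MeasurableSet (R.faceDom x i) :=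
  (continuous_facePoint i).measurable (R.measurableSet_chart x)

variable [T2Space X] [SigmaCompactSpace X] [IsManifold 𝓘(ℝ, Model d) ∞ X]
  (R : Subbody d X) (o : OrientationForm d X)

/-- Local finiteness of the partition and compactness of `R`; this turns the formal sums over all
points of `R` into finite sums. -/
theorem finite_active : {x : R.carrier | ∃ y ∈ R.carrier, R.partition x y ≠ 0}.Finite := by
  refine (R.partition.locallyFinite.finite_nonempty_inter_compact R.isCompact).subset ?_
  rintro x ⟨y, hy, hxy⟩
  exact ⟨y, hxy, hy⟩

/-- The indices of the functions of the partition of unity that do not vanish on `R`. -/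
def active : Finset R.carrier := R.finite_active.toFinset

theorem partition_eq_zero {x : R.carrier} (hx : x ∉ R.active) {y : X} (hy : y ∈ R.carrier) :
    R.partition x y = 0 := by
  by_contra h
  exact hx (R.finite_active.mem_toFinset.mpr ⟨y, hy, h⟩)

theorem sum_partition {y : X} (hy : y ∈ R.carrier) : ∑ x ∈ R.active, R.partition x y = 1 := by
  rw [← R.partition.sum_eq_one hy, eq_comm]
  refine finsum_eq_sum_of_support_subset _ fun x hx => ?_
  by_contra h
  exact hx (R.partition_eq_zero h hy)

theorem tsupport_partition_subset (x : R.carrier) :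
    tsupport (R.partition x) ⊆ (R.chart x).e.source := R.exists_partition.choose_spec x

theorem integralAux_eq_sum (g : ∀ x : X, (Fin (d + 1) → TangentSpace 𝓘(ℝ, Model d) x) → ℝ) :
    R.integralAux g = ∑ x ∈ R.active,
      ∫ z in (R.chart x).e.target ∩ (R.chart x).e.symm ⁻¹' R.carrier,
        R.partition x ((R.chart x).e.symm z) * g ((R.chart x).e.symm z)
          (frame (R.chart x).e z) := by
  refine finsum_eq_sum_of_support_subset _ fun x hx => ?_
  by_contra h
  refine hx (setIntegral_eq_zero_of_forall_eq_zero fun z hz => ?_)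
  rw [R.partition_eq_zero h hz.2, zero_mul]

/-- For restrictions of forms on `X` the guarded evaluation on the boundary may be replaced by the
form itself, since the guard fails only on a null set of each face. -/
theorem bdryIntegral_restrictBdry (η : ∀ x : X, FormAt d d x) :
    R.bdryIntegral o (R.restrictBdry η) = ∑ x ∈ R.active, ∑ i ∈ (R.chart x).s,
      ∫ y in R.faceDom x i, R.partition x ((R.chart x).e.symm (facePoint i y)) *
        ((-1) ^ (i : ℕ) * orientSign o (R.chart x).e (facePoint i y) *
          η ((R.chart x).e.symm (facePoint i y))
            (fun l => frame (R.chart x).e (facePoint i y) (i.succAbove l))) := by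
  have h0 : R.bdryIntegral o (R.restrictBdry η) = ∑ x ∈ R.active, ∑ i ∈ (R.chart x).s,
      ∫ y in R.faceDom x i, R.partition x ((R.chart x).e.symm (facePoint i y)) *
        Real.sign (o.toFun _ (Fin.cons (frame (R.chart x).e (facePoint i y) i)
          (fun l => frame (R.chart x).e (facePoint i y) (i.succAbove l)))) *
        R.evalBdry (R.restrictBdry η) ((R.chart x).e.symm (facePoint i y))
          (fun l => frame (R.chart x).e (facePoint i y) (i.succAbove l)) := by
    refine finsum_eq_sum_of_support_subset _ fun x hx => ?_
    by_contra h
    refine hx (Finset.sum_eq_zero fun i _ => setIntegral_eq_zero_of_forall_eq_zero fun y hy => ?_)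
    rw [R.partition_eq_zero h hy.2, zero_mul, zero_mul]
  rw [h0]
  refine Finset.sum_congr rfl fun x _ => Finset.sum_congr rfl fun i hi => ?_
  refine setIntegral_congr_ae (R.measurableSet_faceDom x i) ?_
  -- Off the edges of the face, where another coordinate vanishes too, all constraints except the
  -- `i`-th are strict. There the remaining frame vectors are tangent to the boundary, and
  -- `evalBdry` does not take its default value.
  have hae : ∀ᵐ y : EuclideanSpace ℝ (Fin d), ∀ l, y l ≠ 0 :=
    ae_all_iff.mpr fun l => by
      rw [ae_iff]
      simpa using volume_coord_eq_zero l
  filter_upwards [hae] with y hy hyD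
  have hneg : ∀ j ∈ (R.chart x).s, j ≠ i → facePoint i y j < 0 := by
    intro j hj hji
    have h1 := ((R.chart x).symm_mem_iff hyD.1).mp hyD.2 j hj
    refine lt_of_le_of_ne h1 ?_
    obtain ⟨l, rfl⟩ := Fin.exists_succAbove_eq hji
    rw [facePoint_apply_succAbove]
    exact hy l
  have h1 : (R.chart x).e.symm (facePoint i y) ∈ frontier R.carrier :=
    (R.chart x).symm_mem_frontier hyD.1 hyD.2 hi (facePoint_apply_same i y)
  have h2 : ∀ l, frame (R.chart x).e (facePoint i y) (i.succAbove l) ∈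
      R.bdryTangent ((R.chart x).e.symm (facePoint i y)) := fun l =>
    R.frame_mem_bdryTangent (R.chart x) hyD.1 (facePoint_apply_same i y) hneg
      (Fin.succAbove_ne i l)
  rw [sign_orientation_cons, evalBdry, dif_pos ⟨h1, h2⟩, mul_assoc]
  rfl

theorem isCompact_image_tsupport (x : R.carrier) :
    IsCompact ((R.chart x).e '' (tsupport (R.partition x) ∩ R.carrier)) :=
  (R.isCompact.inter_left (isClosed_tsupport _)).image_of_continuousOn
    ((R.chart x).e.continuousOn.mono (inter_subset_left.trans (R.tsupport_partition_subset x)))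

theorem image_tsupport_subset (x : R.carrier) :
    (R.chart x).e '' (tsupport (R.partition x) ∩ R.carrier) ⊆ (R.chart x).e.target := by
  rintro _ ⟨y, hy, rfl⟩
  exact (R.chart x).e.map_source (R.tsupport_partition_subset x hy.1)

theorem partition_symm_eq_zero (x : R.carrier) {z : Model d} (hz : z ∈ (R.chart x).e.target)
    (hR : (R.chart x).e.symm z ∈ R.carrier)
    (hK : z ∉ (R.chart x).e '' (tsupport (R.partition x) ∩ R.carrier)) :
    R.partition x ((R.chart x).e.symm z) = 0 := by
  refine image_eq_zero_of_notMem_tsupport fun h => hK ⟨_, ⟨h, hR⟩, ?_⟩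
  exact (R.chart x).e.right_inv hz

theorem continuousOn_partition_symm (x : R.carrier) :
    ContinuousOn (fun z => R.partition x ((R.chart x).e.symm z)) (R.chart x).e.target :=
  (ContMDiffMap.contMDiff (R.partition x)).continuous.comp_continuousOn
      (R.chart x).e.continuousOn_symm

/-- On `R` the partition function vanishes off the image of a compact subset of the chart domain, so
the integrand is continuous on a compact set and zero elsewhere on the domain of integration. -/
theorem integrableOn_chart (x : R.carrier) {f : Model d → ℝ}
    (hf : ContinuousOn f (R.chart x).e.target) :
    IntegrableOn (fun z => R.partition x ((R.chart x).e.symm z) * f z)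
      ((R.chart x).e.target ∩ (R.chart x).e.symm ⁻¹' R.carrier) := by
  refine integrableOn_of_continuousOn_of_eq_zero (R.measurableSet_chart x)
    (R.isCompact_image_tsupport x)
    (((R.continuousOn_partition_symm x).mul hf).mono (R.image_tsupport_subset x)) ?_
  intro z hz hK
  rw [R.partition_symm_eq_zero x hz.1 hz.2 hK, zero_mul]

/-- Dropping the `i`-th coordinate is a continuous left inverse. Closedness is what makes preimages
of compact sets compact on the face. -/
theorem facePoint_injective (i : Fin (d + 1)) :
    Topology.IsClosedEmbedding (facePoint i : EuclideanSpace ℝ (Fin d) → Model d) := by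
  let r : Model d → EuclideanSpace ℝ (Fin d) := fun z => WithLp.toLp 2 fun l => z (i.succAbove l)
  have hr : Continuous r := (PiLp.continuous_toLp 2 _).comp
    (continuous_pi fun l => (EuclideanSpace.proj (i.succAbove l) : Model d →L[ℝ] ℝ).continuous)
  refine Function.LeftInverse.isClosedEmbedding (f := r) (fun y => ?_) hr (continuous_facePoint i)
  ext l
  exact facePoint_apply_succAbove i l y

theorem integrableOn_face (x : R.carrier) (i : Fin (d + 1)) {f : Model d → ℝ}
    (hf : ContinuousOn f (R.chart x).e.target) :
    IntegrableOn (fun y => R.partition x ((R.chart x).e.symm (facePoint i y)) * f (facePoint i y))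
      (R.faceDom x i) := by
  refine integrableOn_of_continuousOn_of_eq_zero (R.measurableSet_faceDom x i)
    ((facePoint_injective i).isCompact_preimage (R.isCompact_image_tsupport x)) ?_ ?_
  · exact (((R.continuousOn_partition_symm x).mul hf).mono (R.image_tsupport_subset x)).comp
      (continuous_facePoint i).continuousOn fun y hy => hy
  · intro y hy hK
    rw [R.partition_symm_eq_zero x hy.1 hy.2 hK, zero_mul]

theorem integral_eq_sum (η : ∀ x : X, FormAt d (d + 1) x) :
    R.integral o η = ∑ x ∈ R.active,
      ∫ z in (R.chart x).e.target ∩ (R.chart x).e.symm ⁻¹' R.carrier,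
        R.partition x ((R.chart x).e.symm z) *
          (orientSign o (R.chart x).e z * topCoeff η (R.chart x).e z) :=
  R.integralAux_eq_sum _

variable {o R}

/-- Additivity of the integral requires integrability in each chart, which continuity of the
coefficients supplies. -/
theorem integral_add {η η' : ∀ x : X, FormAt d (d + 1) x} (hη : ContForm η) (hη' : ContForm η') :
    R.integral o (fun x => η x + η' x) = R.integral o η + R.integral o η' := by
  rw [integral_eq_sum, integral_eq_sum, integral_eq_sum, ← Finset.sum_add_distrib]
  refine Finset.sum_congr rfl fun x _ => ?_
  have hm := (R.chart x).mem_maximalAtlas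
  have hc := continuousOn_orientSign o hm
  refine Eq.trans ?_ (MeasureTheory.integral_add
    (R.integrableOn_chart x (hc.mul (hη _ hm id))) (R.integrableOn_chart x (hc.mul (hη' _ hm id))))
  congr 1
  funext z
  simp only [topCoeff, AlternatingMap.add_apply]
  rw [← mul_add, ← mul_add]

theorem integral_neg (η : ∀ x : X, FormAt d (d + 1) x) :
    R.integral o (fun x => -η x) = -R.integral o η := by
  rw [integral_eq_sum, integral_eq_sum, ← Finset.sum_neg_distrib]
  refine Finset.sum_congr rfl fun x _ => ?_
  rw [← MeasureTheory.integral_neg]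
  congr 1
  funext z
  simp only [topCoeff, AlternatingMap.neg_apply]
  ring

/-- Triangle inequality, over the charts and under each integral; the partition functions are
nonnegative, and the orientation sign is `±1` because the orientation form has no zeros. -/
theorem abs_integral_le (η : ∀ x : X, FormAt d (d + 1) x) :
    |R.integral o η| ≤ R.integralAbs η := by
  rw [integral_eq_sum, integralAbs, integralAux_eq_sum]
  refine (Finset.abs_sum_le_sum_abs _ _).trans (Finset.sum_le_sum fun x _ => ?_)
  refine (abs_integral_le_integral_abs).trans (le_of_eq ?_)
  refine setIntegral_congr_fun (R.measurableSet_chart x) fun z hz => ?_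
  have h0 := topCoeff_ne_zero (R.chart x).mem_maximalAtlas o.ne_zero hz.1
  change |_ * (_ * _)| = _ * |topCoeff η _ z|
  rw [abs_mul, abs_mul, abs_of_nonneg (R.partition.nonneg x _)]
  rcases Real.sign_apply_eq_of_ne_zero _ h0 with h | h <;> simp [orientSign, h]

theorem bdryIntegral_restrictBdry_add {η η' : ∀ x : X, FormAt d d x} (hη : ContForm η)
    (hη' : ContForm η') :
    R.bdryIntegral o (R.restrictBdry fun x => η x + η' x) =
      R.bdryIntegral o (R.restrictBdry η) + R.bdryIntegral o (R.restrictBdry η') := by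
  rw [bdryIntegral_restrictBdry, bdryIntegral_restrictBdry, bdryIntegral_restrictBdry,
    ← Finset.sum_add_distrib]
  refine Finset.sum_congr rfl fun x _ => ?_
  rw [← Finset.sum_add_distrib]
  refine Finset.sum_congr rfl fun i _ => ?_
  have hm := (R.chart x).mem_maximalAtlas
  have hc : ContinuousOn (fun z => (-1) ^ (i : ℕ) * orientSign o (R.chart x).e z)
      (R.chart x).e.target := continuousOn_const.mul (continuousOn_orientSign o hm)
  have h1 := R.integrableOn_face x i (hc.mul (hη _ hm i.succAbove))
  have h2 := R.integrableOn_face x i (hc.mul (hη' _ hm i.succAbove))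
  refine Eq.trans ?_ (MeasureTheory.integral_add h1 h2)
  congr 1
  funext y
  simp only [AlternatingMap.add_apply]
  rw [← mul_add, ← mul_add]

end Subbody

end Integration

/-! ### Stokes' theorem on a subbody for forms supported in one chart -/

section Stokes

variable {d : ℕ} {X : Type*} [TopologicalSpace X] [ChartedSpace (Model d) X]

/-- The form `h dz₂ ∧ ⋯ ∧ dzₙ` in the coordinates of a chart. -/
def tailField (e : OpenPartialHomeomorph X (Model d)) (h : X → ℝ) (x : X) : FormAt d d x :=
  h x • (tailForm d).toAlternatingMap.compLinearMap (chartDeriv e x : _ →ₗ[ℝ] Model d)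

/-- The form `h dz₁ ∧ ⋯ ∧ dzₙ` in the coordinates of a chart. -/
def volField (e : OpenPartialHomeomorph X (Model d)) (h : X → ℝ) (x : X) : FormAt d (d + 1) x :=
  h x • (volForm d).toAlternatingMap.compLinearMap (chartDeriv e x : _ →ₗ[ℝ] Model d)

/-- The partial derivative in the first coordinate of a chart. -/
def firstPartial {Y : Type*} [TopologicalSpace Y] (e : OpenPartialHomeomorph Y (Model d))
    (h : Y → ℝ) : Y → ℝ :=
  e.source.indicator fun x => fderiv ℝ (h ∘ e.symm) (e x) (stdVec 0)

theorem firstPartial_symm {Y : Type*} [TopologicalSpace Y]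
    (e : OpenPartialHomeomorph Y (Model d)) (h : Y → ℝ) {z : Model d}
    (hz : z ∈ e.target) : firstPartial e h (e.symm z) = fderiv ℝ (h ∘ e.symm) z (stdVec 0) := by
  rw [firstPartial, indicator_of_mem (e.map_target hz), e.right_inv hz]

theorem firstPartial_eq_zero {Y : Type*} [TopologicalSpace Y]
    (e : OpenPartialHomeomorph Y (Model d)) {h : Y → ℝ} {K : Set Y} (hK : IsClosed K)
    (h0 : ∀ y, y ∉ K → h y = 0) {y : Y} (hy : y ∉ K) : firstPartial e h y = 0 := by
  by_cases hs : y ∈ e.source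
  · rw [firstPartial, indicator_of_mem hs]
    have hev : h ∘ e.symm =ᶠ[𝓝 (e y)] fun _ => 0 := by
      have h1 : Tendsto e.symm (𝓝 (e y)) (𝓝 y) := by
        have := (e.continuousAt_symm (e.map_source hs)).tendsto
        rwa [e.left_inv hs] at this
      filter_upwards [h1.eventually (hK.isOpen_compl.mem_nhds hy)] with z hz
      exact h0 _ hz
    rw [hev.fderiv_eq]; simp
  · rw [firstPartial, indicator_of_notMem hs]

variable {e e₀ : OpenPartialHomeomorph X (Model d)}

theorem topCoeff_volField (he : e ∈ IsManifold.maximalAtlas 𝓘(ℝ, Model d) ∞ X)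
    (he₀ : e₀ ∈ IsManifold.maximalAtlas 𝓘(ℝ, Model d) ∞ X) (h : X → ℝ) {z : Model d}
    (hz : z ∈ transDom e e₀) :
    topCoeff (volField e₀ h) e z = h (e.symm z) * (fderiv ℝ (e₀ ∘ e.symm) z).det := by
  change h (e.symm z) • volForm d (fun j => chartDeriv e₀ (e.symm z) (frame e z j)) = _
  rw [smul_eq_mul, ← volForm_clm]
  congr 2
  funext j
  exact chartDeriv_frame he he₀ hz j

theorem topCoeff_volField_self (he : e ∈ IsManifold.maximalAtlas 𝓘(ℝ, Model d) ∞ X) (h : X → ℝ)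
    {z : Model d} (hz : z ∈ e.target) : topCoeff (volField e h) e z = h (e.symm z) := by
  rw [topCoeff_volField he he h ⟨hz, e.map_target hz⟩, trans_self_fderiv hz,
    ← volForm_clm]
  simp only [ContinuousLinearMap.id_apply]
  rw [volForm_stdVec, mul_one]

theorem tailField_frame (he : e ∈ IsManifold.maximalAtlas 𝓘(ℝ, Model d) ∞ X)
    (he₀ : e₀ ∈ IsManifold.maximalAtlas 𝓘(ℝ, Model d) ∞ X) (h : X → ℝ) {z : Model d}
    (hz : z ∈ transDom e e₀) (l : Fin d → Fin (d + 1)) :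
    tailField e₀ h (e.symm z) (fun i => frame e z (l i)) =
      h (e.symm z) * tailForm d fun i => fderiv ℝ (e₀ ∘ e.symm) z (stdVec (l i)) := by
  change h (e.symm z) • tailForm d (fun i => chartDeriv e₀ (e.symm z) (frame e z (l i))) = _
  rw [smul_eq_mul]
  congr 2
  funext i
  exact chartDeriv_frame he he₀ hz (l i)

variable (o : OrientationForm d X)

/-- On `R` the coefficient vanishes outside both chart domains, so each integral reduces to the
overlap, where the change of variables applies. -/
theorem integral_topCoeff_volField (he : e ∈ IsManifold.maximalAtlas 𝓘(ℝ, Model d) ∞ X)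
    (he₀ : e₀ ∈ IsManifold.maximalAtlas 𝓘(ℝ, Model d) ∞ X) {R : Set X} (hR : IsClosed R)
    {h : X → ℝ} (hs : ∀ y ∈ R, h y ≠ 0 → y ∈ e.source) (hs₀ : ∀ y ∈ R, h y ≠ 0 → y ∈ e₀.source) :
    ∫ z in e.target ∩ e.symm ⁻¹' R, orientSign o e z * topCoeff (volField e₀ h) e z =
      ∫ z in e₀.target ∩ e₀.symm ⁻¹' R, orientSign o e₀ z * h (e₀.symm z) := by
  have h1 : ∫ z in e.target ∩ e.symm ⁻¹' R, orientSign o e z * topCoeff (volField e₀ h) e z =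
      ∫ z in transDom e e₀ ∩ e.symm ⁻¹' R, orientSign o e z * topCoeff (volField e₀ h) e z := by
    refine setIntegral_eq_of_subset_of_forall_sdiff_eq_zero
      (measurableSet_target_inter_preimage e hR) (fun z hz => ⟨hz.1.1, hz.2⟩) fun z hz => ?_
    have : h (e.symm z) = 0 := by
      by_contra hne
      exact hz.2 ⟨⟨hz.1.1, hs₀ _ hz.1.2 hne⟩, hz.1.2⟩
    simp [topCoeff, volField, this]
  have h2 : ∫ z in e₀.target ∩ e₀.symm ⁻¹' R, orientSign o e₀ z * h (e₀.symm z) =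
      ∫ z in transDom e₀ e ∩ e₀.symm ⁻¹' R, orientSign o e₀ z * topCoeff (volField e₀ h) e₀ z := by
    rw [setIntegral_eq_of_subset_of_forall_sdiff_eq_zero
      (measurableSet_target_inter_preimage e₀ hR)
      (s := transDom e₀ e ∩ e₀.symm ⁻¹' R) (fun z hz => ⟨hz.1.1, hz.2⟩) fun z hz => ?_]
    · refine setIntegral_congr_fun ?_ fun z hz => ?_
      · have : transDom e₀ e ∩ e₀.symm ⁻¹' R = transDom e₀ e ∩ (e₀.target ∩ e₀.symm ⁻¹' R) := by
          ext z
          simp only [transDom, mem_inter_iff]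
          tauto
        rw [this]
        exact (isOpen_transDom e₀ e).measurableSet.inter (measurableSet_target_inter_preimage e₀ hR)
      · rw [topCoeff_volField_self he₀ h hz.1.1]
    · have : h (e₀.symm z) = 0 := by
        by_contra hne
        exact hz.2 ⟨⟨hz.1.1, hs _ hz.1.2 hne⟩, hz.1.2⟩
      rw [this, mul_zero]
  rw [h1, h2]
  exact integral_topCoeff_trans o he he₀ hR _

theorem contDiffOn_comp_symm_of_contMDiff (he : e ∈ IsManifold.maximalAtlas 𝓘(ℝ, Model d) ∞ X)
    {f : X → ℝ} (hf : ContMDiff 𝓘(ℝ, Model d) 𝓘(ℝ, ℝ) ∞ f) :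
    ContDiffOn ℝ ∞ (f ∘ e.symm) e.target := by
  rw [← contMDiffOn_iff_contDiffOn]
  exact hf.comp_contMDiffOn (contMDiffOn_symm_of_mem_maximalAtlas he)

namespace Subbody

variable [T2Space X] [SigmaCompactSpace X] [IsManifold 𝓘(ℝ, Model d) ∞ X] (R : Subbody d X)

/-- Stokes' theorem in one adapted chart. -/
theorem sum_face_tailField (he₀ : e₀ ∈ IsManifold.maximalAtlas 𝓘(ℝ, Model d) ∞ X) {h : X → ℝ}
    {K : Set X} (hK : IsCompact K) (hKs : K ⊆ e₀.source) (h0 : ∀ y, y ∉ K → h y = 0)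
    (hh : ContDiffOn ℝ 1 (h ∘ e₀.symm) e₀.target) (x : R.carrier) :
    ∑ i ∈ (R.chart x).s,
      ∫ y in R.faceDom x i, R.partition x ((R.chart x).e.symm (facePoint i y)) *
        ((-1) ^ (i : ℕ) * orientSign o (R.chart x).e (facePoint i y) *
          tailField e₀ h ((R.chart x).e.symm (facePoint i y))
            (fun l => frame (R.chart x).e (facePoint i y) (i.succAbove l))) =
      ∫ z in e₀.target ∩ e₀.symm ⁻¹' R.carrier,
        orientSign o e₀ z * firstPartial e₀ (fun y => R.partition x y * h y) (e₀.symm z) := by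
  classical
  set c := R.chart x
  set g : X → ℝ := fun y => R.partition x y * h y with hg
  have he := c.mem_maximalAtlas
  have hg0 : ∀ y, y ∉ tsupport (R.partition x) ∩ K → g y = 0 := by
    intro y hy
    by_cases hyK : y ∈ K
    · have : R.partition x y = 0 := image_eq_zero_of_notMem_tsupport fun h => hy ⟨h, hyK⟩
      simp [hg, this]
    · simp [hg, h0 y hyK]
  have hgc : ContDiffOn ℝ 1 (g ∘ e₀.symm) e₀.target :=
    ((contDiffOn_comp_symm_of_contMDiff he₀ (ContMDiffMap.contMDiff (R.partition x))).of_le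
      (by simp)).mul hh
  -- The coefficient in the coordinates of `e₀`, extended by zero to all of `ℝⁿ`; it is of class
  -- `C¹` because its support comes from a compact subset of the chart domain.
  let H : Model d → ℝ := e₀.target.indicator (g ∘ e₀.symm)
  have hHev : ∀ z ∈ e₀.target, H =ᶠ[𝓝 z] g ∘ e₀.symm := fun z hz => by
    filter_upwards [e₀.open_target.mem_nhds hz] with w hw
    exact indicator_of_mem hw _
  have hKe : IsCompact (e₀ '' K) := hK.image_of_continuousOn (e₀.continuousOn.mono hKs)
  have hH : ContDiff ℝ 1 H := by
    rw [contDiff_iff_contDiffAt]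
    intro z
    by_cases hz : z ∈ e₀.target
    · exact (hgc.contDiffAt (e₀.open_target.mem_nhds hz)).congr_of_eventuallyEq (hHev z hz)
    · have hzK : z ∉ e₀ '' K := by
        rintro ⟨y, hy, rfl⟩
        exact hz (e₀.map_source (hKs hy))
      have : H =ᶠ[𝓝 z] fun _ => 0 := by
        filter_upwards [hKe.isClosed.isOpen_compl.mem_nhds hzK] with w hw
        by_cases hwt : w ∈ e₀.target
        · simp only [H, indicator_of_mem hwt]
          refine hg0 _ fun hm => hw ⟨_, hm.2, e₀.right_inv hwt⟩
        · exact indicator_of_notMem hwt _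
      exact contDiffAt_const.congr_of_eventuallyEq this
  have hHψ : ∀ z ∈ transDom c.e e₀, H (e₀ (c.e.symm z)) = g (c.e.symm z) := by
    intro z hz
    simp only [H, indicator_of_mem (e₀.map_source hz.2), Function.comp, e₀.left_inv hz.2]
  have hts : tsupport (R.partition x) ⊆ c.e.source := R.tsupport_partition_subset x
  -- The map pulled back along is the transition from the adapted chart to `e₀`. The compact set
  -- lies in its domain because `ρ` is supported in the adapted chart and `h` in `e₀`.
  have key := integral_corner_pullback (isOpen_transDom c.e e₀) (contDiffOn_trans he he₀) hH
    (K := c.e '' (tsupport (R.partition x) ∩ K))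
    ((hK.inter_left (isClosed_tsupport _)).image_of_continuousOn
      (c.e.continuousOn.mono (inter_subset_left.trans hts)))
    (by
      rintro _ ⟨y, hy, rfl⟩
      exact mem_transDom (hts hy.1) (hKs hy.2))
    (by
      intro z hz hzK
      change H (e₀ (c.e.symm z)) = 0
      rw [hHψ z hz]
      exact hg0 _ fun hm => hzK ⟨_, hm, c.e.right_inv hz.1⟩)
    (ε := orientSign o c.e) (fun z hz => eventually_orientSign_eq o he hz.1) c.s
  have hface : ∀ i ∈ c.s, ∫ y in R.faceDom x i, R.partition x (c.e.symm (facePoint i y)) *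
        ((-1) ^ (i : ℕ) * orientSign o c.e (facePoint i y) *
          tailField e₀ h (c.e.symm (facePoint i y))
            (fun l => frame c.e (facePoint i y) (i.succAbove l))) =
      ∫ y in {y : EuclideanSpace ℝ (Fin d) |
          (∀ j ∈ c.s, facePoint i y j ≤ 0) ∧ facePoint i y ∈ transDom c.e e₀},
        (-1) ^ (i : ℕ) * orientSign o c.e (facePoint i y) *
          (H ((e₀ ∘ c.e.symm) (facePoint i y)) * tailForm d fun l =>
            fderiv ℝ (e₀ ∘ c.e.symm) (facePoint i y) (stdVec (i.succAbove l))) := by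
    intro i hi
    rw [setIntegral_eq_of_subset_of_forall_sdiff_eq_zero (R.measurableSet_faceDom x i)
      (s := {y : EuclideanSpace ℝ (Fin d) |
          (∀ j ∈ c.s, facePoint i y j ≤ 0) ∧ facePoint i y ∈ transDom c.e e₀})]
    · refine setIntegral_congr_fun ?_ fun y hy => ?_
      · exact ((continuous_facePoint i).measurable (measurableSet_corner c.s)).inter
          ((continuous_facePoint i).measurable (isOpen_transDom c.e e₀).measurableSet)
      · have hy2 : facePoint i y ∈ transDom c.e e₀ := hy.2
        change R.partition x (c.e.symm (facePoint i y)) * (_ *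
          tailField e₀ h (c.e.symm (facePoint i y))
            (fun l => frame c.e (facePoint i y) (i.succAbove l))) =
          _ * (H (e₀ (c.e.symm (facePoint i y))) * _)
        rw [tailField_frame he he₀ h hy2, hHψ _ hy2]
        simp only [hg]
        ring
    · exact fun y hy => ⟨hy.2.1, (c.symm_mem_iff hy.2.1).mpr hy.1⟩
    · intro y hy
      have hhy : h (c.e.symm (facePoint i y)) = 0 := by
        by_contra hne
        refine hy.2 ⟨(c.symm_mem_iff hy.1.1).mp hy.1.2, hy.1.1, hKs ?_⟩
        by_contra hk
        exact hne (h0 _ hk)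
      simp [tailField, hhy]
  rw [Finset.sum_congr rfl hface, ← key]
  have hg' : ∀ y, firstPartial e₀ g y ≠ 0 → y ∈ tsupport (R.partition x) ∩ K := by
    intro y hy
    by_contra hn
    exact hy (firstPartial_eq_zero e₀ ((isClosed_tsupport _).inter hK.isClosed) hg0 hn)
  -- The volume integral is carried from `e₀` to the adapted chart, in which `R` is a corner and the
  -- divergence theorem was applied.
  rw [← integral_topCoeff_volField o he he₀ R.isCompact.isClosed
    (fun y _ hy => hts (hg' y hy).1) (fun y _ hy => hKs (hg' y hy).2)]
  rw [setIntegral_eq_of_subset_of_forall_sdiff_eq_zero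
    (measurableSet_target_inter_preimage c.e R.isCompact.isClosed)
    (s := {z : Model d | ∀ i ∈ c.s, z i ≤ 0} ∩ transDom c.e e₀)]
  · refine setIntegral_congr_fun
      ((measurableSet_corner c.s).inter (isOpen_transDom c.e e₀).measurableSet) fun z hz => ?_
    rw [topCoeff_volField he he₀ _ hz.2]
    change _ * (fderiv ℝ H (e₀ (c.e.symm z)) (stdVec 0) * _) = _
    rw [(hHev _ (e₀.map_source hz.2.2)).fderiv_eq, firstPartial,
      indicator_of_mem (show c.e.symm z ∈ e₀.source from hz.2.2)]
  · exact fun z hz => ⟨hz.2.1, (c.symm_mem_iff hz.2.1).mpr hz.1⟩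
  · intro z hz
    have : firstPartial e₀ g (c.e.symm z) = 0 := by
      by_contra hne
      exact hz.2 ⟨(c.symm_mem_iff hz.1.1).mp hz.1.2, hz.1.1, hKs (hg' _ hne).2⟩
    simp [topCoeff, volField, this]

/-- The partition sums to `1` only on `R`, so the differential of the sum vanishes in the interior
of `R`. Continuity extends this to boundary points, since `R` lies in the closure of its interior.
-/
theorem fderiv_sum_partition (he₀ : e₀ ∈ IsManifold.maximalAtlas 𝓘(ℝ, Model d) ∞ X)
    {z : Model d} (hz : z ∈ e₀.target) (hR : e₀.symm z ∈ R.carrier) :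
    ∑ x ∈ R.active, fderiv ℝ (R.partition x ∘ e₀.symm) z = 0 := by
  have hd : ∀ x : R.carrier, ContDiffOn ℝ ∞ (R.partition x ∘ e₀.symm) e₀.target := fun x =>
    contDiffOn_comp_symm_of_contMDiff he₀ (ContMDiffMap.contMDiff (R.partition x))
  by_contra hne
  have hc : ContinuousAt (fun w => ∑ x ∈ R.active, fderiv ℝ (R.partition x ∘ e₀.symm) w) z := by
    refine tendsto_finsetSum _ fun x _ => ?_
    exact ((hd x).continuousOn_fderiv_of_isOpen e₀.open_target (by simp)).continuousAt
      (e₀.open_target.mem_nhds hz)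
  have hev : ∀ᶠ w in 𝓝 z, w ∈ e₀.target ∧
      ∑ x ∈ R.active, fderiv ℝ (R.partition x ∘ e₀.symm) w ≠ 0 :=
    (e₀.open_target.eventually_mem hz).and (hc.eventually_ne hne)
  have hy : ∃ᶠ y in 𝓝 (e₀.symm z), y ∈ interior R.carrier :=
    mem_closure_iff_frequently.mp (R.subset_closure_interior hR)
  have hcy : Tendsto e₀ (𝓝 (e₀.symm z)) (𝓝 z) := by
    have := (e₀.continuousAt (e₀.map_target hz)).tendsto
    rwa [e₀.right_inv hz] at this
  obtain ⟨y, hyi, ⟨⟨-, hy2⟩, hy3⟩⟩ := (hy.and_eventually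
    ((hcy.eventually hev).and (e₀.open_source.mem_nhds (e₀.map_target hz)))).exists
  refine hy2 ?_
  have hyt := e₀.map_source hy3
  have h1 : HasFDerivAt (fun w => ∑ x ∈ R.active, (R.partition x ∘ e₀.symm) w)
      (∑ x ∈ R.active, fderiv ℝ (R.partition x ∘ e₀.symm) (e₀ y)) (e₀ y) := by
    refine HasFDerivAt.fun_sum fun x _ => ?_
    exact (((hd x).contDiffAt (e₀.open_target.mem_nhds hyt)).differentiableAt
      (by simp)).hasFDerivAt
  have h2 : (fun w => ∑ x ∈ R.active, (R.partition x ∘ e₀.symm) w) =ᶠ[𝓝 (e₀ y)] fun _ => 1 := by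
    have h3 : Tendsto e₀.symm (𝓝 (e₀ y)) (𝓝 y) := by
      have := (e₀.continuousAt_symm hyt).tendsto
      rwa [e₀.left_inv hy3] at this
    filter_upwards [h3.eventually (isOpen_interior.mem_nhds hyi)] with w hw
    exact R.sum_partition (interior_subset hw)
  rw [← h1.fderiv, h2.fderiv_eq]
  simp

/-- Summation of the chartwise identities. The product rule splits each `∂₁(ρ h)` into `ρ ∂₁h`,
which adds up to the claim, and `h ∂₁ρ`, which cancels because the differentials of the partition
sum to zero on `R`. -/
theorem bdryIntegral_tailField (he₀ : e₀ ∈ IsManifold.maximalAtlas 𝓘(ℝ, Model d) ∞ X) {h : X → ℝ}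
    {K : Set X} (hK : IsCompact K) (hKs : K ⊆ e₀.source) (h0 : ∀ y, y ∉ K → h y = 0)
    (hh : ContDiffOn ℝ 1 (h ∘ e₀.symm) e₀.target) :
    R.bdryIntegral o (R.restrictBdry (tailField e₀ h)) =
      R.integral o (volField e₀ (firstPartial e₀ h)) := by
  have hA := measurableSet_target_inter_preimage e₀ R.isCompact.isClosed
  have hKe : IsCompact (e₀ '' K) := hK.image_of_continuousOn (e₀.continuousOn.mono hKs)
  have hKt : e₀ '' K ⊆ e₀.target := by
    rintro _ ⟨y, hy, rfl⟩
    exact e₀.map_source (hKs hy)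
  have hint : ∀ k : X → ℝ, ContinuousOn (fun z => k (e₀.symm z)) e₀.target →
      (∀ y, y ∉ K → k y = 0) → IntegrableOn (fun z => orientSign o e₀ z * k (e₀.symm z))
        (e₀.target ∩ e₀.symm ⁻¹' R.carrier) := by
    intro k hk hk0
    refine integrableOn_of_continuousOn_of_eq_zero hA hKe
      (((continuousOn_orientSign o he₀).mul hk).mono hKt) fun z hz hzK => ?_
    rw [hk0, mul_zero]
    exact fun hm => hzK ⟨_, hm, e₀.right_inv hz.1⟩
  have hfp : ∀ g : X → ℝ, ContDiffOn ℝ 1 (g ∘ e₀.symm) e₀.target →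
      ContinuousOn (fun z => firstPartial e₀ g (e₀.symm z)) e₀.target := by
    intro g hg
    refine ContinuousOn.congr ?_ fun z hz => firstPartial_symm e₀ g hz
    exact (hg.continuousOn_fderiv_of_isOpen e₀.open_target le_rfl).clm_apply continuousOn_const
  have hd : ∀ x : R.carrier, ContDiffOn ℝ 1 (R.partition x ∘ e₀.symm) e₀.target := fun x =>
    (contDiffOn_comp_symm_of_contMDiff he₀ (ContMDiffMap.contMDiff (R.partition x))).of_le (by simp)
  have hk0 : ∀ y, y ∉ K → firstPartial e₀ h y = 0 := fun y hy =>
    firstPartial_eq_zero e₀ hK.isClosed h0 hy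
  rw [bdryIntegral_restrictBdry, integral_eq_sum,
    Finset.sum_congr rfl fun x _ => R.sum_face_tailField o he₀ hK hKs h0 hh x]
  have hrhs : ∀ x ∈ R.active, ∫ z in (R.chart x).e.target ∩ (R.chart x).e.symm ⁻¹' R.carrier,
        R.partition x ((R.chart x).e.symm z) *
          (orientSign o (R.chart x).e z *
            topCoeff (volField e₀ (firstPartial e₀ h)) (R.chart x).e z) =
      ∫ z in e₀.target ∩ e₀.symm ⁻¹' R.carrier,
        orientSign o e₀ z * (R.partition x (e₀.symm z) * firstPartial e₀ h (e₀.symm z)) := by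
    intro x _
    rw [← integral_topCoeff_volField o (R.chart x).mem_maximalAtlas he₀ R.isCompact.isClosed
      (h := fun y => R.partition x y * firstPartial e₀ h y)
      (fun y _ hy => R.tsupport_partition_subset x (subset_tsupport _ (left_ne_zero_of_mul hy)))
      (fun y _ hy => by
        refine hKs ?_
        by_contra hn
        exact right_ne_zero_of_mul hy (hk0 y hn))]
    congr 1
    funext z
    simp only [topCoeff, volField, AlternatingMap.smul_apply, smul_eq_mul]
    ring
  rw [Finset.sum_congr rfl hrhs, ← integral_finsetSum, ← integral_finsetSum]
  · refine setIntegral_congr_fun hA fun z hz => ?_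
    rw [← Finset.mul_sum, ← Finset.mul_sum]
    congr 1
    have h1 : ∀ x ∈ R.active, firstPartial e₀ (fun y => R.partition x y * h y) (e₀.symm z) =
        R.partition x (e₀.symm z) * firstPartial e₀ h (e₀.symm z) +
          h (e₀.symm z) * fderiv ℝ (R.partition x ∘ e₀.symm) z (stdVec 0) := by
      intro x _
      rw [firstPartial_symm _ _ hz.1, firstPartial_symm _ _ hz.1]
      have hn := e₀.open_target.mem_nhds hz.1
      change fderiv ℝ (fun w => (R.partition x ∘ e₀.symm) w * (h ∘ e₀.symm) w) z _ = _
      rw [fderiv_fun_mul (((hd x).contDiffAt hn).differentiableAt one_ne_zero)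
        ((hh.contDiffAt hn).differentiableAt one_ne_zero)]
      simp
    rw [Finset.sum_congr rfl h1, Finset.sum_add_distrib, ← Finset.mul_sum]
    have h2 := congrArg (fun T : Model d →L[ℝ] ℝ => T (stdVec 0))
      (R.fderiv_sum_partition he₀ hz.1 hz.2)
    simp only [sum_apply, zero_apply] at h2
    rw [h2, mul_zero, add_zero]
  · intro x _
    exact hint (fun y => R.partition x y * firstPartial e₀ h y)
      ((hd x).continuousOn.mul (hfp h hh)) fun y hy => by simp [hk0 y hy]
  · intro x _
    exact hint _ (hfp _ ((hd x).mul hh)) fun y hy =>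
      firstPartial_eq_zero e₀ hK.isClosed (fun y hy => by simp [h0 y hy]) hy

end Subbody

end Stokes

/-! ### Transformation of the components of jets -/

namespace LocalCoords

section Transition

variable {d : ℕ} {X : Type*} [TopologicalSpace X] [ChartedSpace (Model d) X]
  {J : X → Type*} [∀ x, AddCommGroup (J x)] [∀ x, Module ℝ (J x)]
  {M : Type*} [NormedAddCommGroup M] [NormedSpace ℝ M] (C : LocalCoords d J M)
  {N : Type*} [NormedAddCommGroup N] [NormedSpace ℝ N]

/-- The coordinates, in the chart at `x₁`, of the common domain of the coordinates at `x₁` and at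
`x₀`. -/
def overlap (x₁ x₀ : X) : Set (Model d) :=
  C.coordDom x₁ ∩ (chartAt (Model d) x₁).symm ⁻¹' C.dom x₀

theorem mem_overlap_iff {x₁ x₀ : X} {z : Model d} : z ∈ C.overlap x₁ x₀ ↔
    z ∈ (chartAt (Model d) x₁).target ∧ (chartAt (Model d) x₁).symm z ∈ C.dom x₁ ∧
      (chartAt (Model d) x₁).symm z ∈ C.dom x₀ := by
  simp only [overlap, coordDom, mem_inter_iff, mem_preimage]
  tauto

theorem isOpen_overlap (x₁ x₀ : X) : IsOpen (C.overlap x₁ x₀) := by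
  have : C.overlap x₁ x₀ = (chartAt (Model d) x₁).target ∩
      (chartAt (Model d) x₁).symm ⁻¹' (C.dom x₁ ∩ C.dom x₀) := by
    ext z
    rw [mem_overlap_iff]; rfl
  rw [this]
  exact (chartAt (Model d) x₁).isOpen_inter_preimage_symm
    ((C.isOpen_dom x₁).inter (C.isOpen_dom x₀))

theorem chart_mem_overlap {x₁ x₀ y : X} (h₁ : y ∈ C.dom x₁) (h₀ : y ∈ C.dom x₀) :
    chartAt (Model d) x₁ y ∈ C.overlap x₁ x₀ := by
  have hl := (chartAt (Model d) x₁).left_inv (C.dom_subset x₁ h₁)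
  rw [mem_overlap_iff, hl]
  exact ⟨(chartAt (Model d) x₁).map_source (C.dom_subset x₁ h₁), h₁, h₀⟩

theorem overlap_subset_transDom (x₁ x₀ : X) :
    C.overlap x₁ x₀ ⊆ transDom (chartAt (Model d) x₁) (chartAt (Model d) x₀) := by
  intro z hz
  rw [mem_overlap_iff] at hz
  exact ⟨hz.1, C.dom_subset x₀ hz.2.2⟩

/-- The part `L` of the fibre coordinates transforms smoothly between the coordinates at any two
points. -/
def SmoothTransition (L : M →L[ℝ] N) : Prop :=
  ∀ x₀ x₁ : X, ∃ T : Model d → M →L[ℝ] N, ContDiffOn ℝ ∞ T (C.overlap x₁ x₀) ∧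
    ∀ y ∈ C.dom x₀, y ∈ C.dom x₁ → ∀ a : J y,
      L (C.coord x₀ y a) = T (chartAt (Model d) x₁ y) (C.coord x₁ y a)

variable (d M) in
/-- The component of order zero of the coordinates of jets. -/
def jetProj₀ (k : ℕ) : (∀ j : Fin (k + 1), (Model d) [×(j : ℕ)]→L[ℝ] M) →L[ℝ] M :=
  (continuousMultilinearCurryFin0 ℝ (Model d) M).toContinuousLinearEquiv.toContinuousLinearMap ∘L
    ContinuousLinearMap.proj (R := ℝ) (φ := fun j : Fin (k + 1) => (Model d) [×(j : ℕ)]→L[ℝ] M) 0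

variable (d M) in
/-- The component of order one of the coordinates of jets. -/
def jetProj₁ (k : ℕ) : (∀ j : Fin (k + 2), (Model d) [×(j : ℕ)]→L[ℝ] M) →L[ℝ] Model d →L[ℝ] M :=
  (continuousMultilinearCurryFin1 ℝ (Model d) M).toContinuousLinearEquiv.toContinuousLinearMap ∘L
    ContinuousLinearMap.proj (R := ℝ) (φ := fun j : Fin (k + 2) => (Model d) [×(j : ℕ)]→L[ℝ] M) 1

theorem jetProj₀_derivs (k : ℕ) {x₀ y : X} (hy : y ∈ C.dom x₀) (A : C.CkSection k) :
    jetProj₀ d M k (C.derivs k hy A) = C.rep A.1 x₀ (chartAt (Model d) x₀ y) := rfl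

theorem jetProj₁_derivs (k : ℕ) {x₀ y : X} (hy : y ∈ C.dom x₀) (A : C.CkSection (k + 1 : ℕ)) :
    jetProj₁ d M k (C.derivs (k + 1) hy A) =
      fderiv ℝ (C.rep A.1 x₀) (chartAt (Model d) x₀ y) := by
  ext v
  change iteratedFDeriv ℝ 1 (C.rep A.1 x₀) (chartAt (Model d) x₀ y) (Fin.snoc 0 v) = _
  rw [iteratedFDeriv_one_apply]
  rfl

theorem rep_chart {x₀ y : X} (hy : y ∈ C.dom x₀) (A : ∀ y, J y) :
    C.rep A x₀ (chartAt (Model d) x₀ y) = C.coord x₀ y (A y) := by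
  rw [rep, (chartAt (Model d) x₀).left_inv (C.dom_subset x₀ hy)]

theorem jetAt_surjective (k : ℕ) (y : X) : Function.Surjective (C.jetAt k y) :=
  Submodule.mkQ_surjective _

-- The component of order zero of a jet is the local representative itself, so it inherits the
-- transition of the underlying coordinates.
variable {C} in
theorem SmoothTransition.jetProj₀ {L : M →L[ℝ] N} (hL : C.SmoothTransition L) (k : ℕ) :
    (C.jetCoords k).SmoothTransition (L ∘L jetProj₀ d M k) := by
  intro x₀ x₁
  obtain ⟨T, hT, h⟩ := hL x₀ x₁
  refine ⟨fun z => T z ∘L LocalCoords.jetProj₀ d M k, hT.clm_comp contDiffOn_const, ?_⟩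
  intro y h₀ h₁ a
  obtain ⟨A, rfl⟩ := C.jetAt_surjective k y a
  have h₀' : y ∈ C.dom x₀ := h₀
  have h₁' : y ∈ C.dom x₁ := h₁
  rw [C.jetCoords_coord_jetAt k h₀', C.jetCoords_coord_jetAt k h₁']
  change L (LocalCoords.jetProj₀ d M k (C.derivs k h₀' A)) =
    T _ (LocalCoords.jetProj₀ d M k (C.derivs k h₁' A))
  rw [jetProj₀_derivs, jetProj₀_derivs, rep_chart _ h₀', rep_chart _ h₁']
  exact h y h₀ h₁ _

-- Differentiating the transition law of the representatives produces a term with the derivative of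
-- `T` acting on the value, and a term with `T` acting on the first derivative. Both components are
-- available in jets of order at least one, which is why the order is `k + 1`.
variable {C} in
theorem SmoothTransition.jetProj₁ [IsManifold 𝓘(ℝ, Model d) ∞ X] {L : M →L[ℝ] N}
    (hL : C.SmoothTransition L) (k : ℕ) (v : Model d) :
    (C.jetCoords (k + 1)).SmoothTransition
      (L ∘L ContinuousLinearMap.apply ℝ M v ∘L jetProj₁ d M k) := by
  intro x₀ x₁
  obtain ⟨T, hT, h⟩ := hL x₀ x₁
  set e₀ := chartAt (Model d) x₀ with e₀_def
  set e₁ := chartAt (Model d) x₁ with e₁_def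
  have he₀ : e₀ ∈ IsManifold.maximalAtlas 𝓘(ℝ, Model d) ∞ X := IsManifold.chart_mem_maximalAtlas _
  have he₁ : e₁ ∈ IsManifold.maximalAtlas 𝓘(ℝ, Model d) ∞ X := IsManifold.chart_mem_maximalAtlas _
  have hsub : C.overlap x₁ x₀ ⊆ transDom e₁ e₀ := C.overlap_subset_transDom x₁ x₀
  -- The constant vector `v` of the chart at `x₀`, expressed in the chart at `x₁`; it is the
  -- direction of differentiation there.
  let w : Model d → Model d := fun z => fderiv ℝ (e₁ ∘ e₀.symm) ((e₀ ∘ e₁.symm) z) v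
  have hw : ContDiffOn ℝ ∞ w (C.overlap x₁ x₀) :=
    ((contDiffOn_fderiv_trans he₀ he₁).comp ((contDiffOn_trans he₁ he₀).mono hsub)
      fun z hz => trans_mem_transDom (hsub hz)).clm_apply contDiffOn_const
  refine ⟨fun z => (fderiv ℝ T z (w z)) ∘L LocalCoords.jetProj₀ d M (k + 1) +
    T z ∘L ContinuousLinearMap.apply ℝ M (w z) ∘L LocalCoords.jetProj₁ d M k, ?_, ?_⟩
  · refine ContDiffOn.add ?_ ?_
    · exact ((hT.fderiv_of_isOpen (C.isOpen_overlap x₁ x₀) (by simp)).clm_apply hw).clm_comp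
        contDiffOn_const
    · refine hT.clm_comp (ContDiffOn.clm_comp ?_ contDiffOn_const)
      have happ : ContDiff ℝ ∞ fun v : Model d =>
          (ContinuousLinearMap.apply ℝ M v : (Model d →L[ℝ] M) →L[ℝ] M) := by fun_prop
      exact happ.comp_contDiffOn hw
  · intro y h₀ h₁ a
    have h₀' : y ∈ C.dom x₀ := h₀
    have h₁' : y ∈ C.dom x₁ := h₁
    obtain ⟨A, rfl⟩ := C.jetAt_surjective (k + 1) y a
    rw [C.jetCoords_coord_jetAt _ h₀', C.jetCoords_coord_jetAt _ h₁']
    change L ((LocalCoords.jetProj₁ d M k (C.derivs (k + 1) h₀' A)) v) =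
      (fderiv ℝ T (e₁ y) (w (e₁ y))) (LocalCoords.jetProj₀ d M (k + 1) (C.derivs (k + 1) h₁' A)) +
      T (e₁ y) ((LocalCoords.jetProj₁ d M k (C.derivs (k + 1) h₁' A)) (w (e₁ y)))
    rw [jetProj₁_derivs, jetProj₁_derivs, jetProj₀_derivs]
    have hs₀ : y ∈ e₀.source := C.dom_subset x₀ h₀'
    have hs₁ : y ∈ e₁.source := C.dom_subset x₁ h₁'
    have hwy : w (e₁ y) = fderiv ℝ (e₁ ∘ e₀.symm) (e₀ y) v := by
      simp only [w, Function.comp, e₁.left_inv hs₁]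
    have hψy : (e₁ ∘ e₀.symm) (e₀ y) = e₁ y := by simp only [Function.comp, e₀.left_inv hs₀]
    -- The transition law near the point. Its two sides are differentiated separately, and
    -- uniqueness of the derivative equates the results.
    have hev : (fun z => L (C.rep A.1 x₀ z)) =ᶠ[𝓝 (e₀ y)]
        fun z => T ((e₁ ∘ e₀.symm) z) (C.rep A.1 x₁ ((e₁ ∘ e₀.symm) z)) := by
      filter_upwards [(C.isOpen_overlap x₀ x₁).mem_nhds (C.chart_mem_overlap h₀' h₁')] with z hz
      rw [mem_overlap_iff] at hz
      change L (C.coord x₀ (e₀.symm z) (A.1 (e₀.symm z))) =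
        T (e₁ (e₀.symm z)) (C.rep A.1 x₁ (e₁ (e₀.symm z)))
      rw [rep_chart _ hz.2.2]
      exact h _ hz.2.1 hz.2.2 _
    have hd₀ : DifferentiableAt ℝ (C.rep A.1 x₀) (e₀ y) :=
      (C.contDiffAt_rep A (C.chart_mem_coordDom h₀')).differentiableAt (by simp)
    have hd₁ : DifferentiableAt ℝ (C.rep A.1 x₁) (e₁ y) :=
      (C.contDiffAt_rep A (C.chart_mem_coordDom h₁')).differentiableAt (by simp)
    have hTd : DifferentiableAt ℝ T (e₁ y) :=
      (hT.contDiffAt ((C.isOpen_overlap x₁ x₀).mem_nhds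
        (C.chart_mem_overlap h₁' h₀'))).differentiableAt (by simp)
    have hψ := hasFDerivAt_trans he₀ he₁ (mem_transDom hs₀ hs₁)
    have e1 : HasFDerivAt (fun z => L (C.rep A.1 x₀ z))
        (L ∘L fderiv ℝ (C.rep A.1 x₀) (e₀ y)) (e₀ y) := L.hasFDerivAt.comp _ hd₀.hasFDerivAt
    have e2 : HasFDerivAt (fun z => T ((e₁ ∘ e₀.symm) z))
        (fderiv ℝ T (e₁ y) ∘L fderiv ℝ (e₁ ∘ e₀.symm) (e₀ y)) (e₀ y) :=
      HasFDerivAt.comp (g := T) _ (by rw [hψy]; exact hTd.hasFDerivAt) hψ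
    have e3 : HasFDerivAt (fun z => C.rep A.1 x₁ ((e₁ ∘ e₀.symm) z))
        (fderiv ℝ (C.rep A.1 x₁) (e₁ y) ∘L fderiv ℝ (e₁ ∘ e₀.symm) (e₀ y)) (e₀ y) :=
      HasFDerivAt.comp (g := C.rep A.1 x₁) _ (by rw [hψy]; exact hd₁.hasFDerivAt) hψ
    have e4 := e1.unique ((e2.clm_apply e3).congr_of_eventuallyEq hev)
    have e5 := DFunLike.congr_fun e4 v
    simp only [ContinuousLinearMap.comp_apply, add_apply,
      ContinuousLinearMap.flip_apply, hψy, ← hwy] at e5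
    rw [e5, add_comm]

/-- The coordinates determine the elements of the fibre. -/
def Separating : Prop :=
  ∀ (y : X) (a : J y), (∀ x₀, y ∈ C.dom x₀ → C.coord x₀ y a = 0) → a = 0

/-- The jet space is by definition the quotient by the sections whose derivatives vanish in all
coordinates at the point. -/
theorem separating_jetCoords (k : ℕ) : (C.jetCoords k).Separating := by
  intro y a ha
  obtain ⟨A, rfl⟩ := C.jetAt_surjective k y a
  refine (Submodule.Quotient.mk_eq_zero _).mpr (C.mem_vanish.mpr fun x₀ hy => ?_)
  rw [← C.jetCoords_coord_jetAt k hy]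
  exact ha x₀ hy

variable {C} in
/-- The value of a section in terms of its jet. -/
def jetEval (hC : C.Separating) (k : ℕ) (y : X) : C.Jet k y →ₗ[ℝ] J y :=
  (C.vanish k y).liftQ ((LinearMap.proj y : (∀ y, J y) →ₗ[ℝ] J y) ∘ₗ (C.CkSection k).subtype) <| by
    intro A hA
    rw [LinearMap.mem_ker]
    refine hC y _ fun x₀ hy => ?_
    have h := congrFun (C.mem_vanish.mp hA x₀ hy) 0
    change C.coord x₀ y (A.1 y) = 0
    rw [← rep_chart _ hy]
    change iteratedFDeriv ℝ 0 (C.rep A.1 x₀) (chartAt (Model d) x₀ y) = 0 at h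
    exact congrArg (fun f : (Model d) [×0]→L[ℝ] M => f 0) h

theorem jetEval_jetAt (hC : C.Separating) (k : ℕ) (y : X) (A : C.CkSection k) :
    jetEval hC k y (C.jetAt k y A) = A.1 y := rfl

theorem jetProj₀_coord (hC : C.Separating) (k : ℕ) {x₀ y : X} (hy : y ∈ C.dom x₀)
    (a : C.Jet k y) : jetProj₀ d M k ((C.jetCoords k).coord x₀ y a) =
      C.coord x₀ y (jetEval hC k y a) := by
  obtain ⟨A, rfl⟩ := C.jetAt_surjective k y a
  rw [C.jetCoords_coord_jetAt k hy, jetProj₀_derivs, rep_chart _ hy, jetEval_jetAt]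

/-- Derivatives of order at most `k` of a `C^k` section are still continuous. This is the regularity
that makes the power densities integrable. -/
theorem jetAt_mem_CkSection_zero (k : ℕ) (A : C.CkSection k) :
    (fun y => C.jetAt k y A) ∈ (C.jetCoords k).CkSection 0 := by
  intro x₀
  change ContDiffOn ℝ _ _ (C.coordDom x₀)
  refine ContDiffOn.congr (f := fun z => fun j : Fin (k + 1) =>
      iteratedFDeriv ℝ j (C.rep A.1 x₀) z) ?_ fun z hz => C.rep_jetAt k A hz
  refine contDiffOn_pi.mpr fun j z hz =>
    ((C.contDiffAt_rep A hz).iteratedFDeriv_right ?_).contDiffWithinAt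
  have := j.2
  exact_mod_cast (by omega : 0 + (j : ℕ) ≤ k)

end Transition

/-- The transition is the coordinate change of the two trivializations, smooth by smoothness of the
bundle. It is the starting point for the transitions of all jet components. -/
theorem smoothTransition_bundleCoords {d : ℕ} {X : Type*} [TopologicalSpace X]
    [ChartedSpace (Model d) X] [IsManifold 𝓘(ℝ, Model d) ∞ X]
    {F : Type*} [NormedAddCommGroup F] [NormedSpace ℝ F]
    {V : X → Type*} [∀ x, AddCommGroup (V x)] [∀ x, Module ℝ (V x)]
    [∀ x, TopologicalSpace (V x)] [TopologicalSpace (Bundle.TotalSpace F V)]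
    [FiberBundle F V] [VectorBundle ℝ F V] [ContMDiffVectorBundle ∞ F V 𝓘(ℝ, Model d)] :
    (bundleCoords d F V).SmoothTransition (ContinuousLinearMap.id ℝ F) := by
  intro x₀ x₁
  set t₀ := trivializationAt F V x₀
  set t₁ := trivializationAt F V x₁
  refine ⟨fun z => (t₁.coordChangeL ℝ t₀ ((chartAt (Model d) x₁).symm z) : F →L[ℝ] F), ?_, ?_⟩
  · rw [← contMDiffOn_iff_contDiffOn]
    refine (contMDiffOn_coordChangeL (n := ∞) (IB := 𝓘(ℝ, Model d)) t₁ t₀).comp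
      ((contMDiffOn_symm_of_mem_maximalAtlas
        (IsManifold.chart_mem_maximalAtlas x₁)).mono fun z hz => ?_) fun z hz => ?_
    · exact (((bundleCoords d F V).mem_overlap_iff).mp hz).1
    · have := ((bundleCoords d F V).mem_overlap_iff).mp hz
      exact ⟨this.2.1.2, this.2.2.2⟩
  · intro y h₀ h₁ a
    have hl := (chartAt (Model d) x₁).left_inv h₁.1
    change t₀.linearMapAt ℝ y a = t₁.coordChangeL ℝ t₀
      ((chartAt (Model d) x₁).symm (chartAt (Model d) x₁ y)) (t₁.linearMapAt ℝ y a)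
    rw [hl, Bundle.Trivialization.coordChangeL_apply t₁ t₀ ⟨h₁.2, h₀.2⟩,
      congrFun (Bundle.Trivialization.coe_linearMapAt_of_mem (R := ℝ) t₀ h₀.2) a,
      congrFun (Bundle.Trivialization.coe_linearMapAt_of_mem (R := ℝ) t₁ h₁.2) a]
    have : t₁.symm y (t₁ ⟨y, a⟩).2 = a := t₁.symm_apply_apply_mk h₁.2 a
    rw [this]

end LocalCoords

/-! ### Form-valued fields: algebra, continuity and construction in coordinates -/

section Fields

variable {d : ℕ} {X : Type*} [TopologicalSpace X] [ChartedSpace (Model d) X]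
  {J : X → Type*} [∀ x, AddCommGroup (J x)] [∀ x, Module ℝ (J x)]
  {M : Type*} [NormedAddCommGroup M] [NormedSpace ℝ M] {C : LocalCoords d J M} {p : ℕ}
  {N : Type*} [NormedAddCommGroup N] [NormedSpace ℝ N]

namespace FormValued

instance : Add (FormValued C p) where
  add S S' :=
    { toFun := fun x => S.toFun x + S'.toFun x
      smooth := by
        intro x₀ x hx
        obtain ⟨U, β, hU, hxU, hUd, hβ, h⟩ := S.smooth x₀ x hx
        obtain ⟨U', β', hU', hxU', hUd', hβ', h'⟩ := S'.smooth x₀ x hx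
        refine ⟨U ∩ U', fun z => β z + β' z, hU.inter hU', ⟨hxU, hxU'⟩,
          inter_subset_left.trans hUd, ?_, ?_⟩
        · exact (hβ.mono fun z hz => ⟨hz.1, hz.2.1⟩).add (hβ'.mono fun z hz => ⟨hz.1, hz.2.2⟩)
        · intro y hy a v
          change S.toFun y a v + S'.toFun y a v = _
          rw [h y hy.1, h' y hy.2]
          rfl }

instance : Neg (FormValued C p) where
  neg S :=
    { toFun := fun x => -S.toFun x
      smooth := by
        intro x₀ x hx
        obtain ⟨U, β, hU, hxU, hUd, hβ, h⟩ := S.smooth x₀ x hx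
        refine ⟨U, fun z => -β z, hU, hxU, hUd, hβ.neg, ?_⟩
        intro y hy a v
        change -(S.toFun y a v) = _
        rw [h y hy]
        rfl }

theorem add_toFun (S S' : FormValued C p) (x : X) : (S + S').toFun x = S.toFun x + S'.toFun x := rfl

theorem add_toFun_apply (S S' : FormValued C p) (x : X) (a : J x) :
    (S + S').toFun x a = S.toFun x a + S'.toFun x a := rfl

/-- Around each point the preferred coordinates express the value through a smooth coefficient, the
continuous representative of `A` and the derivative of the transition map; continuity in an
arbitrary chart follows. -/
theorem contForm (S : FormValued C p) [IsManifold 𝓘(ℝ, Model d) ∞ X] {A : ∀ x, J x}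
    (hA : A ∈ C.CkSection 0) : ContForm fun x => S.toFun x (A x) := by
  intro e he l z hz
  refine ContinuousAt.continuousWithinAt ?_
  set x₀ := e.symm z
  set e₀ := chartAt (Model d) x₀ with e₀_def
  have he₀ : e₀ ∈ IsManifold.maximalAtlas 𝓘(ℝ, Model d) ∞ X := IsManifold.chart_mem_maximalAtlas _
  obtain ⟨U, β, hU, hxU, hUd, hβ, h⟩ := S.smooth x₀ x₀ (C.mem_dom x₀)
  have hz' : z ∈ transDom e e₀ := ⟨hz, mem_chart_source _ _⟩
  have hcs : ∀ᶠ w in 𝓝 z, w ∈ transDom e e₀ ∧ e.symm w ∈ U :=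
    ((isOpen_transDom e e₀).eventually_mem hz').and
      ((e.continuousAt_symm hz).eventually (hU.eventually_mem hxU))
  have hev : (fun w => S.toFun (e.symm w) (A (e.symm w)) (fun i => frame e w (l i))) =ᶠ[𝓝 z]
      fun w => β ((e₀ ∘ e.symm) w) (C.rep A x₀ ((e₀ ∘ e.symm) w))
        (fun i => fderiv ℝ (e₀ ∘ e.symm) w (stdVec (l i))) := by
    filter_upwards [hcs] with w hw
    rw [h _ hw.2]
    change _ = β _ (C.rep A x₀ (e₀ (e.symm w))) _
    rw [C.rep_chart (hUd hw.2)]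
    congr 1
    funext i
    exact chartDeriv_frame he he₀ hw.1 (l i)
  refine ContinuousAt.congr ?_ hev.symm
  have hψ : ContinuousAt (e₀ ∘ e.symm) z := (contDiffAt_trans he he₀ hz').continuousAt
  have hψz : (e₀ ∘ e.symm) z ∈ C.coordDom x₀ := C.chart_mem_coordDom (C.mem_dom x₀)
  have h1 : ContinuousAt (fun w => β ((e₀ ∘ e.symm) w)) z := by
    refine ContinuousAt.comp (f := e₀ ∘ e.symm) (g := β) ?_ hψ
    refine hβ.continuousOn.continuousAt ((e₀.isOpen_inter_preimage_symm hU).mem_nhds ⟨hψz.1, ?_⟩)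
    change e₀.symm (e₀ x₀) ∈ U
    rwa [e₀.left_inv hz'.2]
  have h2 : ContinuousAt (fun w => C.rep A x₀ ((e₀ ∘ e.symm) w)) z := by
    refine ContinuousAt.comp (f := e₀ ∘ e.symm) (g := C.rep A x₀) ?_ hψ
    exact (hA x₀).continuousOn.continuousAt ((C.isOpen_coordDom x₀).mem_nhds hψz)
  have h3 : ContinuousAt (fun w => fun i => fderiv ℝ (e₀ ∘ e.symm) w (stdVec (l i))) z := by
    refine tendsto_pi_nhds.mpr fun i => ?_
    have := (contDiffOn_fderiv_trans he he₀).continuousOn.continuousAt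
      ((isOpen_transDom e e₀).mem_nhds hz')
    exact this.clm_apply continuousAt_const
  have h4 := h1.clm_apply h2
  have h5 : Continuous fun q : ((Model d) [⋀^Fin p]→L[ℝ] ℝ) × (Fin p → Model d) => q.1 q.2 := by
    fun_prop
  exact h5.continuousAt.comp (h4.prodMk h3)

open Classical in
/-- A scalar-valued field given by a coefficient `μ` in the coordinates at `x₀`. -/
def coordCoeff (C : LocalCoords d J M) (L : M →L[ℝ] N) (x₀ : X) (μ : Model d → N →L[ℝ] ℝ) (y : X) :
    J y →ₗ[ℝ] ℝ :=
  if y ∈ C.dom x₀ then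
    (μ (chartAt (Model d) x₀ y) ∘L L : M →L[ℝ] ℝ).toLinearMap ∘ₗ C.coord x₀ y
  else 0

theorem coordCoeff_of_mem (L : M →L[ℝ] N) {x₀ : X} (μ : Model d → N →L[ℝ] ℝ) {y : X}
    (hy : y ∈ C.dom x₀) (a : J y) : coordCoeff C L x₀ μ y a =
      μ (chartAt (Model d) x₀ y) (L (C.coord x₀ y a)) := by
  rw [coordCoeff, if_pos hy]; rfl

theorem coordCoeff_of_notMem (L : M →L[ℝ] N) {x₀ : X} (μ : Model d → N →L[ℝ] ℝ) {y : X}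
    (hy : y ∉ C.dom x₀) : coordCoeff C L x₀ μ y = 0 := by
  rw [coordCoeff, if_neg hy]

/-- A form-valued field given, in the coordinates at `x₀`, by a smooth coefficient whose support
is contained in the closed set `K ⊆ dom x₀`. -/
def ofCoord [IsManifold 𝓘(ℝ, Model d) ∞ X] (L : M →L[ℝ] N) (hL : C.SmoothTransition L) (x₀ : X)
    (μ : Model d → N →L[ℝ] ℝ) (hμ : ContDiff ℝ ∞ μ) (K : Set X) (hK : IsClosed K)
    (h0 : ∀ y ∈ C.dom x₀, y ∉ K → μ (chartAt (Model d) x₀ y) = 0) (hKd : K ⊆ C.dom x₀)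
    (α : (Model d) [⋀^Fin p]→L[ℝ] ℝ) : FormValued C p where
  toFun y := (coordCoeff C L x₀ μ y).smulRight
    (α.toAlternatingMap.compLinearMap (chartDeriv (chartAt (Model d) x₀) y : _ →ₗ[ℝ] Model d))
  smooth := by
    intro x₁ x hx
    by_cases hx₀ : x ∈ C.dom x₀
    · obtain ⟨T, hT, h⟩ := hL x₀ x₁
      set e₀ := chartAt (Model d) x₀
      set e₁ := chartAt (Model d) x₁
      have he₀ : e₀ ∈ IsManifold.maximalAtlas 𝓘(ℝ, Model d) ∞ X :=
        IsManifold.chart_mem_maximalAtlas _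
      have he₁ : e₁ ∈ IsManifold.maximalAtlas 𝓘(ℝ, Model d) ∞ X :=
        IsManifold.chart_mem_maximalAtlas _
      have hsub : C.overlap x₁ x₀ ⊆ transDom e₁ e₀ := C.overlap_subset_transDom x₁ x₀
      refine ⟨C.dom x₁ ∩ C.dom x₀, fun z => (μ ((e₀ ∘ e₁.symm) z) ∘L T z).smulRight
        (α.compContinuousLinearMap (fderiv ℝ (e₀ ∘ e₁.symm) z)),
        (C.isOpen_dom x₁).inter (C.isOpen_dom x₀), ⟨hx, hx₀⟩, inter_subset_left, ?_, ?_⟩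
      · have hov : e₁.target ∩ e₁.symm ⁻¹' (C.dom x₁ ∩ C.dom x₀) = C.overlap x₁ x₀ := by
          ext z
          rw [C.mem_overlap_iff]; rfl
        rw [hov]
        have h1 : ContDiffOn ℝ ∞ (fun z => μ ((e₀ ∘ e₁.symm) z) ∘L T z) (C.overlap x₁ x₀) :=
          (hμ.comp_contDiffOn ((contDiffOn_trans he₁ he₀).mono hsub)).clm_comp hT
        have h2 : ContDiffOn ℝ ∞ (fun z => α.compContinuousLinearMap
            (fderiv ℝ (e₀ ∘ e₁.symm) z)) (C.overlap x₁ x₀) :=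
          contDiffOn_compContinuousLinearMap α ((contDiffOn_fderiv_trans he₁ he₀).mono hsub)
        have hs : ContDiff ℝ ∞ fun q : (M →L[ℝ] ℝ) × ((Model d) [⋀^Fin p]→L[ℝ] ℝ) =>
            q.1.smulRight q.2 := by fun_prop
        exact hs.comp_contDiffOn (h1.prodMk h2)
      · intro y hy a v
        change coordCoeff C L x₀ μ y a • α (fun i => chartDeriv e₀ y (v i)) =
          (μ (e₀ (e₁.symm (e₁ y)))) (T (e₁ y) (C.coord x₁ y a)) •
            α (fun i => fderiv ℝ (e₀ ∘ e₁.symm) (e₁ y) (chartDeriv e₁ y (v i)))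
        have hs₁ : y ∈ e₁.source := C.dom_subset x₁ hy.1
        have hs₀ : y ∈ e₀.source := C.dom_subset x₀ hy.2
        rw [e₁.left_inv hs₁, coordCoeff_of_mem L μ hy.2, h y hy.2 hy.1]
        congr 2
        funext i
        exact fderiv_trans_comp_chartDeriv he₁ he₀ hs₁ hs₀ (v i)
    -- Away from the coordinate domain the closed set `K` is avoided in a whole neighbourhood, where
    -- the field is zero.
    · refine ⟨C.dom x₁ ∩ Kᶜ, fun _ => 0, (C.isOpen_dom x₁).inter hK.isOpen_compl,
        ⟨hx, fun h => hx₀ (hKd h)⟩, inter_subset_left, contDiffOn_const, ?_⟩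
      intro y hy a v
      have : coordCoeff C L x₀ μ y a = 0 := by
        by_cases hy₀ : y ∈ C.dom x₀
        · rw [coordCoeff_of_mem L μ hy₀, h0 y hy₀ hy.2]; rfl
        · rw [coordCoeff_of_notMem L μ hy₀]; rfl
      simp [this]

/-- A field acting on the values of sections, as a field acting on their jets. -/
def onJets (hC : C.Separating) (S : FormValued C p) (k : ℕ) : FormValued (C.jetCoords k) p where
  toFun y := S.toFun y ∘ₗ LocalCoords.jetEval hC k y
  smooth := by
    intro x₀ x hx
    obtain ⟨U, β, hU, hxU, hUd, hβ, h⟩ := S.smooth x₀ x hx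
    refine ⟨U, fun z => β z ∘L LocalCoords.jetProj₀ d M k, hU, hxU, hUd,
      hβ.clm_comp contDiffOn_const, ?_⟩
    intro y hy a v
    change S.toFun y (LocalCoords.jetEval hC k y a) v =
      β _ (LocalCoords.jetProj₀ d M k ((C.jetCoords k).coord x₀ y a)) _
    rw [C.jetProj₀_coord hC k (hUd hy), h y hy]

end FormValued

namespace HyperForceSystem

variable {V : X → Type*} [∀ x, AddCommGroup (V x)] [∀ x, Module ℝ (V x)]
  {F : Type*} [NormedAddCommGroup F] [NormedSpace ℝ F] {W : LocalCoords d V F} {k : ℕ}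

/-- The system with a given body hyper-force whose hyper-tractions are the restrictions of a
traction hyper-stress. -/
def ofTractionStress (b : BodyHyperForce W k) (σ : TractionHyperStress W k) :
    HyperForceSystem W k where
  body := b
  traction R x :=
    { toFun := fun a => (σ.toFun x a).compLinearMap (R.bdryTangent (x : X)).subtype
      map_add' := fun a a' => by rw [map_add]; rfl
      map_smul' := fun r a => by rw [map_smul]; rfl }
  traction_smooth R x c i _ := ⟨σ, Eventually.of_forall fun _ _ _ _ _ _ => rfl⟩

theorem restrictBdry_tractionStress (b : BodyHyperForce W k) (σ : TractionHyperStress W k)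
    (R : Subbody d X) (A : ∀ x, W.Jet k x) :
    (fun x : frontier R.carrier => (ofTractionStress b σ).traction R x (A x)) =
      R.restrictBdry fun x => σ.toFun x (A x) := rfl

end HyperForceSystem

end Fields

/-! ### Bump-function fields and the product rule -/

section Localized

variable {d : ℕ} {X : Type*} [TopologicalSpace X] [ChartedSpace (Model d) X]
  {J : X → Type*} [∀ x, AddCommGroup (J x)] [∀ x, Module ℝ (J x)]
  {M : Type*} [NormedAddCommGroup M] [NormedSpace ℝ M] {C : LocalCoords d J M} {p : ℕ}
  {N : Type*} [NormedAddCommGroup N] [NormedSpace ℝ N]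

/-- The points with coordinates in the support of `φ`. -/
def supportAt (x₀ : X) (φ : Model d → ℝ) : Set X :=
  (chartAt (Model d) x₀).symm '' tsupport φ

theorem isCompact_supportAt {x₀ : X} {φ : Model d → ℝ} (hc : HasCompactSupport φ)
    (hs : tsupport φ ⊆ C.coordDom x₀) : IsCompact (supportAt x₀ φ) :=
  hc.isCompact.image_of_continuousOn
    ((chartAt (Model d) x₀).continuousOn_symm.mono (hs.trans inter_subset_left))

theorem supportAt_subset {x₀ : X} {φ : Model d → ℝ} (hs : tsupport φ ⊆ C.coordDom x₀) :
    supportAt x₀ φ ⊆ C.dom x₀ := by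
  rintro _ ⟨z, hz, rfl⟩
  exact (hs hz).2

theorem eq_zero_of_notMem_supportAt {x₀ y : X} {φ : Model d → ℝ}
    (hy : y ∈ (chartAt (Model d) x₀).source) (h : y ∉ supportAt x₀ φ) :
    φ (chartAt (Model d) x₀ y) = 0 := by
  by_contra h0
  exact h ⟨_, subset_tsupport _ h0, (chartAt (Model d) x₀).left_inv hy⟩

section Coefficients

open FormValued

variable {L : M →L[ℝ] N} {x₀ : X} {φ : Model d → ℝ} {l : N →L[ℝ] ℝ}

theorem coordCoeff_apply_of_notMem {μ : Model d → N →L[ℝ] ℝ} {y : X} (h : y ∉ C.dom x₀) (a : J y) :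
    coordCoeff C L x₀ μ y a = 0 := by
  rw [coordCoeff_of_notMem _ _ h, LinearMap.zero_apply]

theorem coordCoeff_symm {μ : Model d → N →L[ℝ] ℝ} (A : ∀ y, J y) {z : Model d}
    (hz : z ∈ C.coordDom x₀) :
    coordCoeff C L x₀ μ ((chartAt (Model d) x₀).symm z) (A ((chartAt (Model d) x₀).symm z)) =
      μ z (L (C.rep A x₀ z)) := by
  rw [coordCoeff_of_mem _ _ hz.2, (chartAt (Model d) x₀).right_inv hz.1]
  rfl

theorem coordCoeff_eq_zero (a : ∀ y, J y) {y : X} (hy : y ∉ supportAt x₀ φ) :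
    coordCoeff C L x₀ (fun z => φ z • l) y (a y) = 0 := by
  by_cases h : y ∈ C.dom x₀
  · rw [coordCoeff_of_mem _ _ h, eq_zero_of_notMem_supportAt (C.dom_subset x₀ h) hy, zero_smul]
    rfl
  · rw [coordCoeff_of_notMem _ _ h]
    rfl

/-- The support of `φ` is compact in a Hausdorff space, hence closed, so the extension by zero is
locally zero at points outside the coordinate domain. -/
theorem contDiffOn_coordCoeff [T2Space X] (hφ : ContDiff ℝ ∞ φ) (hc : HasCompactSupport φ)
    (hs : tsupport φ ⊆ C.coordDom x₀) {r : ℕ} (A : C.CkSection r) :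
    ContDiffOn ℝ r ((fun y => coordCoeff C L x₀ (fun z => φ z • l) y (A.1 y)) ∘
      (chartAt (Model d) x₀).symm) (chartAt (Model d) x₀).target := by
  intro z hz
  refine ContDiffAt.contDiffWithinAt ?_
  by_cases h : (chartAt (Model d) x₀).symm z ∈ C.dom x₀
  · have hz' : z ∈ C.coordDom x₀ := ⟨hz, h⟩
    have hev : (fun y => coordCoeff C L x₀ (fun z => φ z • l) y (A.1 y)) ∘
        (chartAt (Model d) x₀).symm =ᶠ[𝓝 z] fun z => φ z * l (L (C.rep A.1 x₀ z)) := by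
      filter_upwards [(C.isOpen_coordDom x₀).mem_nhds hz'] with z' hz'
      exact coordCoeff_symm A.1 hz'
    refine ContDiffAt.congr_of_eventuallyEq ?_ hev
    exact ((hφ.of_le (by exact_mod_cast le_top)).contDiffAt).mul
      ((l ∘L L).contDiff.contDiffAt.comp z (C.contDiffAt_rep A hz'))
  · have hK := (isCompact_supportAt hc hs).isClosed
    have hev : (fun y => coordCoeff C L x₀ (fun z => φ z • l) y (A.1 y)) ∘
        (chartAt (Model d) x₀).symm =ᶠ[𝓝 z] fun _ => 0 := by
      filter_upwards [((chartAt (Model d) x₀).continuousAt_symm hz).eventually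
        (hK.isOpen_compl.mem_nhds fun h' => h (supportAt_subset hs h'))] with z' hz'
      exact coordCoeff_eq_zero A.1 hz'
    exact contDiffAt_const.congr_of_eventuallyEq hev

/-- The product rule for `φ λ(L A)`. -/
theorem firstPartial_coordCoeff [T2Space X] (hφ : ContDiff ℝ ∞ φ) (hc : HasCompactSupport φ)
    (hs : tsupport φ ⊆ C.coordDom x₀) (A : C.CkSection (1 : ℕ)) (y : X) :
    firstPartial (chartAt (Model d) x₀)
        (fun y => coordCoeff C L x₀ (fun z => φ z • l) y (A.1 y)) y =
      coordCoeff C L x₀ (fun z => fderiv ℝ φ z (stdVec 0) • l) y (A.1 y) +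
      coordCoeff (C.jetCoords 1) (L ∘L ContinuousLinearMap.apply ℝ M (stdVec 0 : Model d) ∘L
        LocalCoords.jetProj₁ d M 0) x₀ (fun z => φ z • l) y (C.jetAt 1 y A) := by
  by_cases h : y ∈ C.dom x₀
  · have h' : y ∈ (C.jetCoords 1).dom x₀ := h
    have hz : chartAt (Model d) x₀ y ∈ C.coordDom x₀ := C.chart_mem_coordDom h
    rw [coordCoeff_of_mem _ _ h, coordCoeff_of_mem _ _ h', C.jetCoords_coord_jetAt 1 h]
    have hev : (fun y => coordCoeff C L x₀ (fun z => φ z • l) y (A.1 y)) ∘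
        (chartAt (Model d) x₀).symm =ᶠ[𝓝 (chartAt (Model d) x₀ y)]
        fun z => φ z * (l ∘L L) (C.rep A.1 x₀ z) := by
      filter_upwards [(C.isOpen_coordDom x₀).mem_nhds hz] with z' hz'
      exact coordCoeff_symm A.1 hz'
    have hA := (C.contDiffAt_rep A hz).differentiableAt (by simp)
    have hφd := (hφ.differentiable (by simp) (chartAt (Model d) x₀ y)).hasFDerivAt
    have hd := hφd.mul ((l ∘L L).hasFDerivAt.comp _ hA.hasFDerivAt)
    have hd' := DFunLike.congr_fun (hd.congr_of_eventuallyEq hev).fderiv (stdVec 0)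
    rw [firstPartial, indicator_of_mem (C.dom_subset x₀ h), hd', ← LocalCoords.rep_chart _ h]
    change _ = _ + φ _ * l (L (LocalCoords.jetProj₁ d M 0 (C.derivs (0 + 1) h A) (stdVec 0)))
    rw [C.jetProj₁_derivs 0 h]
    change φ _ * _ + _ * fderiv ℝ φ _ (stdVec 0) = fderiv ℝ φ _ (stdVec 0) * _ + _
    rw [add_comm, mul_comm]
    rfl
  · have h' : y ∉ (C.jetCoords 1).dom x₀ := h
    rw [coordCoeff_of_notMem _ _ h, coordCoeff_of_notMem _ _ h',
      firstPartial_eq_zero _ (isCompact_supportAt hc hs).isClosed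
        (fun _ hy => coordCoeff_eq_zero A.1 hy) (fun h' => h (supportAt_subset hs h'))]
    simp

/-- Lifting a coefficient to jets through the component of order zero does not change its value on a
section. This compares terms that act on `A` with terms that act on `j¹A`. -/
theorem coordCoeff_jetProj₀ {μ : Model d → N →L[ℝ] ℝ} (k : ℕ) (A : C.CkSection k) (y : X) :
    coordCoeff (C.jetCoords k) (L ∘L LocalCoords.jetProj₀ d M k) x₀ μ y (C.jetAt k y A) =
      coordCoeff C L x₀ μ y (A.1 y) := by
  by_cases h : y ∈ C.dom x₀
  · have h' : y ∈ (C.jetCoords k).dom x₀ := h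
    rw [coordCoeff_of_mem _ _ h, coordCoeff_of_mem _ _ h', C.jetCoords_coord_jetAt k h,
      ← LocalCoords.rep_chart _ h]
    rfl
  · have h' : y ∉ (C.jetCoords k).dom x₀ := h
    rw [coordCoeff_of_notMem _ _ h, coordCoeff_of_notMem _ _ h']
    rfl

theorem coordCoeff_jetProj₁ {μ : Model d → N →L[ℝ] ℝ} (k : ℕ) (v : Model d)
    (A : C.CkSection (k + 1 : ℕ)) {y : X} (h : y ∈ C.dom x₀) :
    coordCoeff (C.jetCoords (k + 1)) (L ∘L ContinuousLinearMap.apply ℝ M v ∘L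
        LocalCoords.jetProj₁ d M k) x₀ μ y (C.jetAt (k + 1) y A) =
      μ (chartAt (Model d) x₀ y) (L (fderiv ℝ (C.rep A.1 x₀) (chartAt (Model d) x₀ y) v)) := by
  have h' : y ∈ (C.jetCoords (k + 1)).dom x₀ := h
  rw [coordCoeff_of_mem _ _ h', C.jetCoords_coord_jetAt (k + 1) h]
  change μ _ (L (LocalCoords.jetProj₁ d M k (C.derivs (k + 1) h A) v)) = _
  rw [C.jetProj₁_derivs k h]

/-- On holonomic jets, the derivative of the value is the derivative component. -/
theorem coordCoeff_prolong {μ : Model d → N →L[ℝ] ℝ} (k : ℕ) (v : Model d)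
    (w : C.CkSection (k + 2 : ℕ)) (y : X) :
    coordCoeff ((C.jetCoords (k + 1)).jetCoords 1) ((L ∘L LocalCoords.jetProj₀ d M (k + 1)) ∘L
        ContinuousLinearMap.apply ℝ _ v ∘L LocalCoords.jetProj₁ d _ 0) x₀ μ y
        ((C.jetCoords (k + 1)).jetAt 1 y (C.prolong (k + 1) w)) =
      coordCoeff (C.jetCoords (k + 1)) (L ∘L ContinuousLinearMap.apply ℝ M v ∘L
        LocalCoords.jetProj₁ d M k) x₀ μ y ((C.prolong (k + 1) w).1 y) := by
  by_cases h : y ∈ C.dom x₀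
  · have h' : y ∈ (C.jetCoords (k + 1)).dom x₀ := h
    have hz : chartAt (Model d) x₀ y ∈ C.coordDom x₀ := C.chart_mem_coordDom h
    refine (coordCoeff_jetProj₁ (C := C.jetCoords (k + 1)) 0 v (C.prolong (k + 1) w) h').trans
      (Eq.trans ?_ (coordCoeff_jetProj₁ k v (C.lower (k + 1) w) h).symm)
    refine congrArg (fun u => μ _ (L u)) ?_
    have hA := (((C.jetCoords (k + 1)).contDiffAt_rep (C.prolong (k + 1) w)
      (x₀ := x₀) hz).differentiableAt (by simp)).hasFDerivAt
    have hd := (LocalCoords.jetProj₀ d M (k + 1)).hasFDerivAt.comp _ hA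
    have hev : C.rep w.1 x₀ =ᶠ[𝓝 (chartAt (Model d) x₀ y)] LocalCoords.jetProj₀ d M (k + 1) ∘
        (C.jetCoords (k + 1)).rep (C.prolong (k + 1) w).1 x₀ := by
      filter_upwards [(C.isOpen_coordDom x₀).mem_nhds hz] with z' hz'
      have := C.rep_jetAt (k + 1) (C.lower (k + 1) w) hz'
      change _ = LocalCoords.jetProj₀ d M (k + 1) ((C.jetCoords (k + 1)).rep
        (fun y => C.jetAt (k + 1) y (C.lower (k + 1) w)) x₀ z')
      rw [this]
      rfl
    exact (DFunLike.congr_fun (hd.congr_of_eventuallyEq hev).fderiv v).symm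
  · have h₁ : y ∉ (C.jetCoords (k + 1)).dom x₀ := h
    rw [coordCoeff_apply_of_notMem h₁]
    apply coordCoeff_apply_of_notMem
    exact h

end Coefficients

namespace FormValued

variable [T2Space X] [IsManifold 𝓘(ℝ, Model d) ∞ X]

/-- The field `φ λ(L a) α` in the coordinates at `x₀`, for a bump function `φ`. -/
def ofBump {L : M →L[ℝ] N} (hL : C.SmoothTransition L) {x₀ : X} {φ : Model d → ℝ}
    (hφ : ContDiff ℝ ∞ φ) (hc : HasCompactSupport φ) (hs : tsupport φ ⊆ C.coordDom x₀)
    (l : N →L[ℝ] ℝ) (α : (Model d) [⋀^Fin p]→L[ℝ] ℝ) : FormValued C p :=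
  ofCoord L hL x₀ (fun z => φ z • l) (hφ.smul contDiff_const) (supportAt x₀ φ)
    (isCompact_supportAt hc hs).isClosed
    (fun y hy hyK => by rw [eq_zero_of_notMem_supportAt (C.dom_subset x₀ hy) hyK, zero_smul])
    (supportAt_subset hs) α

end FormValued

end Localized

/-! ### The perturbing traction, body hyper-force and stress -/

section Perturbation

open LocalCoords FormValued

variable {d : ℕ} {X : Type*} [TopologicalSpace X] [ChartedSpace (Model d) X]
  {V : X → Type*} [∀ x, AddCommGroup (V x)] [∀ x, Module ℝ (V x)]
  {F : Type*} [NormedAddCommGroup F] [NormedSpace ℝ F] {W : LocalCoords d V F}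

variable [T2Space X] [IsManifold 𝓘(ℝ, Model d) ∞ X]
  (hW : W.SmoothTransition (ContinuousLinearMap.id ℝ F)) (k : ℕ) {x₀ : X} {φ : Model d → ℝ}
  (hφ : ContDiff ℝ ∞ φ) (hc : HasCompactSupport φ) (hs : tsupport φ ⊆ W.coordDom x₀)
  (l : F →L[ℝ] ℝ)

/-- The localized traction hyper-stress `φ λ(w) dz₂ ∧ ⋯ ∧ dzₙ`. -/
def bumpTraction : TractionHyperStress W k :=
  ofBump (C := W.jetCoords k) (hW.jetProj₀ k) hφ hc hs l (tailForm d)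

/-- The body hyper-force that compensates for the divergence of `bumpTraction`. -/
def bumpBody : BodyHyperForce W (k + 1) :=
  -(ofBump (C := W.jetCoords (k + 1)) (hW.jetProj₀ (k + 1)) (φ := fun z => fderiv ℝ φ z (stdVec 0))
      ((hφ.fderiv_right (m := ∞) le_rfl).clm_apply contDiff_const)
      (hc.fderiv_apply ℝ (stdVec 0)) ((tsupport_fderiv_apply_subset ℝ _).trans hs) l (volForm d) +
    ofBump (C := W.jetCoords (k + 1)) (hW.jetProj₁ k (stdVec 0)) hφ hc hs l (volForm d))

/-- A non-holonomic stress that vanishes on holonomic jets: the difference of the derivative of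
the value and the derivative component of a section of the jet bundle. -/
def bumpStress : NonHolonomicStress W (k + 1) :=
  ofBump (C := (W.jetCoords (k + 1)).jetCoords 1)
      ((hW.jetProj₀ (k + 1)).jetProj₁ 0 (stdVec 0)) hφ hc hs l (volForm d) +
    -ofBump (C := (W.jetCoords (k + 1)).jetCoords 1)
      ((hW.jetProj₁ k (stdVec 0)).jetProj₀ 1) hφ hc hs l (volForm d)

/-- The scalar factor of `bumpTraction` on a section. -/
def bumpValue (W : LocalCoords d V F) (k : ℕ) (x₀ : X) (φ : Model d → ℝ) (l : F →L[ℝ] ℝ)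
    (A : ∀ y, W.Jet k y) (y : X) : ℝ :=
  coordCoeff (W.jetCoords k) (ContinuousLinearMap.id ℝ F ∘L jetProj₀ d F k) x₀
    (fun z => φ z • l) y (A y)

/-- In the product rule for `∂₁(φ λ(A₀))` the term with `∂₁φ` is cancelled by the first part of the
body hyper-force. There remain `φ λ(∂₁A₀)` and `-φ λ(A₁(e₁))`, the two terms of the stress. -/
theorem bump_identity (A : (W.jetCoords (k + 1)).CkSection (1 : ℕ)) (y : X) :
    volField (chartAt (Model d) x₀)
        (firstPartial (chartAt (Model d) x₀) (bumpValue W (k + 1) x₀ φ l A.1)) y +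
      (bumpBody hW k hφ hc hs l).toFun y (A.1 y) =
      (bumpStress hW k hφ hc hs l).toFun y ((W.jetCoords (k + 1)).jetAt 1 y A) := by
  have h := firstPartial_coordCoeff (C := W.jetCoords (k + 1)) (l := l)
    (L := ContinuousLinearMap.id ℝ F ∘L jetProj₀ d F (k + 1)) hφ hc hs A y
  have h' := coordCoeff_jetProj₀ (C := W.jetCoords (k + 1)) (x₀ := x₀) (μ := fun z => φ z • l)
    (L := ContinuousLinearMap.id ℝ F ∘L ContinuousLinearMap.apply ℝ F (stdVec 0 : Model d) ∘L
      jetProj₁ d F k) 1 A y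
  -- Here `a` and `c` are the two terms of the product rule for `f`, while `b` and `e` are the
  -- derivative component of `A`, read on `A` and on `j¹A`.
  have key : ∀ (f a b c e : ℝ) (v : FormAt d (d + 1) y), f = a + c → e = b →
      f • v + -(a • v + b • v) = c • v + -(e • v) := by
    rintro f a b c e v rfl rfl
    module
  exact key _ _ _ _ _ _ h h'

/-- For a jet extension the derivative of the value component is the derivative component, so the
two terms cancel. -/
theorem bumpStress_holonomic (y : X) :
    (bumpStress hW k hφ hc hs l).toFun y ∘ₗ W.holonomic (k + 1) y = 0 := by
  refine LinearMap.ext fun a => ?_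
  obtain ⟨w, rfl⟩ := W.jetAt_surjective _ y a
  rw [LinearMap.comp_apply, LocalCoords.holonomic_jetAt]
  have h := coordCoeff_prolong (C := W) (L := ContinuousLinearMap.id ℝ F) (x₀ := x₀)
    (μ := fun z => φ z • l) k (stdVec 0) w y
  have h' := coordCoeff_jetProj₀ (C := W.jetCoords (k + 1)) (x₀ := x₀) (μ := fun z => φ z • l)
    (L := ContinuousLinearMap.id ℝ F ∘L ContinuousLinearMap.apply ℝ F (stdVec 0 : Model d) ∘L
      jetProj₁ d F k) 1 (W.prolong (k + 1) w) y
  have key : ∀ (a b c : ℝ) (v : FormAt d (d + 1) y), a = b → c = b →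
      a • v + -(c • v) = 0 := by
    rintro a b c v rfl rfl
    module
  exact key _ _ _ _ h h'

/-- On a section, the localized traction is the form `h dz₂ ∧ ⋯ ∧ dzₙ` with `h` of class `C¹` and
compactly supported in the chart, as Stokes' theorem requires. -/
theorem bdryIntegral_bumpTraction [SigmaCompactSpace X] (o : OrientationForm d X) (R : Subbody d X)
    (A : (W.jetCoords k).CkSection (1 : ℕ)) :
    R.bdryIntegral o (R.restrictBdry fun y => (bumpTraction hW k hφ hc hs l).toFun y (A.1 y)) =
      R.integral o (volField (chartAt (Model d) x₀)
        (firstPartial (chartAt (Model d) x₀) (bumpValue W k x₀ φ l A.1))) :=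
  R.bdryIntegral_tailField o (IsManifold.chart_mem_maximalAtlas x₀) (isCompact_supportAt hc hs)
    ((supportAt_subset hs).trans (W.dom_subset x₀)) (fun _ hy => coordCoeff_eq_zero A.1 hy)
    (contDiffOn_coordCoeff (C := W.jetCoords k) hφ hc hs A)

end Perturbation

/-! ### Smooth test sections with prescribed local representative -/

section Sections

variable {d : ℕ} {X : Type*} [TopologicalSpace X] [ChartedSpace (Model d) X]
  {F : Type*} [NormedAddCommGroup F] [NormedSpace ℝ F]
  {V : X → Type*} [∀ x, AddCommGroup (V x)] [∀ x, Module ℝ (V x)]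
  [∀ x, TopologicalSpace (V x)] [TopologicalSpace (Bundle.TotalSpace F V)]
  [FiberBundle F V] [VectorBundle ℝ F V]

open Classical in
/-- The section with representative `s` in the coordinates at `x₀`, extended by zero. -/
def coordSection (V : X → Type*) [∀ x, AddCommGroup (V x)] [∀ x, Module ℝ (V x)]
    [∀ x, TopologicalSpace (V x)] [TopologicalSpace (Bundle.TotalSpace F V)]
    [FiberBundle F V] [VectorBundle ℝ F V] (x₀ : X) (s : Model d → F) (y : X) : V y :=
  if y ∈ (bundleCoords d F V).dom x₀ then
    (trivializationAt F V x₀).symmₗ ℝ y (s (chartAt (Model d) x₀ y))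
  else 0

theorem coord_coordSection {x₀ y : X} (s : Model d → F) (hy : y ∈ (bundleCoords d F V).dom x₀) :
    (bundleCoords d F V).coord x₀ y (coordSection V x₀ s y) = s (chartAt (Model d) x₀ y) := by
  rw [coordSection, if_pos hy]
  exact Bundle.Trivialization.linearMapAt_symmₗ _ hy.2 _

theorem rep_coordSection {x₀ : X} (s : Model d → F) {z : Model d}
    (hz : z ∈ (bundleCoords d F V).coordDom x₀) :
    (bundleCoords d F V).rep (coordSection V x₀ s) x₀ z = s z := by
  rw [LocalCoords.rep, coord_coordSection s hz.2, (chartAt (Model d) x₀).right_inv hz.1]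

/-- In other coordinates the representative is obtained by the smooth transition of the bundle; off
the domain at `x₀`, closedness of the support makes it locally zero. -/
theorem coordSection_mem_CkSection [T2Space X] [IsManifold 𝓘(ℝ, Model d) ∞ X]
    [ContMDiffVectorBundle ∞ F V 𝓘(ℝ, Model d)] {x₀ : X} {φ : Model d → ℝ} {g : Model d → F}
    (hφ : ContDiff ℝ ∞ φ) (hg : ContDiff ℝ ∞ g) (hc : HasCompactSupport φ)
    (hs : tsupport φ ⊆ (bundleCoords d F V).coordDom x₀) :
    coordSection V x₀ (fun z => φ z • g z) ∈ (bundleCoords d F V).CkSection ∞ := by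
  intro x₁ z hz
  refine ContDiffAt.contDiffWithinAt ?_
  set C := bundleCoords d F V
  set e₀ := chartAt (Model d) x₀ with e₀_def
  set e₁ := chartAt (Model d) x₁ with e₁_def
  have he₀ : e₀ ∈ IsManifold.maximalAtlas 𝓘(ℝ, Model d) ∞ X := IsManifold.chart_mem_maximalAtlas _
  have he₁ : e₁ ∈ IsManifold.maximalAtlas 𝓘(ℝ, Model d) ∞ X := IsManifold.chart_mem_maximalAtlas _
  by_cases h : e₁.symm z ∈ C.dom x₀
  · obtain ⟨T, hT, hTc⟩ := LocalCoords.smoothTransition_bundleCoords (d := d) (F := F)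
      (V := V) x₁ x₀
    have hov : z ∈ C.overlap x₁ x₀ := ⟨hz, h⟩
    have hev : C.rep (coordSection V x₀ fun z => φ z • g z) x₁ =ᶠ[𝓝 z]
        fun z => T ((e₀ ∘ e₁.symm) z) (φ ((e₀ ∘ e₁.symm) z) • g ((e₀ ∘ e₁.symm) z)) := by
      filter_upwards [(C.isOpen_overlap x₁ x₀).mem_nhds hov] with z' hz'
      have h2 := hTc _ hz'.1.2 hz'.2 (coordSection V x₀ (fun z => φ z • g z) (e₁.symm z'))
      rw [coord_coordSection _ hz'.2] at h2
      exact h2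
    refine ContDiffAt.congr_of_eventuallyEq ?_ hev
    have hψ : ContDiffAt ℝ ∞ (e₀ ∘ e₁.symm) z :=
      contDiffAt_trans he₁ he₀ (C.overlap_subset_transDom x₁ x₀ hov)
    have hψz : (e₀ ∘ e₁.symm) z ∈ C.overlap x₀ x₁ := C.chart_mem_overlap h hz.2
    have hT' : ContDiffAt ℝ ∞ T ((e₀ ∘ e₁.symm) z) :=
      hT.contDiffAt ((C.isOpen_overlap x₀ x₁).mem_nhds hψz)
    exact (hT'.comp z hψ).clm_apply ((hφ.contDiffAt.comp z hψ).smul (hg.contDiffAt.comp z hψ))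
  · have hK := (isCompact_supportAt hc hs).isClosed
    have hev : C.rep (coordSection V x₀ fun z => φ z • g z) x₁ =ᶠ[𝓝 z] fun _ => 0 := by
      filter_upwards [(e₁.continuousAt_symm hz.1).eventually
        (hK.isOpen_compl.mem_nhds fun h' => h (supportAt_subset hs h'))] with z' hz'
      have : coordSection V x₀ (fun z => φ z • g z) (e₁.symm z') = 0 := by
        rw [coordSection]
        split_ifs with h'
        · rw [eq_zero_of_notMem_supportAt h'.1 hz', zero_smul, map_zero]
        · rfl
      change C.coord x₁ _ (coordSection V x₀ (fun z => φ z • g z) (e₁.symm z')) = 0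
      rw [this, map_zero]
    exact contDiffAt_const.congr_of_eventuallyEq hev

end Sections

/-! ### Evaluation of the perturbation, representation and consistency -/

section Perturbation

open LocalCoords FormValued

variable {d : ℕ} {X : Type*} [TopologicalSpace X] [ChartedSpace (Model d) X]
  {V : X → Type*} [∀ x, AddCommGroup (V x)] [∀ x, Module ℝ (V x)]
  {F : Type*} [NormedAddCommGroup F] [NormedSpace ℝ F] {W : LocalCoords d V F}
  [T2Space X] [IsManifold 𝓘(ℝ, Model d) ∞ X]
  (hW : W.SmoothTransition (ContinuousLinearMap.id ℝ F)) (k : ℕ) {x₀ : X} {φ : Model d → ℝ}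
  (hφ : ContDiff ℝ ∞ φ) (hc : HasCompactSupport φ) (hs : tsupport φ ⊆ W.coordDom x₀)
  (l : F →L[ℝ] ℝ)

theorem bumpTraction_jetAt (w : W.CkSection k) {y : X} (hy : y ∈ W.dom x₀)
    (v : Fin d → TangentSpace 𝓘(ℝ, Model d) y) :
    (bumpTraction hW k hφ hc hs l).toFun y (W.jetAt k y w) v =
      φ (chartAt (Model d) x₀ y) * l (W.rep w.1 x₀ (chartAt (Model d) x₀ y)) *
        tailForm d (fun i => chartDeriv (chartAt (Model d) x₀) y (v i)) := by
  have h := coordCoeff_jetProj₀ (C := W) (x₀ := x₀) (μ := fun z => φ z • l)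
    (L := ContinuousLinearMap.id ℝ F) k w y
  rw [coordCoeff_of_mem _ _ hy, ← LocalCoords.rep_chart _ hy] at h
  exact congrArg (· * _) h

/-- The value on the coordinate frame shows both contributions, of the value and of the derivative
of `w`. A suitable test section isolates the second one. -/
theorem bumpBody_jetAt (w : W.CkSection (k + 1 : ℕ)) {z : Model d} (hz : z ∈ W.coordDom x₀) :
    (bumpBody hW k hφ hc hs l).toFun ((chartAt (Model d) x₀).symm z)
        (W.jetAt (k + 1) ((chartAt (Model d) x₀).symm z) w) (frame (chartAt (Model d) x₀) z) =
      -(fderiv ℝ φ z (stdVec 0) * l (W.rep w.1 x₀ z) +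
        φ z * l (fderiv ℝ (W.rep w.1 x₀) z (stdVec 0))) := by
  have h := coordCoeff_jetProj₀ (C := W) (x₀ := x₀) (μ := fun z => fderiv ℝ φ z (stdVec 0) • l)
    (L := ContinuousLinearMap.id ℝ F) (k + 1) w ((chartAt (Model d) x₀).symm z)
  have h2 := coordCoeff_symm (C := W) (x₀ := x₀) (μ := fun z => fderiv ℝ φ z (stdVec 0) • l)
    (L := ContinuousLinearMap.id ℝ F) w.1 hz
  have h3 := coordCoeff_jetProj₁ (C := W) (x₀ := x₀) (μ := fun z => φ z • l)
    (L := ContinuousLinearMap.id ℝ F) k (stdVec 0) w hz.2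
  rw [(chartAt (Model d) x₀).right_inv hz.1] at h3
  have he : chartAt (Model d) x₀ ∈ IsManifold.maximalAtlas 𝓘(ℝ, Model d) ∞ X :=
    IsManifold.chart_mem_maximalAtlas _
  change -(_ * volForm d (fun i => chartDeriv (chartAt (Model d) x₀) _ (frame _ z i)) +
    _ * volForm d (fun i => chartDeriv (chartAt (Model d) x₀) _ (frame _ z i))) = _
  simp only [chartDeriv_frame_self he hz.1]
  have hv : volForm d (fun i => stdVec i) = 1 := volForm_stdVec
  rw [hv, mul_one, mul_one]
  exact congrArg₂ (fun a b => -(a + b)) (h.trans h2) h3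

variable [SigmaCompactSpace X] (o : OrientationForm d X)

/-- Adding `bumpStress` to a stress adds `bumpBody` and `bumpTraction` to the system that it
represents. -/
theorem represents_add_bump {P : NonHolonomicStress W (k + 1)} {f : HyperForceSystem W (k + 1)}
    (hP : P.Represents o f) {σ : TractionHyperStress W (k + 1)}
    (hσ : ∀ (R : Subbody d X) (x : frontier R.carrier) (a : W.Jet (k + 1) (x : X))
      (v : Fin d → R.bdryTangent (x : X)),
      f.traction R x a v = σ.toFun x a (fun l => (v l : TangentSpace 𝓘(ℝ, Model d) (x : X)))) :
    (P + bumpStress hW k hφ hc hs l).Represents o (HyperForceSystem.ofTractionStress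
      (f.body + bumpBody hW k hφ hc hs l) (σ + bumpTraction hW (k + 1) hφ hc hs l)) := by
  intro R A
  have hA0 : A.1 ∈ (W.jetCoords (k + 1)).CkSection 0 :=
    (W.jetCoords (k + 1)).CkSection_mono (by simp) A.2
  have hjA := (W.jetCoords (k + 1)).jetAt_mem_CkSection_zero 1 A
  have h1 : R.integral o (fun x => (f.body + bumpBody hW k hφ hc hs l).toFun x (A.1 x)) =
      R.integral o (fun x => f.body.toFun x (A.1 x)) +
      R.integral o (fun x => (bumpBody hW k hφ hc hs l).toFun x (A.1 x)) :=
    Subbody.integral_add (f.body.contForm hA0) ((bumpBody hW k hφ hc hs l).contForm hA0)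
  have h2 : R.integral o (fun x => (P + bumpStress hW k hφ hc hs l).toFun x
        ((W.jetCoords (k + 1)).jetAt 1 x A)) =
      R.integral o (fun x => P.toFun x ((W.jetCoords (k + 1)).jetAt 1 x A)) +
      R.integral o (fun x => (bumpStress hW k hφ hc hs l).toFun x
        ((W.jetCoords (k + 1)).jetAt 1 x A)) :=
    Subbody.integral_add (P.contForm hjA) ((bumpStress hW k hφ hc hs l).contForm hjA)
  -- The pointwise identity, integrated: the exterior derivative of the traction term is the added
  -- stress minus the added body hyper-force.
  have h3 : R.integral o (volField (chartAt (Model d) x₀)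
      (firstPartial (chartAt (Model d) x₀) (bumpValue W (k + 1) x₀ φ l A.1))) =
      R.integral o (fun x => (bumpStress hW k hφ hc hs l).toFun x
        ((W.jetCoords (k + 1)).jetAt 1 x A)) +
      -R.integral o (fun x => (bumpBody hW k hφ hc hs l).toFun x (A.1 x)) := by
    have hb : ContForm fun x => -(bumpBody hW k hφ hc hs l).toFun x (A.1 x) :=
      (-bumpBody hW k hφ hc hs l).contForm hA0
    have hpt := funext fun y => eq_add_neg_of_add_eq (bump_identity hW k hφ hc hs l A y)
    rw [← Subbody.integral_neg, hpt]
    exact Subbody.integral_add ((bumpStress hW k hφ hc hs l).contForm hjA) hb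
  have h4 : R.bdryIntegral o (fun x => (HyperForceSystem.ofTractionStress
        (f.body + bumpBody hW k hφ hc hs l) (σ + bumpTraction hW (k + 1) hφ hc hs l)).traction R x
          (A.1 x)) =
      R.bdryIntegral o (R.restrictBdry fun x => σ.toFun x (A.1 x)) +
      R.bdryIntegral o (R.restrictBdry fun x =>
        (bumpTraction hW (k + 1) hφ hc hs l).toFun x (A.1 x)) := by
    rw [HyperForceSystem.restrictBdry_tractionStress]
    simp only [add_toFun_apply]
    exact Subbody.bdryIntegral_restrictBdry_add (σ.contForm hA0)
      ((bumpTraction hW (k + 1) hφ hc hs l).contForm hA0)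
  -- Locality of the given system enters here: its tractions are restrictions of one field `σ`, so
  -- they add to those of the bump.
  have h5 : (fun x : frontier R.carrier => f.traction R x (A.1 x)) =
      R.restrictBdry fun x => σ.toFun x (A.1 x) := by
    funext x
    ext v
    exact hσ R x (A.1 x) v
  have h6 := hP R A
  rw [HyperForceSystem.power, h5] at h6
  have h7 := bdryIntegral_bumpTraction hW (k + 1) hφ hc hs l o R A
  have key : ∀ {b c e g h i : ℝ}, c + g = i → h = e + -b → c + b + (g + h) = i + e := by
    rintro b c e g h i rfl rfl
    ring
  exact (congrArg₂ (· + ·) h1 h4).trans ((key h6 (h7.trans h3)).trans h2.symm)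

/-- Locality and regularity hold by construction. For boundedness, the representation itself
expresses the boundary integral as a volume integral of a smooth density in `j¹u`. -/
theorem isConsistent_ofTractionStress {P : NonHolonomicStress W k}
    {b : BodyHyperForce W k} {σ : TractionHyperStress W k}
    (hP : P.Represents o (HyperForceSystem.ofTractionStress b σ)) :
    (HyperForceSystem.ofTractionStress b σ).IsConsistent o where
  local_regular := ⟨σ, fun _ _ _ _ => rfl⟩
  bounded := by
    -- The bounding field is `P - b`, with `b` lifted to act on first jets through the value
    -- component.
    refine ⟨P + -b.onJets (W.separating_jetCoords k) 1, fun R u => ?_⟩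
    set A : (W.jetCoords k).CkSection (1 : ℕ) :=
      Submodule.inclusion ((W.jetCoords k).CkSection_mono (by exact_mod_cast le_top)) u
    have hjA := (W.jetCoords k).jetAt_mem_CkSection_zero 1 A
    have h := hP R A
    have h1 : R.integral o (fun x => (P + -b.onJets (W.separating_jetCoords k) 1).toFun x
        ((W.jetCoords k).jetAt 1 x A)) =
        R.integral o (fun x => P.toFun x ((W.jetCoords k).jetAt 1 x A)) +
        -R.integral o (fun x => b.toFun x (A.1 x)) := by
      rw [← Subbody.integral_neg]
      exact Subbody.integral_add (P.contForm hjA)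
        ((-b.onJets (W.separating_jetCoords k) 1).contForm hjA)
    refine le_trans (le_of_eq ?_) (R.abs_integral_le (o := o) _)
    rw [h1, ← h]
    change |_| = |R.integral o (fun x => b.toFun x (A.1 x)) + _ + _|
    rw [add_neg_cancel_comm]
    rfl

end Perturbation

/-! ### Coordinate cubes as subbodies -/

section Cube

variable {d : ℕ}

/-- The closed cube with centre `a` and half side `r`. -/
def cube (a : Model d) (r : ℝ) : Set (Model d) := {z | ∀ i, |z i - a i| ≤ r}

theorem isCompact_cube (a : Model d) (r : ℝ) : IsCompact (cube a r) := by
  have h : cube a r = WithLp.ofLp ⁻¹' (Set.pi univ fun i => Metric.closedBall (a i) r) := by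
    ext z
    simp [cube, Real.dist_eq]
  rw [h]
  exact (PiLp.homeomorph 2 fun _ : Fin (d + 1) => ℝ).isClosedEmbedding.isCompact_preimage
    (isCompact_univ_pi fun i => isCompact_closedBall _ _)

/-- The crude bound `√(d + 1) ≤ d + 1` avoids square roots when the half side is chosen. -/
theorem cube_subset_closedBall (a : Model d) {r : ℝ} (hr : 0 ≤ r) :
    cube a r ⊆ Metric.closedBall a ((d + 1) * r) := by
  intro z hz
  rw [Metric.mem_closedBall, dist_eq_norm, EuclideanSpace.norm_eq]
  have h : ∑ i, ‖(z - a) i‖ ^ 2 ≤ ((d + 1) * r) ^ 2 := by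
    calc ∑ i, ‖(z - a) i‖ ^ 2 ≤ ∑ _i : Fin (d + 1), r ^ 2 :=
          Finset.sum_le_sum fun i _ => pow_le_pow_left₀ (norm_nonneg _) (hz i) 2
      _ = (d + 1) * r ^ 2 := by simp
      _ ≤ ((d + 1) * r) ^ 2 := by
          have : (1 : ℝ) ≤ d + 1 := by linarith [d.cast_nonneg (α := ℝ)]
          rw [mul_pow]
          exact mul_le_mul_of_nonneg_right (by nlinarith) (sq_nonneg r)
  exact Real.sqrt_le_iff.mpr ⟨by positivity, h⟩

/-- The affine coordinates `± (z i - a i) - r`, in which a corner of the cube is at the origin. -/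
def cornerHomeomorph (a : Model d) (r : ℝ) (σ : Fin (d + 1) → ℤˣ) : Model d ≃ₜ Model d where
  toFun z := WithLp.toLp 2 fun i => (σ i : ℤ) * (z i - a i) - r
  invFun u := WithLp.toLp 2 fun i => (σ i : ℤ) * (u i + r) + a i
  left_inv z := by
    ext i
    rcases Int.units_eq_one_or (σ i) with h | h <;> simp [h]
  right_inv u := by
    ext i
    rcases Int.units_eq_one_or (σ i) with h | h <;> simp [h]
  continuous_toFun := by fun_prop
  continuous_invFun := by fun_prop

theorem cornerHomeomorph_apply (a : Model d) (r : ℝ) (σ : Fin (d + 1) → ℤˣ) (z : Model d)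
    (i : Fin (d + 1)) : cornerHomeomorph a r σ z i = (σ i : ℤ) * (z i - a i) - r := rfl

theorem contDiff_cornerHomeomorph (a : Model d) (r : ℝ) (σ : Fin (d + 1) → ℤˣ) :
    ContDiff ℝ ∞ (cornerHomeomorph a r σ) := by
  rw [contDiff_euclidean]
  intro i
  simp only [cornerHomeomorph_apply]
  fun_prop

theorem contDiff_cornerHomeomorph_symm (a : Model d) (r : ℝ) (σ : Fin (d + 1) → ℤˣ) :
    ContDiff ℝ ∞ (cornerHomeomorph a r σ).symm := by
  rw [contDiff_euclidean]
  intro i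
  change ContDiff ℝ ∞ fun u : Model d => (σ i : ℤ) * (u i + r) + a i
  fun_prop

/-- The signs for which all coordinates of `cornerHomeomorph` are `|z i - a i| - r` at `p`. -/
def cornerSign (a p : Model d) (i : Fin (d + 1)) : ℤˣ := if a i ≤ p i then 1 else -1

theorem cornerHomeomorph_cornerSign (a p : Model d) (r : ℝ) (i : Fin (d + 1)) :
    cornerHomeomorph a r (cornerSign a p) p i = |p i - a i| - r := by
  rw [cornerHomeomorph_apply, cornerSign]
  split_ifs with h
  · rw [abs_of_nonneg (sub_nonneg.mpr h)]; simp
  · rw [abs_of_nonpos (by linarith)]; simp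

theorem abs_le_iff_cornerHomeomorph (a : Model d) (r : ℝ) (σ : Fin (d + 1) → ℤˣ) (z : Model d)
    (i : Fin (d + 1)) : |z i - a i| ≤ r ↔
      -(2 * r) ≤ cornerHomeomorph a r σ z i ∧ cornerHomeomorph a r σ z i ≤ 0 := by
  rw [cornerHomeomorph_apply, abs_le]
  rcases Int.units_eq_one_or (σ i) with h | h <;> simp only [h] <;> push_cast <;>
    constructor <;> rintro ⟨h1, h2⟩ <;> constructor <;> linarith

variable {X : Type*} [TopologicalSpace X]

/-- The chart composed with `cornerHomeomorph`, near the point with coordinates `p`. -/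
def cubeChart (e : OpenPartialHomeomorph X (Model d)) (a : Model d) (r : ℝ) (p : Model d) :
    OpenPartialHomeomorph X (Model d) :=
  (e.trans (cornerHomeomorph a r (cornerSign a p)).toOpenPartialHomeomorph).restr
    (e.source ∩ e ⁻¹' {z | ∀ i, -(2 * r) < cornerHomeomorph a r (cornerSign a p) z i ∧
      (|p i - a i| < r → cornerHomeomorph a r (cornerSign a p) z i < 0)})

theorem isOpen_cubeChart_aux (a : Model d) (r : ℝ) (p : Model d) :
    IsOpen {z : Model d | ∀ i, -(2 * r) < cornerHomeomorph a r (cornerSign a p) z i ∧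
      (|p i - a i| < r → cornerHomeomorph a r (cornerSign a p) z i < 0)} := by
  have hc : ∀ i, Continuous fun z => cornerHomeomorph a r (cornerSign a p) z i := fun i =>
    (EuclideanSpace.proj i : Model d →L[ℝ] ℝ).continuous.comp
      (cornerHomeomorph a r (cornerSign a p)).continuous
  simp only [ofPred_forall]
  refine isOpen_iInter_of_finite fun i => ?_
  by_cases h : |p i - a i| < r
  · simp only [h, true_imp_iff]
    exact (isOpen_lt continuous_const (hc i)).inter (isOpen_lt (hc i) continuous_const)
  · simp only [h, false_imp_iff, and_true]
    exact isOpen_lt continuous_const (hc i)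

theorem cubeChart_source (e : OpenPartialHomeomorph X (Model d)) (a : Model d) (r : ℝ)
    (p : Model d) : (cubeChart e a r p).source = e.source ∩ e ⁻¹' {z | ∀ i,
      -(2 * r) < cornerHomeomorph a r (cornerSign a p) z i ∧
      (|p i - a i| < r → cornerHomeomorph a r (cornerSign a p) z i < 0)} := by
  rw [cubeChart, OpenPartialHomeomorph.restr_source,
    (e.isOpen_inter_preimage (isOpen_cubeChart_aux a r p)).interior_eq]
  simp [← inter_assoc]

variable [ChartedSpace (Model d) X]

theorem cubeChart_mem_maximalAtlas [IsManifold 𝓘(ℝ, Model d) ∞ X]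
    {e : OpenPartialHomeomorph X (Model d)} (he : e ∈ IsManifold.maximalAtlas 𝓘(ℝ, Model d) ∞ X)
    (a : Model d) (r : ℝ) (p : Model d) :
    cubeChart e a r p ∈ IsManifold.maximalAtlas 𝓘(ℝ, Model d) ∞ X := by
  refine OpenPartialHomeomorph.mem_maximalAtlas_of_contMDiffOn (I := 𝓘(ℝ, Model d)) _ ?_ ?_
  · refine (contDiff_cornerHomeomorph a r (cornerSign a p)).contMDiff.comp_contMDiffOn
      ((contMDiffOn_of_mem_maximalAtlas he).mono ?_)
    rw [cubeChart_source]
    exact inter_subset_left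
  · refine (contMDiffOn_symm_of_mem_maximalAtlas he).comp
      (contDiff_cornerHomeomorph_symm a r (cornerSign a p)).contMDiff.contMDiffOn fun u hu => ?_
    have := hu.1
    rw [OpenPartialHomeomorph.trans_target] at this
    exact this.2

/-- The adapted charts of a cube in the coordinates of a chart. -/
def cubeCornerChart [IsManifold 𝓘(ℝ, Model d) ∞ X]
    {e : OpenPartialHomeomorph X (Model d)} (he : e ∈ IsManifold.maximalAtlas 𝓘(ℝ, Model d) ∞ X)
    {a : Model d} {r : ℝ} (hr : 0 < r) (hc : cube a r ⊆ e.target) {p : Model d}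
        (hp : p ∈ cube a r) :
    CornerChart (d := d) (e.symm '' cube a r) (e.symm p) where
  e := cubeChart e a r p
  mem_maximalAtlas := cubeChart_mem_maximalAtlas he a r p
  mem_source := by
    rw [cubeChart_source]
    refine ⟨e.map_target (hc hp), ?_⟩
    rw [mem_preimage, e.right_inv (hc hp)]
    intro i
    rw [cornerHomeomorph_cornerSign]
    exact ⟨by linarith [abs_nonneg (p i - a i)], fun h => by linarith⟩
  s := Finset.univ.filter fun i => ¬ |p i - a i| < r
  eq_zero i hi := by
    change cornerHomeomorph a r (cornerSign a p) (e (e.symm p)) i = 0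
    rw [e.right_inv (hc hp), cornerHomeomorph_cornerSign]
    have := (Finset.mem_filter.mp hi).2
    linarith [hp i, not_lt.mp this]
  mem_iff y hy := by
    rw [cubeChart_source] at hy
    have h1 : y ∈ e.symm '' cube a r ↔ e y ∈ cube a r := by
      constructor
      · rintro ⟨z, hz, rfl⟩
        rwa [e.right_inv (hc hz)]
      · exact fun h => ⟨_, h, e.left_inv hy.1⟩
    rw [h1]
    change _ ↔ ∀ i ∈ _, cornerHomeomorph a r (cornerSign a p) (e y) i ≤ 0
    constructor
    · exact fun h i _ => ((abs_le_iff_cornerHomeomorph a r (cornerSign a p) (e y) i).mp (h i)).2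
    -- The restriction of the chart supplies what `s` does not: the bound `-(2 * r)` excludes the
    -- opposite faces, and the coordinates of faces not containing `p` stay negative.
    · intro h i
      refine (abs_le_iff_cornerHomeomorph a r (cornerSign a p) (e y) i).mpr ⟨(hy.2 i).1.le, ?_⟩
      by_cases hi : |p i - a i| < r
      · exact ((hy.2 i).2 hi).le
      · exact h i (Finset.mem_filter.mpr ⟨Finset.mem_univ i, hi⟩)

/-- A cube in the coordinates of a chart. -/
def cubeSubbody [IsManifold 𝓘(ℝ, Model d) ∞ X]
    {e : OpenPartialHomeomorph X (Model d)} (he : e ∈ IsManifold.maximalAtlas 𝓘(ℝ, Model d) ∞ X)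
    {a : Model d} {r : ℝ} (hr : 0 < r) (hc : cube a r ⊆ e.target) : Subbody d X where
  carrier := e.symm '' cube a r
  isCompact := (isCompact_cube a r).image_of_continuousOn (e.continuousOn_symm.mono hc)
  exists_chart := by
    rintro _ ⟨p, hp, rfl⟩
    exact ⟨cubeCornerChart he hr hc hp⟩

/-- The centre of a face of the cube. -/
def faceCentre (a : Model d) (r : ℝ) : Model d := a + r • stdVec 0

theorem faceCentre_mem_cube (a : Model d) {r : ℝ} (hr : 0 < r) : faceCentre a r ∈ cube a r := by
  intro i
  by_cases h : i = 0
  · subst h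
    simp [faceCentre, abs_of_pos hr]
  · simp [faceCentre, h, hr.le]

theorem abs_faceCentre_sub (a : Model d) {r : ℝ} (hr : 0 < r) (i : Fin (d + 1)) :
    |faceCentre a r i - a i| = if i = 0 then r else 0 := by
  split_ifs with h
  · subst h
    simp [faceCentre, abs_of_pos hr]
  · simp [faceCentre, h]

/-- At this point all signs are `+1`, since equality `a i = p i` counts as positive. The adapted
chart is thus a translate of the original one. -/
theorem cornerHomeomorph_faceCentre_symm (a : Model d) {r : ℝ} (hr : 0 < r) :
    ⇑(cornerHomeomorph a r (cornerSign a (faceCentre a r))).symm =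
      fun u => u + WithLp.toLp 2 fun i => r + a i := by
  funext u
  ext i
  have hσ : cornerSign a (faceCentre a r) i = 1 := by
    rw [cornerSign, if_pos]
    by_cases h : i = 0
    · subst h
      simp [faceCentre, hr.le]
    · simp [faceCentre, h]
  change (((cornerSign a (faceCentre a r) i : ℤˣ) : ℤ) : ℝ) * (u i + r) + a i = u i + (r + a i)
  rw [hσ]
  push_cast
  ring

/-- A cube has a boundary point at which the coordinate vectors other than the first are tangent
to the boundary. -/
theorem exists_frontier_cubeSubbody [IsManifold 𝓘(ℝ, Model d) ∞ X]
    {e : OpenPartialHomeomorph X (Model d)} (he : e ∈ IsManifold.maximalAtlas 𝓘(ℝ, Model d) ∞ X)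
    {a : Model d} {r : ℝ} (hr : 0 < r) (hc : cube a r ⊆ e.target) :
    ∃ (x : frontier (cubeSubbody he hr hc).carrier)
      (v : Fin d → (cubeSubbody he hr hc).bdryTangent (x : X)), (x : X) ∈ e.symm '' cube a r ∧
      ∀ l, chartDeriv e (x : X) (v l : TangentSpace 𝓘(ℝ, Model d) (x : X)) = stdVec l.succ := by
  set R := cubeSubbody he hr hc
  set q := faceCentre a r
  have hq : q ∈ cube a r := faceCentre_mem_cube a hr
  let c : CornerChart (d := d) R.carrier (e.symm q) := cubeCornerChart he hr hc hq
  set u := c.e (e.symm q) with hu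
  have hut : u ∈ c.e.target := c.e.map_source c.mem_source
  have hx : c.e.symm u = e.symm q := c.e.left_inv c.mem_source
  have hmem : c.e.symm u ∈ R.carrier := by rw [hx]; exact ⟨q, hq, rfl⟩
  have h0 : (0 : Fin (d + 1)) ∈ c.s := by
    refine Finset.mem_filter.mpr ⟨Finset.mem_univ _, ?_⟩
    rw [abs_faceCentre_sub a hr, if_pos rfl]
    exact lt_irrefl r
  have hs : ∀ j ∈ c.s, j ≠ 0 → u j < 0 := by
    intro j hj hj0
    refine absurd ?_ (Finset.mem_filter.mp hj).2
    rwa [abs_faceCentre_sub a hr, if_neg hj0]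
  have hu0 : u 0 = 0 := c.eq_zero 0 h0
  refine ⟨⟨c.e.symm u, c.symm_mem_frontier hut hmem h0 hu0⟩,
    fun l => ⟨frame c.e u l.succ, R.frame_mem_bdryTangent c hut hu0 hs (Fin.succ_ne_zero l)⟩,
    hmem, fun l => ?_⟩
  have hut' : u ∈ transDom c.e e := by
    refine ⟨hut, ?_⟩
    rw [mem_preimage, hx]
    exact e.map_target (hc hq)
  refine (chartDeriv_frame c.mem_maximalAtlas he hut' l.succ).trans ?_
  -- The transition map is a translation near the point, with derivative the identity; tangent frame
  -- vectors of the adapted chart are therefore coordinate vectors of `e`.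
  have hev : e ∘ c.e.symm =ᶠ[𝓝 u] fun u => u + WithLp.toLp 2 fun i => r + a i := by
    filter_upwards [c.e.open_target.mem_nhds hut] with u' hu'
    refine Eq.trans ?_ (congrFun (cornerHomeomorph_faceCentre_symm a hr) u')
    have := hu'.1
    rw [OpenPartialHomeomorph.trans_target] at this
    exact e.right_inv this.2
  rw [hev.fderiv_eq, fderiv_add_const, fderiv_fun_id]
  rfl

end Cube

/-! ### Determination of the forces and indeterminacy of the hyper-forces -/

section Indeterminacy

open FormValued

variable {d : ℕ} {X : Type*} [TopologicalSpace X] [T2Space X] [SigmaCompactSpace X]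
  [ChartedSpace (Model d) X] [IsManifold 𝓘(ℝ, Model d) ∞ X] (o : OrientationForm d X)
  {F : Type*} [NormedAddCommGroup F] [NormedSpace ℝ F]

theorem force_eq_integral {V : X → Type*} [∀ x, AddCommGroup (V x)] [∀ x, Module ℝ (V x)]
    {W : LocalCoords d V F} {k : ℕ} {S : VariationalHyperStress W (k + 1)}
    {P : NonHolonomicStress W k} {f : HyperForceSystem W k} (hS : S.ConsistentWith P)
    (hP : P.RepresentsForces o f) (R : Subbody d X) (w : W.CkSection (k + 1 : ℕ)) :
    f.force o R w = R.integral o fun x => S.toFun x (W.jetAt (k + 1) x w) := by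
  rw [hP R w]
  congr 1
  funext x
  rw [hS x]
  rfl

theorem exists_bump {d : ℕ} {X : Type*} [TopologicalSpace X] [ChartedSpace (Model d) X]
    {J : X → Type*} [∀ x, AddCommGroup (J x)] [∀ x, Module ℝ (J x)]
    {M : Type*} [NormedAddCommGroup M] [NormedSpace ℝ M] (C : LocalCoords d J M) (x₀ : X) :
        ∃ (φ : Model d → ℝ) (δ : ℝ), 0 < δ ∧ ContDiff ℝ ∞ φ ∧
    HasCompactSupport φ ∧ tsupport φ ⊆ C.coordDom x₀ ∧
    Metric.closedBall (chartAt (Model d) x₀ x₀) δ ⊆ C.coordDom x₀ ∧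
    ∀ z ∈ Metric.closedBall (chartAt (Model d) x₀ x₀) δ, φ z = 1 := by
  obtain ⟨ε, hε, h⟩ := Metric.nhds_basis_closedBall.mem_iff.mp
    ((C.isOpen_coordDom x₀).mem_nhds
      (C.chart_mem_coordDom (C.mem_dom x₀)))
  let φ : ContDiffBump (chartAt (Model d) x₀ x₀) := ⟨ε / 2, ε, by positivity, by linarith⟩
  exact ⟨φ, ε / 2, by positivity, φ.contDiff, φ.hasCompactSupport, by rw [φ.tsupport_eq]; exact h,
    (Metric.closedBall_subset_closedBall (by linarith)).trans h,
    fun z hz => φ.one_of_mem_closedBall hz⟩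

variable {V : X → Type*} [∀ x, AddCommGroup (V x)] [∀ x, Module ℝ (V x)]
  [∀ x, TopologicalSpace (V x)] [TopologicalSpace (Bundle.TotalSpace F V)]
  [FiberBundle F V] [VectorBundle ℝ F V] [ContMDiffVectorBundle ∞ F V 𝓘(ℝ, Model d)]

variable (F V) in
omit [SigmaCompactSpace X] in
theorem exists_section_of_rep {x₀ : X} {φ : Model d → ℝ} (hφ : ContDiff ℝ ∞ φ)
    (hc : HasCompactSupport φ) (hs : tsupport φ ⊆ (bundleCoords d F V).coordDom x₀)
    {g : Model d → F} (hg : ContDiff ℝ ∞ g) (k : ℕ) :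
    ∃ w : (bundleCoords d F V).CkSection k, ∀ z ∈ (bundleCoords d F V).coordDom x₀,
      (bundleCoords d F V).rep w.1 x₀ z = φ z • g z :=
  ⟨⟨_, (bundleCoords d F V).CkSection_mono (by exact_mod_cast le_top)
    (coordSection_mem_CkSection hφ hg hc hs)⟩, fun _ hz => rep_coordSection (fun z => φ z • g z) hz⟩

/-- The perturbation `(β, τ, Q)` of the overview is added. Since it is known explicitly on jets of
sections of the bundle, two test sections suffice to show that it changes the body hyper-force and
some traction. -/
theorem exists_same_hyperStress [Nonempty X] [Nontrivial F] {k : ℕ}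
    {S : VariationalHyperStress (bundleCoords d F V) (k + 2)}
    {P : NonHolonomicStress (bundleCoords d F V) (k + 1)}
    {f : HyperForceSystem (bundleCoords d F V) (k + 1)} (hS : S.ConsistentWith P)
    (hP : P.Represents o f) (hf : f.IsConsistent o) :
    ∃ (P' : NonHolonomicStress (bundleCoords d F V) (k + 1))
      (f' : HyperForceSystem (bundleCoords d F V) (k + 1)),
      S.ConsistentWith P' ∧ P'.Represents o f' ∧ f'.IsConsistent o ∧
      f'.body.toFun ≠ f.body.toFun ∧
      ∃ (R : Subbody d X) (x : frontier R.carrier), f'.traction R x ≠ f.traction R x := by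
  obtain ⟨x₀⟩ := ‹Nonempty X›
  obtain ⟨c, hc0⟩ := exists_ne (0 : F)
  obtain ⟨l, hl⟩ := SeparatingDual.exists_ne_zero (R := ℝ) hc0
  obtain ⟨φ, δ, hδ, hφ, hc, hs, hball, h1⟩ := exists_bump (bundleCoords d F V) x₀
  obtain ⟨σ, hσ⟩ := hf.local_regular
  have hW : (bundleCoords d F V).SmoothTransition (ContinuousLinearMap.id ℝ F) :=
    LocalCoords.smoothTransition_bundleCoords
  have he : chartAt (Model d) x₀ ∈ IsManifold.maximalAtlas 𝓘(ℝ, Model d) ∞ X :=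
    IsManifold.chart_mem_maximalAtlas _
  have hrep := represents_add_bump hW k hφ hc hs l o hP hσ
  refine ⟨_, _, ?_, hrep, isConsistent_ofTractionStress _ o hrep, ?_, ?_⟩
  · intro x
    have h := bumpStress_holonomic hW k hφ hc hs l x
    rw [add_toFun, LinearMap.add_comp, h, add_zero]
    exact hS x
  · intro h
    set a := chartAt (Model d) x₀ x₀ with ha
    have haD : a ∈ (bundleCoords d F V).coordDom x₀ := hball (Metric.mem_closedBall_self hδ.le)
    -- The test section vanishes at `a` and has first partial derivative `c` there. The term with
    -- the derivative of `φ` drops out, and the added body hyper-force takes the value `-l c ≠ 0`.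
    have hg : ContDiff ℝ ∞ fun z : Model d => (z 0 - a 0) • c := by fun_prop
    obtain ⟨w, hw⟩ := exists_section_of_rep F V hφ hc hs hg (k + 1)
    have hb := bumpBody_jetAt hW k hφ hc hs l w haD
    have h0 := congrArg (fun t => t ((bundleCoords d F V).jetAt (k + 1) _ w)
      (frame (chartAt (Model d) x₀) a)) (congrFun h ((chartAt (Model d) x₀).symm a))
    have h2 : f.body.toFun _ ((bundleCoords d F V).jetAt (k + 1) _ w)
        (frame (chartAt (Model d) x₀) a) + (bumpBody hW k hφ hc hs l).toFun _
        ((bundleCoords d F V).jetAt (k + 1) _ w) (frame (chartAt (Model d) x₀) a) =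
      f.body.toFun _ ((bundleCoords d F V).jetAt (k + 1) _ w)
        (frame (chartAt (Model d) x₀) a) := h0
    rw [add_eq_left, hb] at h2
    have hev : (bundleCoords d F V).rep w.1 x₀ =ᶠ[𝓝 a] fun z => (z 0 - a 0) • c := by
      filter_upwards [Metric.closedBall_mem_nhds a hδ] with z hz
      rw [hw z (hball hz), h1 z hz, one_smul]
    have hd : HasFDerivAt (fun z : Model d => (z 0 - a 0) • c)
        ((EuclideanSpace.proj 0 : Model d →L[ℝ] ℝ).smulRight c) a :=
      ((EuclideanSpace.proj 0 : Model d →L[ℝ] ℝ).hasFDerivAt.sub_const (a 0)).smul_const c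
    rw [hev.eq_of_nhds, hev.fderiv_eq, hd.fderiv, h1 a (Metric.mem_closedBall_self hδ.le)] at h2
    exact hl (by simpa using h2)
  · have hd : (0 : ℝ) < d + 1 := by positivity
    -- This half side places the cube in the ball of radius `δ` on which `φ = 1`.
    have hr : 0 < δ / (d + 1) := by positivity
    have hcube : cube (chartAt (Model d) x₀ x₀) (δ / (d + 1)) ⊆
        Metric.closedBall (chartAt (Model d) x₀ x₀) δ := by
      refine (cube_subset_closedBall _ hr.le).trans (Metric.closedBall_subset_closedBall ?_)
      rw [mul_div_cancel₀ _ hd.ne']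
    have hct := hcube.trans (hball.trans inter_subset_left)
    obtain ⟨x, v, hx, hv⟩ := exists_frontier_cubeSubbody he hr hct
    refine ⟨cubeSubbody he hr hct, x, fun h => hl ?_⟩
    -- On a constant representative `c`, at a point of the cube and on the vectors dual to `dz₂, …,
    -- dzₙ`, the added traction takes the value `l c ≠ 0`.
    obtain ⟨w, hw⟩ := exists_section_of_rep F V hφ hc hs (contDiff_const (c := c)) (k + 1)
    obtain ⟨z, hz, hzx⟩ := hx
    have hz' := hcube hz
    have hez : chartAt (Model d) x₀ x = z := by
      rw [← hzx, (chartAt (Model d) x₀).right_inv (hball hz').1]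
    have hxd : (x : X) ∈ (bundleCoords d F V).dom x₀ := hzx ▸ (hball hz').2
    have hb := bumpTraction_jetAt hW (k + 1) hφ hc hs l w hxd fun i => v i
    simp only [hv] at hb
    rw [tailForm_stdVec_succ, hez, hw z (hball hz'), h1 z hz'] at hb
    have h2 := congrArg (fun t => t ((bundleCoords d F V).jetAt (k + 1) x w) v) h
    simp only [hσ] at h2
    have h3 : σ.toFun x ((bundleCoords d F V).jetAt (k + 1) x w) (fun i => v i) +
      (bumpTraction hW (k + 1) hφ hc hs l).toFun x ((bundleCoords d F V).jetAt (k + 1) x w)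
        (fun i => v i) = σ.toFun x ((bundleCoords d F V).jetAt (k + 1) x w) (fun i => v i) := h2
    rw [add_eq_left, hb] at h3
    simpa using h3

end Indeterminacy

end HyperStress

end

theorem mainTheorem5 {d : ℕ} {X : Type*} [TopologicalSpace X] [T2Space X] [SigmaCompactSpace X]
    [ChartedSpace (HyperStress.Model d) X] [IsManifold 𝓘(ℝ, HyperStress.Model d) ∞ X]
    (o : HyperStress.OrientationForm d X)
    (F : Type*) [NormedAddCommGroup F] [NormedSpace ℝ F] [FiniteDimensional ℝ F]
    (V : X → Type*) [∀ x, AddCommGroup (V x)] [∀ x, Module ℝ (V x)]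
    [∀ x, TopologicalSpace (V x)] [TopologicalSpace (Bundle.TotalSpace F V)]
    [FiberBundle F V] [VectorBundle ℝ F V]
    [ContMDiffVectorBundle ∞ F V 𝓘(ℝ, HyperStress.Model d)] (k : ℕ) :
    (∀ (S : HyperStress.VariationalHyperStress (HyperStress.bundleCoords d F V) (k + 1))
        (P : HyperStress.NonHolonomicStress (HyperStress.bundleCoords d F V) k)
        (f : HyperStress.HyperForceSystem (HyperStress.bundleCoords d F V) k),
      S.ConsistentWith P → P.RepresentsForces o f →
      ∀ (R : HyperStress.Subbody d X)
        (w : (HyperStress.bundleCoords d F V).CkSection (k + 1 : ℕ)),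
        f.force o R w =
          R.integral o fun x =>
            S.toFun x ((HyperStress.bundleCoords d F V).jetAt (k + 1) x w)) ∧
    (1 ≤ k → Nonempty X → Nontrivial F →
      ∀ (S : HyperStress.VariationalHyperStress (HyperStress.bundleCoords d F V) (k + 1))
        (P : HyperStress.NonHolonomicStress (HyperStress.bundleCoords d F V) k)
        (f : HyperStress.HyperForceSystem (HyperStress.bundleCoords d F V) k),
      S.ConsistentWith P → P.Represents o f → f.IsConsistent o →
      ∃ (P' : HyperStress.NonHolonomicStress (HyperStress.bundleCoords d F V) k)
        (f' : HyperStress.HyperForceSystem (HyperStress.bundleCoords d F V) k),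
        S.ConsistentWith P' ∧ P'.Represents o f' ∧ f'.IsConsistent o ∧
        f'.body.toFun ≠ f.body.toFun ∧
        ∃ (R : HyperStress.Subbody d X) (x : frontier R.carrier),
          f'.traction R x ≠ f.traction R x) := by
  refine ⟨fun S P f hS hP R w => HyperStress.force_eq_integral o hS hP R w, ?_⟩
  intro hk _ _ S P f hS hP hf
  -- The hyper-forces act on jets of order `k`, one below the order of `S`. Writing `k` as a
  -- successor provides the derivative component used by the perturbation.
  obtain ⟨k, rfl⟩ := Nat.exists_eq_add_of_le' hk
  exact HyperStress.exists_same_hyperStress o hS hP hf
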